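/- **Setting.** Let $p,q\in\mathbb N$ with $q\ge 6$ and $2\le p\le 2^{q-2}$. Put $e_{\min}=-2^{q-1}+2$, $e_{\max}=2^{q-1}-1$, let $$\mathbb F=\{\pm(1+i/2^p)2^{e},\ \pm(i/2^p)2^{e_{\min}} : i\in\{0,\dots,2^p-1\},\ e\in\mathbb Z,\ e_{\min}\le e\le e_{\max}\}$$ be the set of finite floats, $\Omega=(2-2^{-p})2^{e_{\max}}$ its largest element, and $\overline{\mathbb F}=\mathbb F\cup\{\infty,-\infty,\mathrm{NaN}\}$. A finite float is called even if its index $i$ is even. Let $\lceil\cdot\rfloor:\mathbb R\to\overline{\mathbb F}$ be rounding to the nearest element of $\mathbb F$, ties to the even one, with $\lceil x\rfloor=\pm\infty$ if $\pm x\ge \Omega+2^{e_{\max}-p-1}$. On $\mathbb F$ put $x\oplus y=\lceil x+y\rfloor$ and $x\otimes y=\lceil xy\rfloor$; non-finite arguments are treated as usual ($\infty\oplus(-\infty)$, $0\otimes(\pm\infty)$ and every operation with a NaN give NaN). Sums $\bigoplus_{i=1}^n x_i$ are evaluated from left to right, starting from $0$. Products of matrices and vectors are formed with $\otimes$ and $\bigoplus$.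 **Activation functions.** Let $\hat\sigma:\mathbb R\to\mathbb R$ be one of $\mathrm{ReLU}(x)=\max(0,x)$; $\mathrm{ELU}(x)=x$ for $x\ge0$ and $e^x-1$ for $x<0$; $\mathrm{GELU}(x)=\frac x2\bigl(1+\frac{2}{\sqrt\pi}\int_0^{x/\sqrt2}e^{-t^2}dt\bigr)$; $\mathrm{Swish}(x)=\frac{x}{1+e^{-x}}$; $\mathrm{Sigmoid}(x)=\frac1{1+e^{-x}}$; $\tanh$. Let $\sigma=\lceil\hat\sigma\rfloor:\overline{\mathbb F}\to\overline{\mathbb F}$ be its rounded version: $\sigma(x)=\lceil\hat\sigma(x)\rfloor$ for $x\in\mathbb F$, $\sigma(\pm\infty)$ is the rounded limit of $\hat\sigma$ at $\pm\infty$, and $\sigma(\mathrm{NaN})=\mathrm{NaN}$. Let $\sigma':\overline{\mathbb F}\to\overline{\mathbb F}$ be the rounded version of the derivative $\hat\sigma'$, defined in the same way, where $\sigma'(0)$ is an arbitrary fixed element of $\mathbb F$ if $\hat\sigma=\mathrm{ReLU}$. Put $$M_\sigma=\begin{cases}2^{e_{\max}-2}&\text{for ReLU, ELU, GELU, Swish},\\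 2^{e_{\max}-1}&\text{for Sigmoid},\tanh,\end{cases}\qquad H_\sigma=\begin{cases}\Omega&\text{for ReLU, ELU, GELU, Swish},\\ 2^{p-1}&\text{for Sigmoid},\\ 2^{p-2}&\text{for }\tanh.\end{cases}$$ **Networks and automatic differentiation.** An $L$-layer $\sigma$ network with input dimension $d_0$ and output dimension $d_L$ is a function $f=\rho_L\circ\sigma\circ\rho_{L-1}\circ\cdots\circ\sigma\circ\rho_1$, given by hidden dimensions $d_1,\dots,d_{L-1}\ge1$, matrices $A_l\in\mathbb F^{d_l\times d_{l-1}}$ and vectors $b_l\in\mathbb F^{d_l}$, where $\rho_l(x)=A_l\otimes x\oplus b_l$ and $\sigma$ acts coordinatewise. For an input $x$ let $y_l=(\rho_l\circ\sigma\circ\cdots\circ\sigma\circ\rho_1)(x)$, and let $\sigma'(y_l)$ be the diagonal matrix with entries $\sigma'(y_{l,i})$. For a row vector $g$ (the input gradient), the gradient computed by reverse-mode automatic differentiation is $$\mathcal D_{f,x}(g)=g\otimes A_L\otimes\sigma'(y_{L-1})\otimes A_{L-1}\otimes\cdots\otimes\sigma'(y_1)\otimes A_1,$$ evaluated from left to right.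 **Theorem.** Let $d\ge1$, $\mathcal X=([-M_\sigma,M_\sigma]\cap\mathbb F)^d$, and let $f^*:\mathcal X\to\mathbb F$, $h^*:\mathcal X\to[-H_\sigma,H_\sigma]\cap\mathbb F$ and $g^*:\mathbb F^d\to\mathbb F^{1\times d}$ be functions such that $g^*(x)=0$ for all $x\in\mathcal X$ with $h^*(x)=0$. Then for every $L\ge9$ there is an $L$-layer $\sigma$ network $f$ with input dimension $d$ and output dimension $1$ such that for all $x\in\mathcal X$ $$f(x)=f^*(x)\qquad\text{and}\qquad \mathcal D_{f,x}(h^*(x))=g^*(x).$$ -/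

import Mathlib

namespace FloatNet

open Filter Topology

/-! ### Finite floats -/

/-- Smallest exponent `-2^(q-1) + 2`. -/
def eMin (q : ℕ) : ℤ := -(2 : ℤ) ^ (q - 1) + 2

/-- Largest exponent `2^(q-1) - 1`. -/
def eMax (q : ℕ) : ℤ := (2 : ℤ) ^ (q - 1) - 1

/-- `x` is `± (1 + i / 2^p) * 2^e` (normal) or `± (i / 2^p) * 2^eMin` (subnormal), for the given
`i < 2^p` and some admissible sign and exponent. -/
def HasMantissa (p q : ℕ) (x : ℝ) (i : ℕ) : Prop :=
  i < 2 ^ p ∧ ∃ s : ℝ, (s = -1 ∨ s = 1) ∧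
    ((∃ e : ℤ, eMin q ≤ e ∧ e ≤ eMax q ∧ x = s * (1 + (i : ℝ) / 2 ^ p) * (2 : ℝ) ^ e) ∨
      x = s * ((i : ℝ) / 2 ^ p) * (2 : ℝ) ^ eMin q)

/-- The set of finite floats, as a set of real numbers. -/
def finiteFloats (p q : ℕ) : Set ℝ := {x | ∃ i : ℕ, HasMantissa p q x i}

/-- The type of finite floats. -/
abbrev Flt (p q : ℕ) : Type := {x : ℝ // x ∈ finiteFloats p q}

/-- A float is even if its mantissa index `i` is even. -/
def IsEvenFloat (p q : ℕ) (x : ℝ) : Prop := ∃ i : ℕ, Even i ∧ HasMantissa p q x i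

theorem zero_mem_finiteFloats (p q : ℕ) : (0 : ℝ) ∈ finiteFloats p q :=
  ⟨0, by positivity, 1, Or.inr rfl, Or.inr (by simp)⟩

instance (p q : ℕ) : Zero (Flt p q) := ⟨⟨0, zero_mem_finiteFloats p q⟩⟩

/-- The largest finite float `Ω = (2 - 2^(-p)) * 2^eMax`. -/
noncomputable def maxFloat (p q : ℕ) : ℝ := (2 - (2 : ℝ) ^ (-(p : ℤ))) * (2 : ℝ) ^ eMax q

/-! ### All floats and rounding -/

/-- The floats, including the non-finite ones. -/
inductive ExtFlt (p q : ℕ) : Type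
  | fin (x : Flt p q)
  | posInf
  | negInf
  | nan

instance (p q : ℕ) : Zero (ExtFlt p q) := ⟨.fin 0⟩

/-- `y` is a finite float nearest to `x`; in the case of a tie, it is the even one. -/
def IsNearest (p q : ℕ) (x : ℝ) (y : Flt p q) : Prop :=
  (∀ z : Flt p q, |x - y| ≤ |x - z|) ∧
    (IsEvenFloat p q y ∨ ∀ z : Flt p q, |x - z| = |x - y| → z = y)

open Classical in
/-- Rounding to the nearest finite float, ties to even. The default value is never used for
`1 ≤ p` and `2 ≤ q`, see `existsUnique_isNearest`. -/
noncomputable def roundFinite (p q : ℕ) (x : ℝ) : Flt p q :=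
  if h : ∃ y, IsNearest p q x y then h.choose else 0

open Classical in
/-- The rounding operation on real numbers, with overflow to the infinities. -/
noncomputable def round (p q : ℕ) (x : ℝ) : ExtFlt p q :=
  if |x| < maxFloat p q + (2 : ℝ) ^ (eMax q - p - 1) then .fin (roundFinite p q x)
  else if 0 < x then .posInf else .negInf

section RoundingIsWellDefined

theorem HasMantissa.neg {p q : ℕ} {x : ℝ} {i : ℕ} (h : HasMantissa p q x i) :
    HasMantissa p q (-x) i := by
  obtain ⟨hi, s, hs, h⟩ := h
  refine ⟨hi, -s, by rcases hs with rfl | rfl <;> simp, ?_⟩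
  rcases h with ⟨e, h1, h2, rfl⟩ | rfl
  · exact Or.inl ⟨e, h1, h2, by ring⟩
  · exact Or.inr (by ring)

theorem HasMantissa.scaled {p q : ℕ} (hp : 1 ≤ p) (hq : 2 ≤ q) {x : ℝ} {i : ℕ}
    (h : HasMantissa p q x i) (hx : 0 ≤ x) :
    ∃ (m : ℕ) (e : ℤ), x = m * (2 : ℝ) ^ (e - p) ∧ m < 2 ^ (p + 1) ∧ eMin q ≤ e ∧ e ≤ eMax q ∧
      (2 ^ p ≤ m ∨ e = eMin q) ∧ m % 2 = i % 2 := by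
  obtain ⟨hi, s, hs, h⟩ := h
  have h2p : (2 : ℕ) ^ p % 2 = 0 := by
    obtain ⟨k, rfl⟩ : ∃ k, p = k + 1 := ⟨p - 1, by omega⟩
    rw [pow_succ]; omega
  have hqq : (2 : ℤ) ≤ 2 ^ (q - 1) := by
    calc (2 : ℤ) = 2 ^ 1 := by norm_num
      _ ≤ 2 ^ (q - 1) := pow_le_pow_right₀ (by norm_num) (by omega)
  have hpow : ∀ e : ℤ, (2 : ℝ) ^ (e - p) = (2 : ℝ) ^ e / 2 ^ p := fun e => by
    rw [zpow_sub₀ (by norm_num), zpow_natCast]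
  rcases h with ⟨e, h1, h2, rfl⟩ | rfl
  · have hs1 : s = 1 := by
      rcases hs with rfl | rfl
      · exfalso
        have : (0 : ℝ) < (1 + (i : ℝ) / 2 ^ p) * (2 : ℝ) ^ e := by positivity
        linarith
      · rfl
    subst hs1
    refine ⟨2 ^ p + i, e, ?_, by rw [pow_succ]; omega, h1, h2, Or.inl (by omega), by omega⟩
    rw [hpow]; push_cast; field_simp
  · refine ⟨i, eMin q, ?_, by rw [pow_succ]; omega, le_rfl, by unfold eMin eMax; omega,
      Or.inr rfl, rfl⟩
    rw [hpow]
    rcases hs with rfl | rfl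
    · have h0 : (0 : ℝ) ≤ (i : ℝ) / 2 ^ p * (2 : ℝ) ^ eMin q := by positivity
      have h1 : (i : ℝ) / 2 ^ p * (2 : ℝ) ^ eMin q = 0 := by linarith
      have h2 : (i : ℝ) = 0 := by
        rcases mul_eq_zero.1 h1 with h | h
        · simpa using h
        · exact absurd h (by positivity)
      simp [h2]
    · field_simp

theorem mem_of_scaled {p q : ℕ} {m : ℕ} {e : ℤ} (hm : m < 2 ^ (p + 1)) (h1 : eMin q ≤ e)
    (h2 : e ≤ eMax q) (h : 2 ^ p ≤ m ∨ e = eMin q) :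
    (m : ℝ) * (2 : ℝ) ^ (e - p) ∈ finiteFloats p q := by
  have hpow : ∀ e : ℤ, (2 : ℝ) ^ (e - p) = (2 : ℝ) ^ e / 2 ^ p := fun e => by
    rw [zpow_sub₀ (by norm_num), zpow_natCast]
  rw [pow_succ] at hm
  rw [hpow]
  by_cases hmp : 2 ^ p ≤ m
  · obtain ⟨i, rfl⟩ := Nat.exists_eq_add_of_le hmp
    refine ⟨i, by omega, 1, Or.inr rfl, Or.inl ⟨e, h1, h2, ?_⟩⟩
    push_cast; field_simp
  · obtain rfl := h.resolve_left hmp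
    refine ⟨m, by omega, 1, Or.inr rfl, Or.inr ?_⟩
    field_simp

theorem exists_between_of_nonneg {p q : ℕ} (hp : 1 ≤ p) (hq : 2 ≤ q) {x y : ℝ} {i j : ℕ}
    (hx : HasMantissa p q x i) (hy : HasMantissa p q y j) (hij : i % 2 = j % 2) (h0 : 0 ≤ x)
    (hxy : x < y) : ∃ z ∈ finiteFloats p q, x < z ∧ z < y := by
  obtain ⟨m, e, rfl, hm, he1, he2, hme, hmi⟩ := hx.scaled hp hq h0
  obtain ⟨n, f, rfl, hn, hf1, hf2, hnf, hnj⟩ := hy.scaled hp hq (h0.trans hxy.le)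
  have h2p : (2 : ℕ) ^ p % 2 = 0 := by
    obtain ⟨k, rfl⟩ : ∃ k, p = k + 1 := ⟨p - 1, by omega⟩
    rw [pow_succ]; omega
  rw [pow_succ] at hm hn
  have hef : e ≤ f := by
    by_contra! hlt
    have hm' : 2 ^ p ≤ m := hme.resolve_right (by omega)
    have h1 : (n : ℝ) * (2 : ℝ) ^ (f - p) ≤ m * (2 : ℝ) ^ (e - p) := by
      have hsplit : (2 : ℝ) ^ (e - p) = 2 ^ (e - f - 1) * 2 * (2 : ℝ) ^ (f - p) := by
        rw [mul_assoc, ← zpow_one_add₀ (by norm_num), ← zpow_add₀ (by norm_num)]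
        congr 1; ring
      have hge : (1 : ℝ) ≤ 2 ^ (e - f - 1) := one_le_zpow₀ (by norm_num) (by omega)
      have hnm : (n : ℝ) ≤ m * 2 := by exact_mod_cast (show n ≤ m * 2 by omega)
      rw [hsplit, ← mul_assoc]
      refine mul_le_mul_of_nonneg_right ?_ (by positivity)
      have : (0 : ℝ) ≤ (m : ℝ) * 2 := by positivity
      nlinarith
    linarith
  obtain ⟨k, hk⟩ := Int.eq_ofNat_of_zero_le (show 0 ≤ f - e by omega)
  have hsplit : (2 : ℝ) ^ (f - p) = 2 ^ k * (2 : ℝ) ^ (e - p) := by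
    rw [← zpow_natCast, ← zpow_add₀ (by norm_num)]
    congr 1; omega
  have hpos : (0 : ℝ) < (2 : ℝ) ^ (e - p) := by positivity
  have hlt : m < n * 2 ^ k := by
    rw [hsplit, ← mul_assoc] at hxy
    have := lt_of_mul_lt_mul_right hxy hpos.le
    exact_mod_cast this
  have hlt' : m + 1 < n * 2 ^ k := by
    refine lt_of_le_of_ne hlt fun heq => ?_
    rcases Nat.eq_zero_or_pos k with rfl | hk0
    · simp at heq; omega
    · have hn' : 2 ^ p ≤ n := hnf.resolve_right (by omega)
      obtain ⟨l, rfl⟩ : ∃ l, k = l + 1 := ⟨k - 1, by omega⟩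
      have h1 : 1 ≤ 2 ^ l := Nat.one_le_two_pow
      rw [pow_succ] at heq
      have h2 : n * (2 ^ l * 2) = n * 2 ^ l * 2 := by ring
      have h3 : n ≤ n * 2 ^ l := Nat.le_mul_of_pos_right _ h1
      have h4 : n * 2 ^ l = n := by omega
      omega
  refine ⟨((m + 1 : ℕ) : ℝ) * (2 : ℝ) ^ (e - p), ?_, ?_, ?_⟩
  · by_cases hm1 : m + 1 < 2 ^ (p + 1)
    · exact mem_of_scaled hm1 he1 he2 (by omega)
    · have hm2 : m + 1 = 2 ^ p * 2 := by rw [pow_succ] at hm1; omega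
      have hlt : e < eMax q := by
        refine lt_of_le_of_ne he2 fun h => ?_
        have : k = 0 := by omega
        subst this
        simp at hlt'; omega
      have := mem_of_scaled (p := p) (q := q) (m := 2 ^ p) (e := e + 1)
        (by rw [pow_succ]; omega) (by omega) (by omega) (Or.inl le_rfl)
      convert this using 1
      rw [hm2, show e + 1 - (p : ℤ) = 1 + (e - p) by ring, zpow_one_add₀ (by norm_num)]
      push_cast; ring
  · refine mul_lt_mul_of_pos_right ?_ hpos
    exact_mod_cast Nat.lt_succ_self m
  · rw [hsplit, ← mul_assoc]
    refine mul_lt_mul_of_pos_right ?_ hpos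
    exact_mod_cast hlt'

theorem exists_between {p q : ℕ} (hp : 1 ≤ p) (hq : 2 ≤ q) {x y : ℝ} {i j : ℕ}
    (hx : HasMantissa p q x i) (hy : HasMantissa p q y j) (hij : i % 2 = j % 2) (hxy : x < y) :
    ∃ z ∈ finiteFloats p q, x < z ∧ z < y := by
  rcases le_or_gt 0 x with h0 | h0
  · exact exists_between_of_nonneg hp hq hx hy hij h0 hxy
  rcases lt_or_ge 0 y with h1 | h1
  · exact ⟨0, zero_mem_finiteFloats p q, h0, h1⟩
  obtain ⟨z, ⟨k, hz⟩, h2, h3⟩ := exists_between_of_nonneg hp hq hy.neg hx.neg hij.symm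
    (by linarith) (by linarith)
  exact ⟨-z, ⟨k, hz.neg⟩, by linarith, by linarith⟩

theorem finite_finiteFloats (p q : ℕ) : (finiteFloats p q).Finite := by
  have h : finiteFloats p q ⊆
      ((fun t : ℝ × ℕ × ℤ => t.1 * (1 + (t.2.1 : ℝ) / 2 ^ p) * (2 : ℝ) ^ t.2.2) ''
        (({-1, 1} : Set ℝ) ×ˢ Set.Iio (2 ^ p) ×ˢ Set.Icc (eMin q) (eMax q))) ∪
      ((fun t : ℝ × ℕ => t.1 * ((t.2 : ℝ) / 2 ^ p) * (2 : ℝ) ^ eMin q) ''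
        (({-1, 1} : Set ℝ) ×ˢ Set.Iio (2 ^ p))) := by
    rintro x ⟨i, hi, s, hs, ⟨e, h1, h2, rfl⟩ | rfl⟩
    · exact Or.inl ⟨(s, i, e), ⟨by simpa using hs, hi, h1, h2⟩, rfl⟩
    · exact Or.inr ⟨(s, i), ⟨by simpa using hs, hi⟩, rfl⟩
  refine Set.Finite.subset (Set.Finite.union ?_ ?_) h
  · exact (((Set.finite_singleton _).insert _).prod
      ((Set.finite_Iio _).prod (Set.finite_Icc _ _))).image _
  · exact (((Set.finite_singleton _).insert _).prod (Set.finite_Iio _)).image _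

/-- Two distinct floats at the same minimal distance from `x` have opposite parities. -/
theorem parity_ne_of_tie {p q : ℕ} (hp : 1 ≤ p) (hq : 2 ≤ q) {x : ℝ} {y z : Flt p q} {i j : ℕ}
    (hy : HasMantissa p q y i) (hz : HasMantissa p q z j)
    (hmin : ∀ w : Flt p q, |x - y| ≤ |x - w|) (htie : |x - z| = |x - y|) (hne : z ≠ y) :
    i % 2 ≠ j % 2 := by
  intro hij
  have key : ∀ a b : ℝ, a < b → |x - a| = |x - b| → ∀ w, a < w → w < b → |x - w| < |x - b| := by
    intro a b hab h w h1 h2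
    rcases abs_eq_abs.1 h with h | h
    · linarith
    · rw [show |x - b| = b - x by rw [abs_sub_comm]; exact abs_of_pos (by linarith)]
      exact abs_lt.2 ⟨by linarith, by linarith⟩
  rcases lt_trichotomy (y : ℝ) z with h | h | h
  · obtain ⟨w, hw, h1, h2⟩ := exists_between hp hq hy hz hij h
    have := key _ _ h htie.symm w h1 h2
    have := hmin ⟨w, hw⟩
    simp only at this
    linarith
  · exact hne (Subtype.ext h.symm)
  · obtain ⟨w, hw, h1, h2⟩ := exists_between hp hq hz hy hij.symm h
    have := key _ _ h htie w h1 h2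
    have := hmin ⟨w, hw⟩
    simp only at this
    linarith

theorem existsUnique_isNearest {p q : ℕ} (hp : 1 ≤ p) (hq : 2 ≤ q) (x : ℝ) :
    ∃! y : Flt p q, IsNearest p q x y := by
  have : Finite (Flt p q) := (finite_finiteFloats p q).to_subtype
  have : Nonempty (Flt p q) := ⟨0⟩
  obtain ⟨y, hy⟩ := Finite.exists_min fun z : Flt p q => |x - z|
  obtain ⟨i, hi⟩ := y.2
  refine existsUnique_of_exists_of_unique ?_ ?_
  · by_cases hye : i % 2 = 0
    · exact ⟨y, hy, Or.inl ⟨i, Nat.even_iff.2 hye, hi⟩⟩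
    by_cases hu : ∀ z : Flt p q, |x - z| = |x - y| → z = y
    · exact ⟨y, hy, Or.inr hu⟩
    push Not at hu
    obtain ⟨z, hz, hne⟩ := hu
    obtain ⟨j, hj⟩ := z.2
    have := parity_ne_of_tie hp hq hi hj hy hz hne
    exact ⟨z, fun w => hz ▸ hy w, Or.inl ⟨j, Nat.even_iff.2 (by omega), hj⟩⟩
  · rintro a b ⟨ha, ha'⟩ ⟨hb, hb'⟩
    have hab : |x - a| = |x - b| := le_antisymm (ha b) (hb a)
    rcases ha' with ⟨i, hi, hi'⟩ | ha'
    · rcases hb' with ⟨j, hj, hj'⟩ | hb'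
      · by_contra hne
        refine parity_ne_of_tie hp hq hi' hj' ha hab.symm (Ne.symm hne) ?_
        rw [Nat.even_iff.1 hi, Nat.even_iff.1 hj]
      · exact hb' a hab
    · exact (ha' b hab.symm).symm

end RoundingIsWellDefined

/-! ### Floating-point arithmetic -/

namespace ExtFlt

variable {p q : ℕ}

/-- Floating-point addition. -/
noncomputable def add : ExtFlt p q → ExtFlt p q → ExtFlt p q
  | nan, _ => nan
  | _, nan => nan
  | fin x, fin y => round p q ((x : ℝ) + (y : ℝ))
  | posInf, negInf => nan
  | negInf, posInf => nan
  | posInf, _ => posInf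
  | _, posInf => posInf
  | negInf, _ => negInf
  | _, negInf => negInf

open Classical in
/-- The infinity with the sign of the real number `x`; it is NaN for `x = 0`. -/
noncomputable def signedInf (x : ℝ) : ExtFlt p q :=
  if 0 < x then posInf else if x < 0 then negInf else nan

/-- Floating-point multiplication. -/
noncomputable def mul : ExtFlt p q → ExtFlt p q → ExtFlt p q
  | nan, _ => nan
  | _, nan => nan
  | fin x, fin y => round p q ((x : ℝ) * (y : ℝ))
  | fin x, posInf => signedInf (x : ℝ)
  | fin x, negInf => signedInf (-(x : ℝ))
  | posInf, fin y => signedInf (y : ℝ)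
  | negInf, fin y => signedInf (-(y : ℝ))
  | posInf, posInf => posInf
  | posInf, negInf => negInf
  | negInf, posInf => negInf
  | negInf, negInf => posInf

end ExtFlt

infixl:65 " ⊕ₑ " => ExtFlt.add
infixl:70 " ⊗ₑ " => ExtFlt.mul

variable {p q : ℕ}

/-- The floating-point sum of `x 0, …, x (n - 1)`, evaluated from left to right; the empty sum
is `0`. -/
noncomputable def fsum : (n : ℕ) → (Fin n → ExtFlt p q) → ExtFlt p q
  | 0, _ => 0
  | n + 1, x => fsum n (fun i => x i.castSucc) ⊕ₑ x (Fin.last n)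

/-- The floating-point product `A ⊗ x` of a matrix and a column vector. -/
noncomputable def mulVec {m n : ℕ} (A : Matrix (Fin m) (Fin n) (ExtFlt p q))
    (x : Fin n → ExtFlt p q) : Fin m → ExtFlt p q :=
  fun i => fsum n fun j => A i j ⊗ₑ x j

/-- The floating-point product `g ⊗ A` of a row vector and a matrix. -/
noncomputable def vecMul {m n : ℕ} (g : Fin m → ExtFlt p q)
    (A : Matrix (Fin m) (Fin n) (ExtFlt p q)) : Fin n → ExtFlt p q :=
  fun j => fsum m fun i => g i ⊗ₑ A i j

/-! ### Networks and automatic differentiation -/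

/-- The parameters (finite floats) of a floating-point affine transformation from dimension `m`
to dimension `n`. -/
structure Affine (p q m n : ℕ) where
  A : Matrix (Fin n) (Fin m) (Flt p q)
  b : Fin n → Flt p q

namespace Affine

variable {m n : ℕ}

/-- The weight matrix, as a matrix of floats. -/
def weight (ρ : Affine p q m n) : Matrix (Fin n) (Fin m) (ExtFlt p q) := ρ.A.map ExtFlt.fin

/-- `x ↦ A ⊗ x ⊕ b`. -/
noncomputable def eval (ρ : Affine p q m n) (x : Fin m → ExtFlt p q) : Fin n → ExtFlt p q :=
  fun i => mulVec ρ.weight x i ⊕ₑ .fin (ρ.b i)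

/-- Reverse-mode derivative of an affine transformation: `g ↦ g ⊗ A`. -/
noncomputable def grad (ρ : Affine p q m n) (g : Fin n → ExtFlt p q) : Fin m → ExtFlt p q :=
  vecMul g ρ.weight

end Affine

/-- Reverse-mode derivative at `x` of an activation function applied coordinatewise:
`g ↦ g ⊗ diag (σ' x)`. -/
noncomputable def activationGrad (σ' : ExtFlt p q → ExtFlt p q) {n : ℕ} (x g : Fin n → ExtFlt p q) :
    Fin n → ExtFlt p q :=
  vecMul g (Matrix.diagonal fun i => σ' (x i))

/-- Parameters of a network with `L` affine layers (`L ≥ 1`), input dimension `m` and output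
dimension `n`. All hidden dimensions are positive. -/
inductive Network (p q : ℕ) : (L m n : ℕ) → Type
  | last {m n : ℕ} (ρ : Affine p q m n) : Network p q 1 m n
  | cons {L m k n : ℕ} (ρ : Affine p q m k) (hk : 0 < k) (N : Network p q L k n) :
      Network p q (L + 1) m n

namespace Network

/-- The function `ρ_L ∘ σ ∘ ρ_{L-1} ∘ ⋯ ∘ σ ∘ ρ_1` computed by the network. -/
noncomputable def eval (σ : ExtFlt p q → ExtFlt p q) :
    {L m n : ℕ} → Network p q L m n → (Fin m → ExtFlt p q) → (Fin n → ExtFlt p q)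
  | _, _, _, last ρ, x => ρ.eval x
  | _, _, _, cons ρ _ N, x => N.eval σ fun i => σ (ρ.eval x i)

/-- The output gradient `D_{f,x}(g)` of reverse-mode automatic differentiation with input gradient
`g`: the input gradient is propagated from the last layer to the first one, that is,
`D_{ψ₂ ∘ ψ₁, x}(g) = D_{ψ₁, x}(D_{ψ₂, ψ₁(x)}(g))`. -/
noncomputable def grad (σ σ' : ExtFlt p q → ExtFlt p q) :
    {L m n : ℕ} → Network p q L m n → (x : Fin m → ExtFlt p q) → (g : Fin n → ExtFlt p q) →
      (Fin m → ExtFlt p q)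
  | _, _, _, last ρ, _, g => ρ.grad g
  | _, _, _, cons ρ _ N, x, g =>
      ρ.grad (activationGrad σ' (ρ.eval x) (N.grad σ σ' (fun i => σ (ρ.eval x i)) g))

end Network

/-! ### Activation functions -/

/-- The error function. -/
noncomputable def erf (x : ℝ) : ℝ := 2 / √Real.pi * ∫ t in (0 : ℝ)..x, Real.exp (-t ^ 2)

/-- Names of the activation functions. -/
inductive Activation
  | relu | elu | gelu | swish | sigmoid | tanh

namespace Activation

/-- The real activation functions. -/
noncomputable def real : Activation → ℝ → ℝ
  | relu, x => max 0 x
  | elu, x => if 0 ≤ x then x else Real.exp x - 1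
  | gelu, x => x / 2 * (1 + erf (x / √2))
  | swish, x => x / (1 + Real.exp (-x))
  | sigmoid, x => 1 / (1 + Real.exp (-x))
  | tanh, x => Real.tanh x

/-- The bound `M_σ` on the inputs. -/
noncomputable def inputBound (q : ℕ) : Activation → ℝ
  | relu | elu | gelu | swish => (2 : ℝ) ^ (eMax q - 2)
  | sigmoid | tanh => (2 : ℝ) ^ (eMax q - 1)

/-- The bound `H_σ` on the input gradients. -/
noncomputable def gradBound (p q : ℕ) : Activation → ℝ
  | relu | elu | gelu | swish => maxFloat p q
  | sigmoid => (2 : ℝ) ^ ((p : ℤ) - 1)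
  | tanh => (2 : ℝ) ^ ((p : ℤ) - 2)

end Activation

open Classical in
/-- The rounded value of the (possibly infinite) limit of `f` along `l`; NaN if there is none. -/
noncomputable def roundLimit (p q : ℕ) (f : ℝ → ℝ) (l : Filter ℝ) : ExtFlt p q :=
  if h : ∃ c : ℝ, Tendsto f l (𝓝 c) then round p q h.choose
  else if Tendsto f l atTop then .posInf
  else if Tendsto f l atBot then .negInf
  else .nan

/-- The rounded version of a real function. -/
noncomputable def rounded (p q : ℕ) (f : ℝ → ℝ) : ExtFlt p q → ExtFlt p q
  | .fin x => round p q (f x)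
  | .posInf => roundLimit p q f atTop
  | .negInf => roundLimit p q f atBot
  | .nan => .nan

/-- `σ'` is a rounded version of the derivative of `f`: it maps finite floats to finite floats and
agrees with the rounded derivative, except that at a finite float where `f` is not differentiable
its value may be any finite float. -/
def IsRoundedDeriv (f : ℝ → ℝ) (σ' : ExtFlt p q → ExtFlt p q) : Prop :=
  (∀ x : Flt p q, ∃ y : Flt p q, σ' (.fin x) = .fin y) ∧
    ∀ x : ExtFlt p q, (∀ y : Flt p q, x = .fin y → DifferentiableAt ℝ f y) →
      σ' x = rounded p q (deriv f) x

end FloatNet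

/-! The domain is finite, so the network can be a table: many small subnetworks ("blocks") run side
by side on the same input, each responsible for one addend at one input `u`. The last layer adds up
their outputs from left to right, and the transpose of the first layer adds up their gradients from
left to right. Floating-point addition is not associative, so a block is treated as an operation on
a pair of accumulators (output so far, gradient so far); parallel composition of blocks is then
composition of these operations (`Block.Run.par`). Every float is a sum of copies of some ±2^i with
exact partial sums (`exists_copies`). It therefore suffices to build value units, which add ±2^i to
the output at `u` and nothing to any gradient, and gradient units, which add ±2^i to one gradient
coordinate at `u` and nothing to the output; `exists_network` assembles them.

Selection of `u` rests on saturation. The tails of the activation functions decay exponentially, and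
below -2^(q+1) they are smaller than half the smallest float. After rounding, σ is exactly a
constant `c` there and σ' is exactly 0. Coordinate comparisons (`HasDetectors`) combine to an
indicator neuron that is low at `u` and high elsewhere (`exists_indicator`). At `u` its vanishing
derivative stops every finite gradient. In the one-neuron value units and in the gates, the neuron
behind it is low elsewhere and sends back no gradient. The remaining value units use similar
saturation arguments.

A gradient unit must let a prescribed gradient reach the input. Each layer of its path has a pair of
neurons P, Q, and the next P receives Wσ(P) - Wσ(Q) + β. When both activations agree, the forward
contributions cancel exactly and the pre-activation is the known constant β, whereas the gradient
still passes through P, multiplied by exact powers of two (`chain_state`, `chain_grad`). A pair of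
gate neurons with output weights a and -a joins path and indicator: their outputs cancel, their
gradients into the indicator cancel, and away from `u` they are low (`exists_gradUnit`).

The input gradient is an arbitrary nonzero float h, and its mantissa has to disappear. Rounding does
this: h is scaled down until only the smallest positive float is left (`exists_normalizing_weight`,
`exists_scale_to_min`). From there the path scales up by at most about 2^(E/2) per layer, E =
2^(q-1), because larger weights could overflow in the forward pass. The exponents span less than
5E/2, which costs five layers, and the first weight must be neutral. Six hidden layers of path, one
gate layer and the output layer give L = 9.

Two interfaces cover the six functions. `FloatRamp` (ReLU, ELU, GELU, Swish) uses the fact that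
large floats are fixed points with derivative 1. `FloatSquash` (sigmoid, tanh) uses boundedness and
the fact that the derivative at 0 is a power of two. -/

namespace FloatNet

/-! ### The exponent range -/

/-- The restrictions on the floating-point format. -/
structure Adm (p q : ℕ) : Prop where
  hp : 2 ≤ p
  hpq : p ≤ 2 ^ (q - 2)
  hq : 6 ≤ q

/-- `2 ^ (q - 1)`. -/
def expRange (q : ℕ) : ℤ := (2 : ℤ) ^ (q - 1)

theorem eMin_eq (q : ℕ) : eMin q = 2 - expRange q := by unfold eMin expRange; ring

theorem eMax_eq (q : ℕ) : eMax q = expRange q - 1 := rfl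

section

variable {p q : ℕ} (A : Adm p q)

include A

/-- Here p ≤ 2^(q-2) enters. Together with `Adm.expRange_ge` it reduces the later comparisons of
powers of two to linear inequalities between p, q and `expRange q`. -/
theorem Adm.two_mul_le : 2 * (p : ℤ) ≤ expRange q := by
  have h := A.hpq
  have hq := A.hq
  obtain ⟨k, rfl⟩ : ∃ k, q = k + 2 := ⟨q - 2, by omega⟩
  have : (p : ℤ) ≤ 2 ^ k := by
    have h2 : p ≤ 2 ^ k := by simpa using h
    exact_mod_cast h2
  unfold expRange
  rw [show k + 2 - 1 = k + 1 by omega, pow_succ]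
  omega

theorem Adm.expRange_ge : 2 * (q : ℤ) + 12 ≤ expRange q ∧ 32 ≤ expRange q := by
  have hq := A.hq
  unfold expRange
  obtain ⟨k, rfl⟩ : ∃ k, q = k + 6 := ⟨q - 6, by omega⟩
  rw [show k + 6 - 1 = k + 5 by omega]
  have : ∀ k : ℕ, 2 * ((k + 6 : ℕ) : ℤ) + 12 ≤ 2 ^ (k + 5) ∧ (32 : ℤ) ≤ 2 ^ (k + 5) := by
    intro k
    induction k with
    | zero => norm_num
    | succ k ih =>
      rw [show k + 1 + 5 = (k + 5) + 1 by ring, pow_succ]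
      push_cast at ih ⊢
      constructor <;> linarith [ih.1, ih.2]
  exact this k

theorem Adm.one_le : 1 ≤ p := le_trans (by norm_num) A.hp

theorem Adm.two_le : 2 ≤ q := le_trans (by norm_num) A.hq

end

/-! ### Floats as integer multiples of powers of two -/

section Grid

variable {p q : ℕ}

theorem neg_mem {x : ℝ} (h : x ∈ finiteFloats p q) : -x ∈ finiteFloats p q := by
  obtain ⟨i, hi⟩ := h
  exact ⟨i, hi.neg⟩

theorem two_zpow_split {a b : ℤ} (h : a ≤ b) : ∃ n : ℕ, (2 : ℝ) ^ b = n * (2 : ℝ) ^ a ∧ 1 ≤ n := by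
  obtain ⟨k, hk⟩ := Int.eq_ofNat_of_zero_le (show 0 ≤ b - a by omega)
  refine ⟨2 ^ k, ?_, Nat.one_le_two_pow⟩
  push_cast
  rw [← zpow_natCast, ← zpow_add₀ (by norm_num)]
  congr 1
  omega

/-- The mantissa need not be normalized: a short one is doubled and the exponent lowered until it is
normal or the exponent is minimal. -/
theorem nat_mul_mem {m : ℕ} {e : ℤ} (hm : m < 2 ^ (p + 1)) (h1 : eMin q ≤ e) (h2 : e ≤ eMax q) :
    (m : ℝ) * (2 : ℝ) ^ (e - p) ∈ finiteFloats p q := by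
  obtain ⟨k, hk⟩ := Int.eq_ofNat_of_zero_le (show 0 ≤ e - eMin q by omega)
  induction k generalizing e m with
  | zero => exact mem_of_scaled hm h1 h2 (Or.inr (by omega))
  | succ k ih =>
    by_cases hmp : 2 ^ p ≤ m
    · exact mem_of_scaled hm h1 h2 (Or.inl hmp)
    · have := ih (m := 2 * m) (e := e - 1) (by rw [pow_succ]; omega) (by omega) (by omega) (by omega)
      convert this using 1
      rw [show e - (p : ℤ) = 1 + (e - 1 - p) by ring, zpow_one_add₀ (by norm_num)]
      push_cast
      ring

/-- The endpoint 2^(p+1) is the first float of the next binade, which is why `e` must stay below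
`eMax q`. -/
theorem nat_mul_mem' {m : ℕ} {e : ℤ} (hm : m ≤ 2 ^ (p + 1)) (h1 : eMin q ≤ e) (h2 : e < eMax q) :
    (m : ℝ) * (2 : ℝ) ^ (e - p) ∈ finiteFloats p q := by
  rcases hm.lt_or_eq with h | rfl
  · exact nat_mul_mem h h1 h2.le
  · have := nat_mul_mem (p := p) (q := q) (m := 2 ^ p) (e := e + 1)
      (Nat.pow_lt_pow_right (by norm_num) (by omega)) (by omega) (by omega)
    convert this using 1
    rw [show e + 1 - (p : ℤ) = 1 + (e - p) by ring, zpow_one_add₀ (by norm_num)]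
    push_cast
    ring

theorem int_mul_mem {n : ℤ} {e : ℤ} (hn : |n| < 2 ^ (p + 1)) (h1 : eMin q ≤ e) (h2 : e ≤ eMax q) :
    (n : ℝ) * (2 : ℝ) ^ (e - p) ∈ finiteFloats p q := by
  obtain ⟨m, rfl | rfl⟩ := n.eq_nat_or_neg
  · rw [Nat.abs_cast] at hn
    exact_mod_cast nat_mul_mem (p := p) (q := q) (by exact_mod_cast hn) h1 h2
  · rw [abs_neg, Nat.abs_cast] at hn
    push_cast
    rw [neg_mul]
    exact neg_mem (nat_mul_mem (p := p) (q := q) (by exact_mod_cast hn) h1 h2)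

theorem two_zpow_mem (A : Adm p q) {i : ℤ} (h1 : eMin q - p ≤ i) (h2 : i ≤ eMax q) :
    (2 : ℝ) ^ i ∈ finiteFloats p q := by
  rcases le_or_gt (eMin q) i with h | h
  · have := nat_mul_mem (p := p) (q := q) (m := 2 ^ p) (e := i)
      (Nat.pow_lt_pow_right (by norm_num) (by omega)) h h2
    convert this using 1
    push_cast
    rw [← zpow_natCast, ← zpow_add₀ (by norm_num)]
    congr 1; ring
  · obtain ⟨k, hk⟩ := Int.eq_ofNat_of_zero_le (show 0 ≤ i - (eMin q - p) by omega)
    have := nat_mul_mem (p := p) (q := q) (m := 2 ^ k) (e := eMin q)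
      (Nat.pow_lt_pow_right (by norm_num) (by omega)) le_rfl
        (by have := A.expRange_ge; rw [eMin_eq, eMax_eq]; omega)
    convert this using 1
    push_cast
    rw [← zpow_natCast, ← zpow_add₀ (by norm_num)]
    congr 1; omega

theorem exists_scaled (A : Adm p q) {x : ℝ} (hx : x ∈ finiteFloats p q) :
    ∃ (n : ℤ) (e : ℤ), x = n * (2 : ℝ) ^ (e - p) ∧ |n| < 2 ^ (p + 1) ∧ eMin q ≤ e ∧ e ≤ eMax q ∧
      (2 ^ p ≤ |n| ∨ e = eMin q) := by
  obtain ⟨i, hi⟩ := hx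
  rcases le_total 0 x with h | h
  · obtain ⟨m, e, h1, h2, h3, h4, h5, -⟩ := hi.scaled A.one_le A.two_le h
    refine ⟨m, e, by exact_mod_cast h1, ?_, h3, h4, ?_⟩
    · rw [Nat.abs_cast]; exact_mod_cast h2
    · rw [Nat.abs_cast]; exact_mod_cast h5
  · obtain ⟨m, e, h1, h2, h3, h4, h5, -⟩ := hi.neg.scaled A.one_le A.two_le (by linarith)
    refine ⟨-m, e, by push_cast; linarith, ?_, h3, h4, ?_⟩
    · rw [abs_neg, Nat.abs_cast]; exact_mod_cast h2
    · rw [abs_neg, Nat.abs_cast]; exact_mod_cast h5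

theorem exists_eq_mul_min (A : Adm p q) {z : ℝ} (hz : z ∈ finiteFloats p q) :
    ∃ n : ℤ, z = n * (2 : ℝ) ^ (eMin q - p) := by
  obtain ⟨n, e, rfl, -, h, -⟩ := exists_scaled A hz
  obtain ⟨k, hk, -⟩ := two_zpow_split (show eMin q - p ≤ e - p by omega)
  exact ⟨n * k, by rw [hk]; push_cast; ring⟩

/-- A float of size at least 2^e has exponent at least e, so its spacing is a multiple of 2^(e-p).
-/
theorem exists_eq_mul (A : Adm p q) {z : ℝ} (hz : z ∈ finiteFloats p q) {e : ℤ}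
    (he : (2 : ℝ) ^ e ≤ |z|) : ∃ n : ℤ, z = n * (2 : ℝ) ^ (e - p) := by
  obtain ⟨n, f, rfl, hn, h, -⟩ := exists_scaled A hz
  have hef : e ≤ f := by
    by_contra! hlt
    rw [abs_mul, abs_of_pos (show (0 : ℝ) < 2 ^ (f - p) by positivity)] at he
    have h1 : (|(n : ℝ)|) < 2 ^ (p + 1) := by exact_mod_cast hn
    have h2 : (2 : ℝ) ^ (p + 1) * 2 ^ (f - p) ≤ 2 ^ e := by
      rw [← zpow_natCast, ← zpow_add₀ (by norm_num)]
      exact zpow_le_zpow_right₀ (by norm_num) (by push_cast; omega)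
    have h3 : |(n : ℝ)| * 2 ^ (f - p) < 2 ^ (p + 1) * 2 ^ (f - p) :=
      mul_lt_mul_of_pos_right h1 (by positivity)
    linarith
  obtain ⟨k, hk, -⟩ := two_zpow_split (show e - p ≤ f - p by omega)
  exact ⟨n * k, by rw [hk]; push_cast; ring⟩

theorem sep_of_grid {u y z : ℝ} {m n : ℤ} (hu : 0 < u) (hy : y = m * u) (hz : z = n * u)
    (hne : z ≠ y) : u ≤ |z - y| := by
  have hmn : n - m ≠ 0 := by
    intro h
    exact hne (by rw [hy, hz, show n = m by omega])
  have h1 : (1 : ℝ) ≤ |((n - m : ℤ) : ℝ)| := by exact_mod_cast Int.one_le_abs hmn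
  rw [hy, hz, ← sub_mul, abs_mul, abs_of_pos hu]
  push_cast at h1
  nlinarith

/-- All floats, subnormal ones included, lie on one grid of width 2^(eMin-p). This lower bound makes
inequality of inputs detectable. -/
theorem min_sep (A : Adm p q) {y z : ℝ} (hy : y ∈ finiteFloats p q) (hz : z ∈ finiteFloats p q)
    (hne : z ≠ y) : (2 : ℝ) ^ (eMin q - p) ≤ |z - y| := by
  obtain ⟨m, hm⟩ := exists_eq_mul_min A hy
  obtain ⟨n, hn⟩ := exists_eq_mul_min A hz
  exact sep_of_grid (by positivity) hm hn hne

theorem maxFloat_eq : maxFloat p q = ((2 ^ (p + 1) - 1 : ℕ) : ℝ) * (2 : ℝ) ^ (eMax q - p) := by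
  rw [Nat.cast_sub Nat.one_le_two_pow, maxFloat, zpow_sub₀ (by norm_num), zpow_neg]
  push_cast
  simp only [zpow_natCast, pow_succ]
  field_simp

theorem maxFloat_mem (A : Adm p q) : maxFloat p q ∈ finiteFloats p q := by
  rw [maxFloat_eq]
  refine nat_mul_mem ?_ ?_ le_rfl
  · have := Nat.one_le_two_pow (n := p + 1); omega
  · have := A.expRange_ge; rw [eMin_eq, eMax_eq]; omega

theorem abs_le_maxFloat (A : Adm p q) {z : ℝ} (hz : z ∈ finiteFloats p q) :
    |z| ≤ maxFloat p q := by
  obtain ⟨n, e, rfl, hn, -, he, -⟩ := exists_scaled A hz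
  rw [maxFloat_eq, abs_mul, abs_of_pos (show (0 : ℝ) < 2 ^ (e - p) by positivity)]
  refine mul_le_mul ?_ (zpow_le_zpow_right₀ (by norm_num) (by omega)) (by positivity) (by positivity)
  have h1 : |n| ≤ 2 ^ (p + 1) - 1 := by omega
  rw [Nat.cast_sub Nat.one_le_two_pow]
  push_cast
  exact_mod_cast h1

theorem two_zpow_eMax_le (A : Adm p q) : (3 : ℝ) / 2 * 2 ^ eMax q ≤ maxFloat p q := by
  unfold maxFloat
  refine mul_le_mul_of_nonneg_right ?_ (by positivity)
  have : (2 : ℝ) ^ (-(p : ℤ)) ≤ 2 ^ (-1 : ℤ) :=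
    zpow_le_zpow_right₀ (by norm_num) (by have := A.hp; omega)
  norm_num at this ⊢
  linarith

theorem maxFloat_lt : maxFloat p q < 2 ^ (eMax q + 1) := by
  unfold maxFloat
  rw [zpow_add_one₀ (by norm_num), mul_comm]
  refine mul_lt_mul_of_pos_left ?_ (by positivity)
  have : (0 : ℝ) < (2 : ℝ) ^ (-(p : ℤ)) := by positivity
  linarith

theorem maxFloat_pos (A : Adm p q) : 0 < maxFloat p q :=
  lt_of_lt_of_le (by positivity) (two_zpow_eMax_le A)

end Grid

/-! ### Rounding: monotonicity and enclosures -/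

section Rounding

variable {p q : ℕ}

theorem isNearest_roundFinite (A : Adm p q) (x : ℝ) : IsNearest p q x (roundFinite p q x) := by
  have h : ∃ y, IsNearest p q x y := (existsUnique_isNearest A.one_le A.two_le x).exists
  unfold roundFinite
  rw [dif_pos h]
  exact h.choose_spec

theorem roundFinite_eq (A : Adm p q) {x : ℝ} {y : Flt p q} (h : IsNearest p q x y) :
    roundFinite p q x = y :=
  (existsUnique_isNearest A.one_le A.two_le x).unique (isNearest_roundFinite A x) h

theorem roundFinite_eq_of_lt (A : Adm p q) {x : ℝ} {y : Flt p q}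
    (h : ∀ z : Flt p q, z ≠ y → |x - y| < |x - z|) : roundFinite p q x = y := by
  refine roundFinite_eq A ⟨fun z => ?_, Or.inr fun z hz => ?_⟩
  · by_cases hzy : z = y
    · rw [hzy]
    · exact (h z hzy).le
  · by_contra hzy
    exact (h z hzy).ne' hz

theorem round_eq_fin {x : ℝ} (hx : |x| ≤ maxFloat p q) :
    round p q x = .fin (roundFinite p q x) := by
  unfold round
  rw [if_pos (lt_of_le_of_lt hx (lt_add_of_pos_right _ (by positivity)))]

theorem round_of_mem (A : Adm p q) {x : ℝ} (hx : x ∈ finiteFloats p q) :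
    round p q x = .fin ⟨x, hx⟩ := by
  rw [round_eq_fin (abs_le_maxFloat A hx)]
  congr 1
  refine roundFinite_eq_of_lt A fun z hz => ?_
  simp only [sub_self, abs_zero, abs_pos]
  intro h
  exact hz (Subtype.ext (by simp only; linarith))

theorem round_coe (A : Adm p q) (x : Flt p q) : round p q x = .fin x := round_of_mem A x.2

theorem le_roundFinite (A : Adm p q) {x : ℝ} {f : Flt p q} (h : (f : ℝ) ≤ x) :
    (f : ℝ) ≤ roundFinite p q x := by
  by_contra! hlt
  have h1 := (isNearest_roundFinite A x).1 f
  rw [abs_of_nonneg (by linarith), abs_of_nonneg (by linarith)] at h1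
  linarith

theorem roundFinite_le (A : Adm p q) {x : ℝ} {f : Flt p q} (h : x ≤ (f : ℝ)) :
    (roundFinite p q x : ℝ) ≤ f := by
  by_contra! hlt
  have h1 := (isNearest_roundFinite A x).1 f
  rw [abs_of_nonpos (by linarith), abs_of_nonpos (by linarith)] at h1
  linarith

theorem round_neg (A : Adm p q) {x : ℝ} {y : Flt p q} (h : round p q x = .fin y) :
    round p q (-x) = .fin ⟨-y, neg_mem y.2⟩ := by
  unfold round at h ⊢
  rw [abs_neg]
  split_ifs at h ⊢ with h1
  · simp only [ExtFlt.fin.injEq] at h ⊢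
    have hn := isNearest_roundFinite A x
    rw [h] at hn
    refine roundFinite_eq A ⟨fun z => ?_, ?_⟩
    · have := hn.1 ⟨-z, neg_mem z.2⟩
      simp only at this ⊢
      rw [← abs_neg, ← abs_neg (-x - (z : ℝ))]
      convert this using 2 <;> ring
    · rcases hn.2 with ⟨i, hi, hm⟩ | hu
      · exact Or.inl ⟨i, hi, hm.neg⟩
      · refine Or.inr fun z hz => ?_
        have := hu ⟨-z, neg_mem z.2⟩ (by
          simp only at hz ⊢
          rw [← abs_neg, ← abs_neg (x - (y : ℝ))]
          convert hz using 2 <;> ring)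
        refine Subtype.ext ?_
        have h3 := congrArg Subtype.val this
        simp only at h3 ⊢
        linarith

/-- `y` is a finite float with value in `[a, b]`. -/
def Btw (y : ExtFlt p q) (a b : ℝ) : Prop := ∃ f : Flt p q, y = .fin f ∧ a ≤ f ∧ (f : ℝ) ≤ b

/-- `y` is `-∞` or a finite float with value at most `r`. -/
def Le (y : ExtFlt p q) (r : ℝ) : Prop := y = .negInf ∨ ∃ f : Flt p q, y = .fin f ∧ (f : ℝ) ≤ r

/-- `y` is a finite float. -/
def IsFin (y : ExtFlt p q) : Prop := ∃ f : Flt p q, y = .fin f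

theorem Btw.isFin {y : ExtFlt p q} {a b : ℝ} (h : Btw y a b) : IsFin y := by
  obtain ⟨f, hf, -⟩ := h
  exact ⟨f, hf⟩

theorem Btw.le {y : ExtFlt p q} {a b : ℝ} (h : Btw y a b) : Le y b := by
  obtain ⟨f, hf, -, h⟩ := h
  exact Or.inr ⟨f, hf, h⟩

theorem Btw.mono {y : ExtFlt p q} {a b c d : ℝ} (h : Btw y a b) (h1 : c ≤ a) (h2 : b ≤ d) :
    Btw y c d := by
  obtain ⟨f, hf, h3, h4⟩ := h
  exact ⟨f, hf, h1.trans h3, h4.trans h2⟩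

theorem Le.mono {y : ExtFlt p q} {r s : ℝ} (h : Le y r) (hrs : r ≤ s) : Le y s := by
  rcases h with h | ⟨f, hf, h⟩
  · exact Or.inl h
  · exact Or.inr ⟨f, hf, h.trans hrs⟩

theorem btw_fin {f : Flt p q} {a b : ℝ} : Btw (.fin f) a b ↔ a ≤ f ∧ (f : ℝ) ≤ b := by
  constructor
  · rintro ⟨g, h, h1⟩
    cases h
    exact h1
  · intro h
    exact ⟨f, rfl, h⟩

/-- Rounding is monotone and fixes floats, so enclosures with float endpoints survive it. This is
the main tool to exclude overflow without computing the rounded value. -/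
theorem round_btw (A : Adm p q) {a b x : ℝ} (ha : a ∈ finiteFloats p q)
    (hb : b ∈ finiteFloats p q) (h1 : a ≤ x) (h2 : x ≤ b) : Btw (round p q x) a b := by
  have h3 := (abs_le.1 (abs_le_maxFloat A ha)).1
  have h4 := (abs_le.1 (abs_le_maxFloat A hb)).2
  rw [round_eq_fin (abs_le.2 ⟨by linarith, by linarith⟩)]
  exact ⟨_, rfl, le_roundFinite A (f := ⟨a, ha⟩) h1, roundFinite_le A (f := ⟨b, hb⟩) h2⟩

theorem round_isFin {x : ℝ} (h : |x| ≤ maxFloat p q) : IsFin (round p q x) :=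
  ⟨_, round_eq_fin h⟩

theorem round_le (A : Adm p q) {b x : ℝ} (hb : b ∈ finiteFloats p q) (h : x ≤ b) :
    Le (round p q x) b := by
  unfold round
  split_ifs with h1 h2
  · exact Or.inr ⟨_, rfl, roundFinite_le A (f := ⟨b, hb⟩) h⟩
  · exfalso
    rw [abs_of_pos h2] at h1
    have h4 := (abs_le.1 (abs_le_maxFloat A hb)).2
    have : (0 : ℝ) < 2 ^ (eMax q - p - 1) := by positivity
    linarith
  · exact Or.inl rfl

theorem round_ge (A : Adm p q) {b x : ℝ} (hb : b ∈ finiteFloats p q) (h : b ≤ x) :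
    round p q x = .posInf ∨ ∃ f : Flt p q, round p q x = .fin f ∧ b ≤ f := by
  unfold round
  split_ifs with h1 h2
  · exact Or.inr ⟨_, rfl, le_roundFinite A (f := ⟨b, hb⟩) h⟩
  · exact Or.inl rfl
  · exfalso
    rw [abs_of_nonpos (not_lt.1 h2)] at h1
    have h4 := (abs_le.1 (abs_le_maxFloat A hb)).1
    have : (0 : ℝ) < 2 ^ (eMax q - p - 1) := by positivity
    linarith

/-- Distinct floats are at least 2^(eMin-p) apart, so half of this distance is safe in every binade.
-/
theorem round_near_of_abs_lt (A : Adm p q) {x : ℝ} (y : Flt p q)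
    (h : |x - y| < 2 ^ (eMin q - p - 1)) : round p q x = .fin y := by
  have hw : (2 : ℝ) ^ (eMin q - p) = 2 * 2 ^ (eMin q - p - 1) := by
    rw [← zpow_one_add₀ (by norm_num)]; congr 1; ring
  have hlt : |x| < maxFloat p q + 2 ^ (eMax q - p - 1) := by
    have h1 := abs_le_maxFloat A y.2
    have h2 : (2 : ℝ) ^ (eMin q - p - 1) ≤ 2 ^ (eMax q - p - 1) :=
      zpow_le_zpow_right₀ (by norm_num) (by
        have := A.expRange_ge; rw [eMin_eq, eMax_eq]; omega)
    have h3 : |x| ≤ |x - y| + |(y : ℝ)| := by simpa using abs_add_le (x - y) (y : ℝ)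
    linarith
  unfold round
  rw [if_pos hlt]
  congr 1
  refine roundFinite_eq_of_lt A fun z hz => ?_
  have h1 := min_sep A y.2 z.2 (fun h => hz (Subtype.ext h))
  have h2 : |(z : ℝ) - y| ≤ |x - y| + |x - z| := by
    have := abs_sub_le (z : ℝ) x y
    rw [abs_sub_comm (z : ℝ) x] at this
    linarith
  linarith

/-- Above 2^e the floats lie on a grid of width 2^(e-p), and half of it is allowed. A float below
2^e is no competitor: it is farther from `x` than 2^e, which itself lies on the grid. -/
theorem round_near_of_binade (A : Adm p q) {x : ℝ} {y : Flt p q} {n : ℕ} {e : ℤ}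
    (hy : (y : ℝ) = n * (2 : ℝ) ^ (e - p)) (he : e ≤ eMax q)
    (hx : (2 : ℝ) ^ e ≤ x) (h : |x - y| < 2 ^ (e - p - 1)) : round p q x = .fin y := by
  have hw : (2 : ℝ) ^ (e - p) = 2 * 2 ^ (e - p - 1) := by
    rw [← zpow_one_add₀ (by norm_num)]; congr 1; ring
  have hlt : |x| < maxFloat p q + 2 ^ (eMax q - p - 1) := by
    have h1 := abs_le_maxFloat A y.2
    have h2 : (2 : ℝ) ^ (e - p - 1) ≤ 2 ^ (eMax q - p - 1) :=
      zpow_le_zpow_right₀ (by norm_num) (by omega)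
    have h3 : |x| ≤ |x - y| + |(y : ℝ)| := by simpa using abs_add_le (x - y) (y : ℝ)
    linarith
  have hpe : (2 : ℝ) ^ e = ((2 ^ p : ℤ) : ℝ) * 2 ^ (e - p) := by
    push_cast
    rw [← zpow_natCast, ← zpow_add₀ (by norm_num)]; congr 1; ring
  have key : ∀ w : ℝ, w ≠ y → ∀ k : ℤ, w = k * (2 : ℝ) ^ (e - p) → |x - y| < |x - w| := by
    intro w hw1 k hk
    have h1 := sep_of_grid (by positivity) (show (y : ℝ) = (n : ℤ) * _ by exact_mod_cast hy) hk hw1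
    have h2 : |w - y| ≤ |x - y| + |x - w| := by
      have := abs_sub_le w x y
      rw [abs_sub_comm w x] at this
      linarith
    linarith
  unfold round
  rw [if_pos hlt]
  congr 1
  refine roundFinite_eq_of_lt A fun z hz => ?_
  have hz' : (z : ℝ) ≠ y := fun h => hz (Subtype.ext h)
  rcases le_or_gt ((2 : ℝ) ^ e) z with h1 | h1
  · obtain ⟨k, hk⟩ := exists_eq_mul A z.2 (h1.trans (le_abs_self _))
    exact key z hz' k hk
  · have h3 : |x - y| ≤ |x - (2 : ℝ) ^ e| := by
      by_cases h2 : (2 : ℝ) ^ e = y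
      · rw [h2]
      · exact (key _ h2 _ hpe).le
    rw [abs_of_nonneg (show 0 ≤ x - (2 : ℝ) ^ e by linarith)] at h3
    rw [abs_of_nonneg (show 0 ≤ x - z by linarith)]
    linarith

end Rounding

/-! ### Arithmetic -/

section Arithmetic

variable {p q : ℕ}

theorem fin_add (x y : Flt p q) : (ExtFlt.fin x) ⊕ₑ (.fin y) = round p q ((x : ℝ) + y) := rfl

theorem fin_mul (x y : Flt p q) : (ExtFlt.fin x) ⊗ₑ (.fin y) = round p q ((x : ℝ) * y) := rfl

theorem zero_eq_fin : (0 : ExtFlt p q) = .fin 0 := rfl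

theorem coe_zero : ((0 : Flt p q) : ℝ) = 0 := rfl

theorem round_zero (A : Adm p q) : round p q 0 = 0 := round_coe A 0

theorem add_zero' (A : Adm p q) (x : ExtFlt p q) : x ⊕ₑ 0 = x := by
  cases x with
  | fin x =>
    rw [zero_eq_fin, fin_add, coe_zero, add_zero, round_coe A]
  | _ => rfl

theorem zero_add' (A : Adm p q) (x : ExtFlt p q) : 0 ⊕ₑ x = x := by
  cases x with
  | fin x =>
    rw [zero_eq_fin, fin_add, coe_zero, zero_add, round_coe A]
  | _ => rfl

theorem zero_mul_fin (A : Adm p q) {x : ExtFlt p q} (hx : IsFin x) : 0 ⊗ₑ x = 0 := by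
  obtain ⟨f, rfl⟩ := hx
  rw [zero_eq_fin, fin_mul, coe_zero, zero_mul, round_zero A]; rfl

theorem mul_zero_fin (A : Adm p q) {x : ExtFlt p q} (hx : IsFin x) : x ⊗ₑ 0 = 0 := by
  obtain ⟨f, rfl⟩ := hx
  rw [zero_eq_fin, fin_mul, coe_zero, mul_zero, round_zero A]; rfl

theorem isFin_zero : IsFin (0 : ExtFlt p q) := ⟨0, rfl⟩

theorem isFin_fin (x : Flt p q) : IsFin (ExtFlt.fin x) := ⟨x, rfl⟩

theorem Le.add (A : Adm p q) {x y : ExtFlt p q} {r s t : ℝ} (hx : Le x r) (hy : Le y s)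
    (ht : t ∈ finiteFloats p q) (h : r + s ≤ t) : Le (x ⊕ₑ y) t := by
  rcases hx with rfl | ⟨f, rfl, hf⟩ <;> rcases hy with rfl | ⟨g, rfl, hg⟩
  · exact Or.inl rfl
  · exact Or.inl rfl
  · exact Or.inl rfl
  · rw [fin_add]
    exact round_le A ht (by linarith)

theorem Btw.add (A : Adm p q) {x y : ExtFlt p q} {a b c d u v : ℝ} (hx : Btw x a b)
    (hy : Btw y c d) (hu : u ∈ finiteFloats p q) (hv : v ∈ finiteFloats p q) (h1 : u ≤ a + c)
    (h2 : b + d ≤ v) : Btw (x ⊕ₑ y) u v := by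
  obtain ⟨f, rfl, hf, hf'⟩ := hx
  obtain ⟨g, rfl, hg, hg'⟩ := hy
  rw [fin_add]
  exact round_btw A hu hv (by linarith) (by linarith)

theorem Btw.mul (A : Adm p q) {w : Flt p q} {x : ExtFlt p q} {a b u v : ℝ} (hw : 0 ≤ (w : ℝ))
    (hx : Btw x a b) (hu : u ∈ finiteFloats p q) (hv : v ∈ finiteFloats p q) (h1 : u ≤ w * a)
    (h2 : w * b ≤ v) : Btw (.fin w ⊗ₑ x) u v := by
  obtain ⟨f, rfl, hf, hf'⟩ := hx
  rw [fin_mul]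
  exact round_btw A hu hv (h1.trans (mul_le_mul_of_nonneg_left hf hw))
    ((mul_le_mul_of_nonneg_left hf' hw).trans h2)

theorem Btw.neg_mul (A : Adm p q) {w : Flt p q} {x : ExtFlt p q} {a b u v : ℝ} (hw : (w : ℝ) ≤ 0)
    (hx : Btw x a b) (hu : u ∈ finiteFloats p q) (hv : v ∈ finiteFloats p q) (h1 : u ≤ w * b)
    (h2 : w * a ≤ v) : Btw (.fin w ⊗ₑ x) u v := by
  obtain ⟨f, rfl, hf, hf'⟩ := hx
  rw [fin_mul]
  exact round_btw A hu hv (h1.trans (mul_le_mul_of_nonpos_left hf' hw))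
    ((mul_le_mul_of_nonpos_left hf hw).trans h2)

theorem exact_mul (A : Adm p q) {x y : Flt p q} {z : ℝ} (hz : z ∈ finiteFloats p q)
    (h : (x : ℝ) * y = z) : (ExtFlt.fin x) ⊗ₑ (.fin y) = .fin ⟨z, hz⟩ := by
  rw [fin_mul, h, round_of_mem A hz]

theorem exact_add (A : Adm p q) {x y : Flt p q} {z : ℝ} (hz : z ∈ finiteFloats p q)
    (h : (x : ℝ) + y = z) : (ExtFlt.fin x) ⊕ₑ (.fin y) = .fin ⟨z, hz⟩ := by
  rw [fin_add, h, round_of_mem A hz]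

/-- The float `-x`. -/
def fneg (x : Flt p q) : Flt p q := ⟨-x, neg_mem x.2⟩

theorem coe_fneg (x : Flt p q) : ((fneg x : Flt p q) : ℝ) = -x := rfl

theorem add_fneg (A : Adm p q) (x : Flt p q) : (ExtFlt.fin x) ⊕ₑ (.fin (fneg x)) = 0 := by
  rw [fin_add, coe_fneg, add_neg_cancel, round_zero A]

theorem fneg_mul (A : Adm p q) {w x y : Flt p q} (h : (ExtFlt.fin w) ⊗ₑ (.fin x) = .fin y) :
    (ExtFlt.fin (fneg w)) ⊗ₑ (.fin x) = .fin (fneg y) := by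
  rw [fin_mul] at h ⊢
  rw [coe_fneg, neg_mul, round_neg A h]; rfl

theorem mul_fneg (A : Adm p q) {w x y : Flt p q} (h : (ExtFlt.fin w) ⊗ₑ (.fin x) = .fin y) :
    (ExtFlt.fin w) ⊗ₑ (.fin (fneg x)) = .fin (fneg y) := by
  rw [fin_mul] at h ⊢
  rw [coe_fneg, mul_neg, round_neg A h]; rfl

end Arithmetic

end FloatNet

namespace FloatNet

/-! ### Left-to-right sums with an initial accumulator -/

section Accumulate

variable {p q : ℕ}

/-- Adds `x 0, …, x (n - 1)` to `s`, from left to right. -/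
noncomputable def facc (s : ExtFlt p q) : (n : ℕ) → (Fin n → ExtFlt p q) → ExtFlt p q
  | 0, _ => s
  | n + 1, x => facc s n (fun i => x i.castSucc) ⊕ₑ x (Fin.last n)

theorem fsum_eq_facc (n : ℕ) (x : Fin n → ExtFlt p q) : fsum n x = facc 0 n x := by
  induction n with
  | zero => rfl
  | succ n ih => rw [fsum, facc, ih]

/-- This is the reason for carrying an initial value: without associativity, the sum over a
concatenation is not the sum of two sums, but it is the second sum started at the result of the
first. -/
theorem facc_append (s : ExtFlt p q) (a b : ℕ) (x : Fin a → ExtFlt p q) (y : Fin b → ExtFlt p q) :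
    facc s (a + b) (Fin.append x y) = facc (facc s a x) b y := by
  induction b with
  | zero =>
    change facc s a _ = facc s a x
    congr 1
    funext i
    exact Fin.append_left x y i
  | succ b ih =>
    change facc s (a + b) _ ⊕ₑ _ = facc (facc s a x) b _ ⊕ₑ _
    rw [← ih (fun i => y i.castSucc)]
    congr 1
    · congr 1
      funext i
      refine Fin.addCases (fun i => ?_) (fun i => ?_) i
      · rw [Fin.append_left]
        exact Fin.append_left x y i
      · rw [Fin.append_right]
        exact Fin.append_right x y i.castSucc
    · exact Fin.append_right x y (Fin.last b)

theorem facc_zero (A : Adm p q) (s : ExtFlt p q) (n : ℕ) {x : Fin n → ExtFlt p q}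
    (hx : ∀ i, x i = 0) : facc s n x = s := by
  induction n with
  | zero => rfl
  | succ n ih => rw [facc, ih (fun i => hx _), hx, add_zero' A]

theorem facc_single (A : Adm p q) (s : ExtFlt p q) (n : ℕ) {x : Fin n → ExtFlt p q} (j : Fin n)
    (hx : ∀ i, i ≠ j → x i = 0) : facc s n x = s ⊕ₑ x j := by
  induction n with
  | zero => exact j.elim0
  | succ n ih =>
    rw [facc]
    refine Fin.lastCases (fun hx => ?_) (fun j hx => ?_) j hx
    · rw [facc_zero A]
      intro i
      exact hx _ (Fin.castSucc_lt_last i).ne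
    · rw [ih j (fun i hi => hx _ (fun h => hi (Fin.castSucc_injective _ h))),
        hx _ (Fin.castSucc_lt_last j).ne', add_zero' A]

theorem facc_one (s : ExtFlt p q) (x : Fin 1 → ExtFlt p q) : facc s 1 x = s ⊕ₑ x 0 := rfl

theorem facc_two (s : ExtFlt p q) (x : Fin 2 → ExtFlt p q) :
    facc s 2 x = s ⊕ₑ x 0 ⊕ₑ x 1 := rfl

end Accumulate

/-! ### Affine maps, stacked and block diagonal -/

section AffineMaps

variable {p q : ℕ}

theorem Affine.eval_apply {m n : ℕ} (ρ : Affine p q m n) (x : Fin m → ExtFlt p q) (i : Fin n) :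
    ρ.eval x i = facc 0 m (fun j => .fin (ρ.A i j) ⊗ₑ x j) ⊕ₑ .fin (ρ.b i) := by
  unfold Affine.eval mulVec
  rw [fsum_eq_facc]; rfl

theorem Affine.grad_apply {m n : ℕ} (ρ : Affine p q m n) (g : Fin n → ExtFlt p q) (j : Fin m) :
    ρ.grad g j = facc 0 n (fun i => g i ⊗ₑ .fin (ρ.A i j)) := by
  unfold Affine.grad vecMul
  rw [fsum_eq_facc]; rfl

/-- The off-diagonal zeros of the diagonal matrix contribute 0 only against finite entries, since 0
⊗ ∞ is NaN. Hence the finiteness conditions that accompany all gradients below. -/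
theorem activationGrad_apply (A : Adm p q) (σ' : ExtFlt p q → ExtFlt p q) {n : ℕ}
    {x g : Fin n → ExtFlt p q} (hg : ∀ i, IsFin (g i)) (j : Fin n) :
    activationGrad σ' x g j = g j ⊗ₑ σ' (x j) := by
  unfold activationGrad vecMul
  rw [fsum_eq_facc, facc_single A 0 n j, zero_add' A, Matrix.diagonal_apply_eq]
  intro i hi
  rw [Matrix.diagonal_apply_ne _ hi, mul_zero_fin A (hg i)]

/-- Two affine maps of the same input. -/
def Affine.stack {m n₁ n₂ : ℕ} (ρ₁ : Affine p q m n₁) (ρ₂ : Affine p q m n₂) :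
    Affine p q m (n₁ + n₂) where
  A := Fin.append ρ₁.A ρ₂.A
  b := Fin.append ρ₁.b ρ₂.b

/-- Two affine maps of separate inputs. -/
def Affine.block {m₁ m₂ n₁ n₂ : ℕ} (ρ₁ : Affine p q m₁ n₁) (ρ₂ : Affine p q m₂ n₂) :
    Affine p q (m₁ + m₂) (n₁ + n₂) where
  A := Fin.append (fun i => Fin.append (ρ₁.A i) fun _ => 0)
    (fun i => Fin.append (fun _ => 0) (ρ₂.A i))
  b := Fin.append ρ₁.b ρ₂.b

theorem Affine.stack_left {m n₁ n₂ : ℕ} (ρ₁ : Affine p q m n₁) (ρ₂ : Affine p q m n₂)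
    (i : Fin n₁) (j : Fin m) : (ρ₁.stack ρ₂).A (Fin.castAdd n₂ i) j = ρ₁.A i j :=
  congrFun (Fin.append_left (α := Fin m → Flt p q) _ _ i) j

theorem Affine.stack_right {m n₁ n₂ : ℕ} (ρ₁ : Affine p q m n₁) (ρ₂ : Affine p q m n₂)
    (i : Fin n₂) (j : Fin m) : (ρ₁.stack ρ₂).A (Fin.natAdd n₁ i) j = ρ₂.A i j :=
  congrFun (Fin.append_right (α := Fin m → Flt p q) _ _ i) j

section

variable {m₁ m₂ n₁ n₂ : ℕ} (ρ₁ : Affine p q m₁ n₁) (ρ₂ : Affine p q m₂ n₂)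

theorem Affine.block_left_left (i : Fin n₁) (j : Fin m₁) :
    (ρ₁.block ρ₂).A (Fin.castAdd n₂ i) (Fin.castAdd m₂ j) = ρ₁.A i j := by
  change Fin.append (fun i => Fin.append (ρ₁.A i) fun _ => 0)
    (fun i => Fin.append (fun _ => 0) (ρ₂.A i)) _ _ = _
  rw [Fin.append_left, Fin.append_left]

theorem Affine.block_left_right (i : Fin n₁) (j : Fin m₂) :
    (ρ₁.block ρ₂).A (Fin.castAdd n₂ i) (Fin.natAdd m₁ j) = 0 := by
  change Fin.append (fun i => Fin.append (ρ₁.A i) fun _ => 0)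
    (fun i => Fin.append (fun _ => 0) (ρ₂.A i)) _ _ = _
  rw [Fin.append_left, Fin.append_right]

theorem Affine.block_right_left (i : Fin n₂) (j : Fin m₁) :
    (ρ₁.block ρ₂).A (Fin.natAdd n₁ i) (Fin.castAdd m₂ j) = 0 := by
  change Fin.append (fun i => Fin.append (ρ₁.A i) fun _ => 0)
    (fun i => Fin.append (fun _ => 0) (ρ₂.A i)) _ _ = _
  rw [Fin.append_right, Fin.append_left]

theorem Affine.block_right_right (i : Fin n₂) (j : Fin m₂) :
    (ρ₁.block ρ₂).A (Fin.natAdd n₁ i) (Fin.natAdd m₁ j) = ρ₂.A i j := by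
  change Fin.append (fun i => Fin.append (ρ₁.A i) fun _ => 0)
    (fun i => Fin.append (fun _ => 0) (ρ₂.A i)) _ _ = _
  rw [Fin.append_right, Fin.append_right]

end

theorem eq_append {α : Type*} {a b : ℕ} {f : Fin (a + b) → α} {u : Fin a → α} {v : Fin b → α}
    (h₁ : ∀ i, f (Fin.castAdd b i) = u i) (h₂ : ∀ i, f (Fin.natAdd a i) = v i) :
    f = Fin.append u v := by
  funext i
  refine Fin.addCases (fun i => ?_) (fun i => ?_) i
  · rw [Fin.append_left, h₁]
  · rw [Fin.append_right, h₂]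

theorem Affine.eval_stack {m n₁ n₂ : ℕ} (ρ₁ : Affine p q m n₁) (ρ₂ : Affine p q m n₂)
    (x : Fin m → ExtFlt p q) :
    (ρ₁.stack ρ₂).eval x = Fin.append (ρ₁.eval x) (ρ₂.eval x) := by
  refine eq_append (fun i => ?_) (fun i => ?_)
  · rw [eval_apply, eval_apply]
    simp only [stack_left]
    rw [show (ρ₁.stack ρ₂).b (Fin.castAdd n₂ i) = ρ₁.b i from Fin.append_left _ _ i]
  · rw [eval_apply, eval_apply]
    simp only [stack_right]
    rw [show (ρ₁.stack ρ₂).b (Fin.natAdd n₁ i) = ρ₂.b i from Fin.append_right _ _ i]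

theorem append_map₂ {α β γ : Type*} {a b : ℕ} (f : α → β → γ) (x₁ : Fin a → α) (x₂ : Fin b → α)
    (y₁ : Fin a → β) (y₂ : Fin b → β) :
    (fun i => f (Fin.append x₁ x₂ i) (Fin.append y₁ y₂ i)) =
      Fin.append (fun i => f (x₁ i) (y₁ i)) (fun i => f (x₂ i) (y₂ i)) := by
  funext i
  refine Fin.addCases (fun i => ?_) (fun i => ?_) i
  · simp only [Fin.append_left]
  · simp only [Fin.append_right]

theorem append_map {α β : Type*} {a b : ℕ} (f : α → β) (x₁ : Fin a → α) (x₂ : Fin b → α) :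
    (fun i => f (Fin.append x₁ x₂ i)) = Fin.append (fun i => f (x₁ i)) (fun i => f (x₂ i)) := by
  funext i
  refine Fin.addCases (fun i => ?_) (fun i => ?_) i
  · simp only [Fin.append_left]
  · simp only [Fin.append_right]

/-- The zero blocks are harmless exactly because the other half of the input is finite, and adding
the resulting zeros changes no partial sum. -/
theorem Affine.eval_block (A : Adm p q) {m₁ m₂ n₁ n₂ : ℕ} (ρ₁ : Affine p q m₁ n₁)
    (ρ₂ : Affine p q m₂ n₂) {x₁ : Fin m₁ → ExtFlt p q} {x₂ : Fin m₂ → ExtFlt p q}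
    (h₁ : ∀ i, IsFin (x₁ i)) (h₂ : ∀ i, IsFin (x₂ i)) :
    (ρ₁.block ρ₂).eval (Fin.append x₁ x₂) = Fin.append (ρ₁.eval x₁) (ρ₂.eval x₂) := by
  funext i
  refine Fin.addCases (fun i => ?_) (fun i => ?_) i
  · rw [Fin.append_left, eval_apply, eval_apply]
    simp only [block, Fin.append_left]
    rw [append_map₂ (fun (a : Flt p q) y => (ExtFlt.fin a) ⊗ₑ y), facc_append, facc_zero A]
    exact fun j => zero_mul_fin A (h₂ j)
  · rw [Fin.append_right, eval_apply, eval_apply]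
    simp only [block, Fin.append_right]
    rw [append_map₂ (fun (a : Flt p q) y => (ExtFlt.fin a) ⊗ₑ y), facc_append, facc_zero A 0 m₁]
    exact fun j => zero_mul_fin A (h₁ j)

theorem Affine.grad_block (A : Adm p q) {m₁ m₂ n₁ n₂ : ℕ} (ρ₁ : Affine p q m₁ n₁)
    (ρ₂ : Affine p q m₂ n₂) {g₁ : Fin n₁ → ExtFlt p q} {g₂ : Fin n₂ → ExtFlt p q}
    (h₁ : ∀ i, IsFin (g₁ i)) (h₂ : ∀ i, IsFin (g₂ i)) :
    (ρ₁.block ρ₂).grad (Fin.append g₁ g₂) = Fin.append (ρ₁.grad g₁) (ρ₂.grad g₂) := by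
  refine eq_append (fun j => ?_) (fun j => ?_)
  · rw [grad_apply, grad_apply]
    refine Eq.trans (congrArg (facc 0 (n₁ + n₂)) (eq_append (u := fun i => g₁ i ⊗ₑ .fin (ρ₁.A i j))
      (v := fun i => g₂ i ⊗ₑ .fin 0) (fun i => ?_) (fun i => ?_))) ?_
    · rw [Fin.append_left, block_left_left]
    · rw [Fin.append_right, block_right_left]
    · rw [facc_append, facc_zero A]
      exact fun i => mul_zero_fin A (h₂ i)
  · rw [grad_apply, grad_apply]
    refine Eq.trans (congrArg (facc 0 (n₁ + n₂)) (eq_append (u := fun i => g₁ i ⊗ₑ .fin 0)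
      (v := fun i => g₂ i ⊗ₑ .fin (ρ₂.A i j)) (fun i => ?_) (fun i => ?_))) ?_
    · rw [Fin.append_left, block_left_right]
    · rw [Fin.append_right, block_right_right]
    · rw [facc_append, facc_zero A 0 n₁]
      exact fun i => mul_zero_fin A (h₁ i)

end AffineMaps

/-! ### Towers: parallel composition, evaluation and gradients -/

/-- A network with `l` hidden layers, described from the first layer to the last one. -/
inductive Tower (p q : ℕ) : (l m n : ℕ) → Type
  | base {m n : ℕ} (ρ : Affine p q m n) : Tower p q 0 m n
  | snoc {l m k n : ℕ} (T : Tower p q l m k) (hk : 0 < k) (ρ : Affine p q k n) :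
      Tower p q (l + 1) m n

/-- Adds a layer at the end of a network. -/
def Network.snoc {p q : ℕ} : {L m k n : ℕ} → Network p q L m k → 0 < k → Affine p q k n →
    Network p q (L + 1) m n
  | _, _, _, _, .last ρ, hk, ρ' => .cons ρ hk (.last ρ')
  | _, _, _, _, .cons ρ h N, hk, ρ' => .cons ρ h (N.snoc hk ρ')

namespace Tower

variable {p q : ℕ}

/-- The network described by a tower. -/
def toNetwork : {l m n : ℕ} → Tower p q l m n → Network p q (l + 1) m n
  | _, _, _, base ρ => .last ρ
  | _, _, _, snoc T hk ρ => T.toNetwork.snoc hk ρ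

/-- Parallel composition: two towers with a common input. -/
def par : {l m n₁ n₂ : ℕ} → Tower p q l m n₁ → Tower p q l m n₂ → Tower p q l m (n₁ + n₂)
  | _, _, _, _, base ρ₁, base ρ₂ => base (ρ₁.stack ρ₂)
  | _, _, _, _, snoc T₁ h₁ ρ₁, snoc T₂ _ ρ₂ =>
      snoc (T₁.par T₂) (Nat.add_pos_left h₁ _) (ρ₁.block ρ₂)

section Semantics

variable (σ σ' : ExtFlt p q → ExtFlt p q)

/-- The function computed by a tower. -/
noncomputable def eval : {l m n : ℕ} → Tower p q l m n → (Fin m → ExtFlt p q) →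
    (Fin n → ExtFlt p q)
  | _, _, _, base ρ, x => ρ.eval x
  | _, _, _, snoc T _ ρ, x => ρ.eval fun i => σ (T.eval x i)

/-- The output gradient of a tower, added to `t`. -/
noncomputable def gradFrom : {l m n : ℕ} → (t : Fin m → ExtFlt p q) → Tower p q l m n →
    (x : Fin m → ExtFlt p q) → (g : Fin n → ExtFlt p q) → (Fin m → ExtFlt p q)
  | _, _, _, t, base ρ, _, g => fun k => facc (t k) _ fun i => g i ⊗ₑ .fin (ρ.A i k)
  | _, _, _, t, snoc T _ ρ, x, g => gradFrom t T x fun j => ρ.grad g j ⊗ₑ σ' (T.eval σ x j)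

/-- All values of the activation function and of its derivative are finite. -/
def Regular : {l m n : ℕ} → Tower p q l m n → (Fin m → ExtFlt p q) → Prop
  | _, _, _, base _, _ => True
  | _, _, _, snoc T _ _, x =>
      T.Regular x ∧ ∀ i, IsFin (σ (T.eval σ x i)) ∧ IsFin (σ' (T.eval σ x i))

/-- All gradients are finite. -/
def GradFinite : {l m n : ℕ} → Tower p q l m n → (Fin m → ExtFlt p q) →
    (Fin n → ExtFlt p q) → Prop
  | _, _, _, base _, _, g => ∀ i, IsFin (g i)
  | _, _, _, snoc T _ ρ, x, g => (∀ i, IsFin (g i)) ∧ (∀ j, IsFin (ρ.grad g j)) ∧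
      T.GradFinite x fun j => ρ.grad g j ⊗ₑ σ' (T.eval σ x j)

end Semantics

variable {σ σ' : ExtFlt p q → ExtFlt p q}

theorem _root_.FloatNet.Network.eval_snoc {L m k n : ℕ} (N : Network p q L m k) (hk : 0 < k)
    (ρ : Affine p q k n) (x : Fin m → ExtFlt p q) :
    (N.snoc hk ρ).eval σ x = ρ.eval fun i => σ (N.eval σ x i) := by
  induction N with
  | last ρ' => rfl
  | cons ρ' h N ih => exact ih hk ρ _

theorem _root_.FloatNet.Network.grad_snoc {L m k n : ℕ} (N : Network p q L m k) (hk : 0 < k)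
    (ρ : Affine p q k n) (x : Fin m → ExtFlt p q) (g : Fin n → ExtFlt p q) :
    (N.snoc hk ρ).grad σ σ' x g = N.grad σ σ' x (activationGrad σ' (N.eval σ x) (ρ.grad g)) := by
  induction N with
  | last ρ' => rfl
  | cons ρ' h N ih =>
    simp only [Network.snoc, Network.grad]
    rw [ih hk ρ]; rfl

theorem eval_toNetwork {l m n : ℕ} (T : Tower p q l m n) (x : Fin m → ExtFlt p q) :
    T.toNetwork.eval σ x = T.eval σ x := by
  induction T with
  | base ρ => rfl
  | snoc T hk ρ ih => rw [toNetwork, Network.eval_snoc, ih]; rfl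

/-- `GradFinite` is what collapses each product with a diagonal matrix to a coordinatewise product;
the gradient sum of the first layer starts at 0. -/
theorem grad_toNetwork (A : Adm p q) {l m n : ℕ} (T : Tower p q l m n) (x : Fin m → ExtFlt p q)
    (g : Fin n → ExtFlt p q) (h : T.GradFinite σ σ' x g) :
    T.toNetwork.grad σ σ' x g = T.gradFrom σ σ' 0 x g := by
  induction T with
  | base ρ => funext k; exact ρ.grad_apply g k
  | snoc T hk ρ ih =>
    rw [toNetwork, Network.grad_snoc, gradFrom, ← ih _ _ h.2.2]
    congr 1
    funext j
    rw [activationGrad_apply A σ' h.2.1, eval_toNetwork]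

theorem eval_par (A : Adm p q) {l m n₁ n₂ : ℕ} (T₁ : Tower p q l m n₁) (T₂ : Tower p q l m n₂)
    (x : Fin m → ExtFlt p q) (h₁ : T₁.Regular σ σ' x) (h₂ : T₂.Regular σ σ' x) :
    (T₁.par T₂).Regular σ σ' x ∧
      (T₁.par T₂).eval σ x = Fin.append (T₁.eval σ x) (T₂.eval σ x) := by
  induction T₁ generalizing n₂ with
  | base ρ₁ =>
    cases T₂ with
    | base ρ₂ => exact ⟨trivial, Affine.eval_stack _ _ _⟩
  | snoc T₁ k₁ ρ₁ ih =>
    cases T₂ with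
    | snoc T₂ k₂ ρ₂ =>
      obtain ⟨h3, h4⟩ := ih T₂ x h₁.1 h₂.1
      refine ⟨⟨h3, fun i => ?_⟩, ?_⟩
      · rw [h4]
        refine Fin.addCases (fun i => ?_) (fun i => ?_) i
        · rw [Fin.append_left]; exact h₁.2 i
        · rw [Fin.append_right]; exact h₂.2 i
      · simp only [par, eval]
        rw [h4, append_map σ, Affine.eval_block A _ _ (fun i => (h₁.2 i).1) (fun i => (h₂.2 i).1)]

/-- In the hidden layers the two gradients stay separate because the weights are block diagonal.
They meet only in the first layer, whose rows are stacked: the left-to-right sum runs through the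
rows of `T₁` and then continues with those of `T₂`. -/
theorem grad_par (A : Adm p q) {l m n₁ n₂ : ℕ} (T₁ : Tower p q l m n₁) (T₂ : Tower p q l m n₂)
    (x : Fin m → ExtFlt p q) (h₁ : T₁.Regular σ σ' x) (h₂ : T₂.Regular σ σ' x)
    (g₁ : Fin n₁ → ExtFlt p q) (g₂ : Fin n₂ → ExtFlt p q) (hg₁ : T₁.GradFinite σ σ' x g₁)
    (hg₂ : T₂.GradFinite σ σ' x g₂) (t : Fin m → ExtFlt p q) :
    (T₁.par T₂).GradFinite σ σ' x (Fin.append g₁ g₂) ∧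
      (T₁.par T₂).gradFrom σ σ' t x (Fin.append g₁ g₂) =
        T₂.gradFrom σ σ' (T₁.gradFrom σ σ' t x g₁) x g₂ := by
  have happ : ∀ {a b : ℕ} {u : Fin a → ExtFlt p q} {v : Fin b → ExtFlt p q},
      (∀ i, IsFin (u i)) → (∀ i, IsFin (v i)) → ∀ i, IsFin (Fin.append u v i) := by
    intro a b u v hu hv i
    refine Fin.addCases (fun i => ?_) (fun i => ?_) i
    · rw [Fin.append_left]; exact hu i
    · rw [Fin.append_right]; exact hv i
  induction T₁ generalizing n₂ with
  | base ρ₁ =>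
    cases T₂ with
    | base ρ₂ =>
      refine ⟨happ hg₁ hg₂, ?_⟩
      funext k
      simp only [par, gradFrom]
      rw [← facc_append]
      congr 1
      refine eq_append (fun i => ?_) (fun i => ?_)
      · rw [Fin.append_left, Affine.stack_left]
      · rw [Fin.append_right, Affine.stack_right]
  | snoc T₁ k₁ ρ₁ ih =>
    cases T₂ with
    | snoc T₂ k₂ ρ₂ =>
      obtain ⟨-, h4⟩ := eval_par A T₁ T₂ x h₁.1 h₂.1
      have h5 : (fun j => (ρ₁.block ρ₂).grad (Fin.append g₁ g₂) j ⊗ₑ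
          σ' ((T₁.par T₂).eval σ x j)) =
          Fin.append (fun j => ρ₁.grad g₁ j ⊗ₑ σ' (T₁.eval σ x j))
            (fun j => ρ₂.grad g₂ j ⊗ₑ σ' (T₂.eval σ x j)) := by
        rw [h4, Affine.grad_block A _ _ hg₁.1 hg₂.1]
        exact append_map₂ (fun y z => y ⊗ₑ σ' z) _ _ _ _
      obtain ⟨h6, h7⟩ := ih T₂ x h₁.1 h₂.1 _ _ hg₁.2.2 hg₂.2.2 t
      refine ⟨⟨happ hg₁.1 hg₂.1, ?_, ?_⟩, ?_⟩
      · rw [Affine.grad_block A _ _ hg₁.1 hg₂.1]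
        exact happ hg₁.2.1 hg₂.2.1
      · rw [h5]; exact h6
      · simp only [par, gradFrom]
        rw [h5]; exact h7

/-- A zero gradient stays zero through finite weights and derivatives, and adding zeros leaves every
accumulator unchanged, even a non-finite one. -/
theorem gradFrom_zero (A : Adm p q) {l m n : ℕ} (T : Tower p q l m n) (x : Fin m → ExtFlt p q)
    (h : T.Regular σ σ' x) (g : Fin n → ExtFlt p q) (hg : ∀ i, g i = 0)
    (t : Fin m → ExtFlt p q) : T.GradFinite σ σ' x g ∧ T.gradFrom σ σ' t x g = t := by
  induction T with
  | base ρ =>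
    refine ⟨fun i => by rw [hg]; exact isFin_zero, funext fun k => facc_zero A _ _ fun i => ?_⟩
    rw [hg, zero_mul_fin A (isFin_fin _)]
  | snoc T hk ρ ih =>
    have h1 : ∀ j, ρ.grad g j = 0 := fun j => by
      rw [Affine.grad_apply, facc_zero A]
      intro i
      rw [hg, zero_mul_fin A (isFin_fin _)]
    obtain ⟨h2, h3⟩ := ih x h.1 (fun j => ρ.grad g j ⊗ₑ σ' (T.eval σ x j))
      (fun j => by rw [h1, zero_mul_fin A (h.2 j).2]) t
    exact ⟨⟨fun i => by rw [hg]; exact isFin_zero, fun j => by rw [h1]; exact isFin_zero, h2⟩, h3⟩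

end Tower

/-! ### Blocks -/

/-- A tower, with the weights of its outputs in a subsequent summation. -/
structure Block (p q l d : ℕ) where
  n : ℕ
  hn : 0 < n
  T : Tower p q l d n
  a : Fin n → Flt p q

namespace Block

variable {p q l d : ℕ}

/-- Two blocks side by side. -/
def par (B₁ B₂ : Block p q l d) : Block p q l d where
  n := B₁.n + B₂.n
  hn := Nat.add_pos_left B₁.hn _
  T := B₁.T.par B₂.T
  a := Fin.append B₁.a B₂.a

/-- The row of output weights as an affine map. -/
def row (B : Block p q l d) (b : Flt p q) : Affine p q B.n 1 := ⟨fun _ => B.a, fun _ => b⟩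

/-- The tower that sums up the outputs of a block. -/
def close (B : Block p q l d) (b : Flt p q) : Tower p q (l + 1) d 1 := .snoc B.T B.hn (B.row b)

variable (σ σ' : ExtFlt p q → ExtFlt p q)

/-- On the input `x` with gradient `h`, the block changes the accumulated output `s` and the
accumulated gradient `t` into `s'` and `t'`. -/
structure Run (B : Block p q l d) (x : Fin d → ExtFlt p q) (h : Flt p q) (s : ExtFlt p q)
    (t : Fin d → ExtFlt p q) (s' : ExtFlt p q) (t' : Fin d → ExtFlt p q) : Prop where
  regular : B.T.Regular σ σ' x
  value : ∀ i, IsFin (σ (B.T.eval σ x i))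
  deriv : ∀ i, IsFin (σ' (B.T.eval σ x i))
  weight : ∀ i, IsFin (.fin h ⊗ₑ .fin (B.a i))
  grad : B.T.GradFinite σ σ' x fun i => .fin h ⊗ₑ .fin (B.a i) ⊗ₑ σ' (B.T.eval σ x i)
  out : facc s B.n (fun i => .fin (B.a i) ⊗ₑ σ (B.T.eval σ x i)) = s'
  gradOut : B.T.gradFrom σ σ' t x
    (fun i => .fin h ⊗ₑ .fin (B.a i) ⊗ₑ σ' (B.T.eval σ x i)) = t'

variable {σ σ'}

/-- Side by side in the network means one after the other on the accumulators, for the output and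
for the gradient alike. -/
theorem Run.par (A : Adm p q) {B₁ B₂ : Block p q l d} {x : Fin d → ExtFlt p q} {h : Flt p q}
    {s s₁ s₂ : ExtFlt p q} {t t₁ t₂ : Fin d → ExtFlt p q} (R₁ : B₁.Run σ σ' x h s t s₁ t₁)
    (R₂ : B₂.Run σ σ' x h s₁ t₁ s₂ t₂) : (B₁.par B₂).Run σ σ' x h s t s₂ t₂ := by
  obtain ⟨h1, h2⟩ := Tower.eval_par A B₁.T B₂.T x R₁.regular R₂.regular
  have h3 : (fun i => (ExtFlt.fin h) ⊗ₑ .fin ((B₁.par B₂).a i) ⊗ₑ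
      σ' ((B₁.par B₂).T.eval σ x i)) =
      Fin.append (fun i => .fin h ⊗ₑ .fin (B₁.a i) ⊗ₑ σ' (B₁.T.eval σ x i))
        (fun i => .fin h ⊗ₑ .fin (B₂.a i) ⊗ₑ σ' (B₂.T.eval σ x i)) := by
    change (fun i => _ ⊗ₑ .fin (Fin.append B₁.a B₂.a i) ⊗ₑ σ' ((B₁.T.par B₂.T).eval σ x i)) = _
    rw [h2]
    exact append_map₂ (fun (a : Flt p q) y => (ExtFlt.fin h) ⊗ₑ .fin a ⊗ₑ σ' y) _ _ _ _
  obtain ⟨h4, h5⟩ := Tower.grad_par A B₁.T B₂.T x R₁.regular R₂.regular _ _ R₁.grad R₂.grad t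
  refine ⟨h1, fun i => ?_, fun i => ?_, fun i => ?_, by rw [h3]; exact h4, ?_, ?_⟩
  · change IsFin (σ ((B₁.T.par B₂.T).eval σ x i))
    rw [h2]
    refine Fin.addCases (fun i => ?_) (fun i => ?_) i
    · rw [Fin.append_left]; exact R₁.value i
    · rw [Fin.append_right]; exact R₂.value i
  · change IsFin (σ' ((B₁.T.par B₂.T).eval σ x i))
    rw [h2]
    refine Fin.addCases (fun i => ?_) (fun i => ?_) i
    · rw [Fin.append_left]; exact R₁.deriv i
    · rw [Fin.append_right]; exact R₂.deriv i
  · change IsFin (_ ⊗ₑ .fin (Fin.append B₁.a B₂.a i))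
    refine Fin.addCases (fun i => ?_) (fun i => ?_) i
    · rw [Fin.append_left]; exact R₁.weight i
    · rw [Fin.append_right]; exact R₂.weight i
  · change facc s (B₁.n + B₂.n) (fun i => .fin (Fin.append B₁.a B₂.a i) ⊗ₑ
      σ ((B₁.T.par B₂.T).eval σ x i)) = _
    rw [h2, append_map₂ (fun (a : Flt p q) y => (ExtFlt.fin a) ⊗ₑ σ y), facc_append, R₁.out, R₂.out]
  · rw [h3]
    refine h5.trans ?_
    rw [R₁.gradOut, R₂.gradOut]

theorem eval_close (B : Block p q l d) (b : Flt p q) (x : Fin d → ExtFlt p q) :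
    (B.close b).eval σ x = fun _ =>
      facc 0 B.n (fun i => .fin (B.a i) ⊗ₑ σ (B.T.eval σ x i)) ⊕ₑ .fin b := by
  funext i
  exact Affine.eval_apply _ _ _

theorem Run.close (A : Adm p q) {B : Block p q l d} {x : Fin d → ExtFlt p q} {h : Flt p q}
    {s' : ExtFlt p q} {t t' : Fin d → ExtFlt p q} (R : B.Run σ σ' x h 0 t s' t') (b : Flt p q) :
    (B.close b).Regular σ σ' x ∧ (B.close b).eval σ x = (fun _ => s' ⊕ₑ .fin b) ∧
      (B.close b).GradFinite σ σ' x (fun _ => .fin h) ∧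
      (B.close b).gradFrom σ σ' t x (fun _ => .fin h) = t' := by
  have h1 : ∀ j, (B.row b).grad (fun _ => .fin h) j = .fin h ⊗ₑ .fin (B.a j) := fun j => by
    rw [Affine.grad_apply, facc_one, zero_add' A]; rfl
  refine ⟨⟨R.regular, fun i => ⟨R.value i, R.deriv i⟩⟩, ?_, ⟨fun i => isFin_fin _, fun j => ?_, ?_⟩,
    ?_⟩
  · rw [eval_close, R.out]
  · rw [h1]; exact R.weight j
  · simp only [h1]; exact R.grad
  · simp only [Block.close, Tower.gradFrom, h1]; exact R.gradOut

/-- All blocks of a list side by side. -/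
def parAll (B₀ : Block p q l d) : List (Block p q l d) → Block p q l d
  | [] => B₀
  | B :: Bs => B.par (parAll B₀ Bs)

/-- A block with constant output. -/
def trivial (l d : ℕ) : Block p q l d where
  n := 1
  hn := one_pos
  T := Nat.rec (Tower.base ⟨fun _ _ => 0, fun _ => 0⟩)
    (fun _ T => .snoc T one_pos ⟨fun _ _ => 0, fun _ => 0⟩) l
  a := fun _ => 0

/-- The accumulators after running a list of blocks. -/
inductive RunList (σ σ' : ExtFlt p q → ExtFlt p q) (x : Fin d → ExtFlt p q) (h : Flt p q) :
    List (Block p q l d) → ExtFlt p q → (Fin d → ExtFlt p q) → ExtFlt p q →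
      (Fin d → ExtFlt p q) → Prop
  | nil (s t) : RunList σ σ' x h [] s t s t
  | cons {B Bs s t s₁ t₁ s₂ t₂} (R : Run σ σ' B x h s t s₁ t₁)
      (Rs : RunList σ σ' x h Bs s₁ t₁ s₂ t₂) : RunList σ σ' x h (B :: Bs) s t s₂ t₂

theorem RunList.append {x : Fin d → ExtFlt p q} {h : Flt p q} {Bs Cs : List (Block p q l d)}
    {s s₁ s₂ : ExtFlt p q} {t t₁ t₂ : Fin d → ExtFlt p q} (R₁ : RunList σ σ' x h Bs s t s₁ t₁)
    (R₂ : RunList σ σ' x h Cs s₁ t₁ s₂ t₂) : RunList σ σ' x h (Bs ++ Cs) s t s₂ t₂ := by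
  induction R₁ with
  | nil => exact R₂
  | cons R _ ih => exact .cons R (ih R₂)

theorem RunList.parAll (A : Adm p q) {B₀ : Block p q l d} {x : Fin d → ExtFlt p q} {h : Flt p q}
    {Bs : List (Block p q l d)} {s s₁ : ExtFlt p q} {t t₁ : Fin d → ExtFlt p q}
    (h₀ : ∀ s t, B₀.Run σ σ' x h s t s t) (R : RunList σ σ' x h Bs s t s₁ t₁) :
    (parAll B₀ Bs).Run σ σ' x h s t s₁ t₁ := by
  induction R with
  | nil => exact h₀ _ _
  | cons R _ ih => exact R.par A ih

theorem trivial_spec (A : Adm p q) (hσ : ∀ y : Flt p q, IsFin (σ (.fin y)))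
    (hσ' : ∀ y : Flt p q, IsFin (σ' (.fin y))) (x : Fin d → Flt p q) :
    ((trivial l d : Block p q l d).T).Regular σ σ' (fun k => .fin (x k)) ∧
      ((trivial l d : Block p q l d).T).eval σ (fun k => .fin (x k)) = fun _ => 0 := by
  have key : ∀ {m : ℕ} (z : Fin m → ExtFlt p q), (∀ i, IsFin (z i)) →
      (⟨fun _ _ => 0, fun _ => 0⟩ : Affine p q m 1).eval z = fun _ => 0 := by
    intro m z hz
    funext i
    rw [Affine.eval_apply, facc_zero A]
    · exact zero_add' A _
    · exact fun j => zero_mul_fin A (hz j)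
  induction l with
  | zero => exact ⟨True.intro, key _ fun i => isFin_fin _⟩
  | succ l ih =>
    refine ⟨⟨ih.1, fun i => ?_⟩, ?_⟩
    · have := congrFun ih.2 i
      simp only [trivial] at this
      rw [this]
      exact ⟨hσ 0, hσ' 0⟩
    · refine key _ fun i => ?_
      have := congrFun ih.2 i
      simp only [trivial] at this
      rw [this]
      exact hσ 0

/-- The neutral element of parallel composition. It terminates `parAll`, where an empty block is not
available because hidden dimensions are positive. -/
theorem trivial_run (A : Adm p q) (hσ : ∀ y : Flt p q, IsFin (σ (.fin y)))
    (hσ' : ∀ y : Flt p q, IsFin (σ' (.fin y))) (x : Fin d → Flt p q) (h : Flt p q)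
    (s : ExtFlt p q) (t : Fin d → ExtFlt p q) :
    (trivial l d).Run σ σ' (fun k => .fin (x k)) h s t s t := by
  obtain ⟨h1, h2⟩ := trivial_spec (l := l) A hσ hσ' x
  have h3 : ∀ i, (ExtFlt.fin h) ⊗ₑ .fin ((trivial l d).a i) ⊗ₑ
      σ' ((trivial l d).T.eval σ (fun k => .fin (x k)) i) = 0 := fun i => by
    rw [h2, show (ExtFlt.fin ((trivial l d).a i) : ExtFlt p q) = 0 from rfl,
      mul_zero_fin A (isFin_fin _)]
    exact zero_mul_fin A (hσ' 0)
  obtain ⟨h4, h5⟩ := Tower.gradFrom_zero A _ _ h1 _ h3 t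
  refine ⟨h1, fun i => by rw [h2]; exact hσ 0, fun i => by rw [h2]; exact hσ' 0, fun i => ?_,
    h4, facc_zero A _ _ fun i => ?_, h5⟩
  · exact ⟨0, mul_zero_fin A (isFin_fin _)⟩
  · rw [h2]; exact zero_mul_fin A (hσ 0)

end Block

end FloatNet

namespace FloatNet

/-! ### Floats as exact sums of signed powers of two -/

section Copies

variable {p q : ℕ}

theorem round_add_round (A : Adm p q) {a b : ℝ} (ha : a ∈ finiteFloats p q)
    (hb : b ∈ finiteFloats p q) : round p q a ⊕ₑ round p q b = round p q (a + b) := by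
  rw [round_of_mem A ha, round_of_mem A hb, fin_add]

/-- Every float is a sum of copies of a signed power of two, with exact partial sums. -/
theorem exists_copies (A : Adm p q) (f : Flt p q) :
    ∃ (m : ℕ) (i : ℤ) (r : ℝ), eMin q - p ≤ i ∧ i ≤ eMax q - p ∧ (r = 1 ∨ r = -1) ∧
      (f = 0 → m = 0) ∧ round p q (r * m * 2 ^ i) = .fin f ∧
      ∀ j < m, round p q (r * j * 2 ^ i) ⊕ₑ round p q (r * 2 ^ i) =
        round p q (r * (j + 1 : ℕ) * 2 ^ i) := by
  obtain ⟨n, e, hf, hn, h1, h2, -⟩ := exists_scaled A f.2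
  have key : ∀ r : ℝ, (r = 1 ∨ r = -1) → ∀ j : ℕ, j ≤ n.natAbs →
      r * j * 2 ^ (e - p) ∈ finiteFloats p q := by
    intro r hr j hj
    have hj' : j < 2 ^ (p + 1) := by zify at hj ⊢; omega
    have h3 := nat_mul_mem (p := p) (q := q) hj' h1 h2
    rcases hr with rfl | rfl
    · rwa [one_mul]
    · rw [neg_one_mul, neg_mul]; exact neg_mem h3
  have main : ∀ r : ℝ, (r = 1 ∨ r = -1) → (n : ℝ) = r * n.natAbs →
      ∃ (m : ℕ) (i : ℤ) (r : ℝ), eMin q - p ≤ i ∧ i ≤ eMax q - p ∧ (r = 1 ∨ r = -1) ∧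
      (f = 0 → m = 0) ∧ round p q (r * m * 2 ^ i) = .fin f ∧
      ∀ j < m, round p q (r * j * 2 ^ i) ⊕ₑ round p q (r * 2 ^ i) =
        round p q (r * (j + 1 : ℕ) * 2 ^ i) := by
    intro r hr hnr
    refine ⟨n.natAbs, e - p, r, by omega, by omega, hr, ?_, ?_, ?_⟩
    · intro h0
      rw [h0, coe_zero] at hf
      rcases mul_eq_zero.1 hf.symm with h | h
      · simpa using h
      · exact absurd h (by positivity)
    · rw [← hnr, ← hf, round_coe A]
    · intro j hj
      have h4 := key r hr 1 (by omega)
      rw [Nat.cast_one, mul_one] at h4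
      rw [round_add_round A (key r hr j hj.le) h4]
      congr 1
      push_cast
      ring
  rcases le_total 0 n with h | h
  · refine main 1 (Or.inl rfl) ?_
    have : (n.natAbs : ℤ) = n := Int.natAbs_of_nonneg h
    have h5 : ((n.natAbs : ℤ) : ℝ) = n := by rw [this]
    rw [Int.cast_natCast] at h5
    rw [h5, one_mul]
  · refine main (-1) (Or.inr rfl) ?_
    have : (n.natAbs : ℤ) = -n := Int.ofNat_natAbs_of_nonpos h
    have h5 : ((n.natAbs : ℤ) : ℝ) = -n := by rw [this]; push_cast; rfl
    rw [Int.cast_natCast] at h5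
    rw [h5]; ring

end Copies

/-! ### Assembling the network from value units and gradient units -/

section Assemble

variable {p q d l : ℕ} {σ σ' : ExtFlt p q → ExtFlt p q}

theorem Block.RunList.replicate {x : Fin d → ExtFlt p q} {h : Flt p q} {B : Block p q l d}
    (m : ℕ) (S : ℕ → ExtFlt p q) (t : ℕ → Fin d → ExtFlt p q)
    (R : ∀ j < m, B.Run σ σ' x h (S j) (t j) (S (j + 1)) (t (j + 1))) :
    Block.RunList σ σ' x h (List.replicate m B) (S 0) (t 0) (S m) (t m) := by
  induction m generalizing S t with
  | zero => exact .nil _ _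
  | succ m ih =>
    exact .cons (R 0 (by omega)) (ih (fun j => S (j + 1)) (fun j => t (j + 1))
      fun j hj => R (j + 1) (by omega))

variable {dom : (Fin d → Flt p q) → Prop}

/-- The input vector, as a vector of floats. -/
def inp (x : {x : Fin d → Flt p q // dom x}) : Fin d → ExtFlt p q := fun k => .fin (x.1 k)

open Classical in
/-- A block that adds `v` to the output at the input `u` only, without contributing to the
gradient. -/
def IsValueUnit (σ σ' : ExtFlt p q → ExtFlt p q) (hs : {x : Fin d → Flt p q // dom x} → Flt p q)
    (B : Block p q l d) (u : {x : Fin d → Flt p q // dom x}) (v : ℝ) : Prop :=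
  ∀ x s t, B.Run σ σ' (inp x) (hs x) s t (if x = u then s ⊕ₑ round p q v else s) t

open Classical in
/-- A block that adds `v` to coordinate `k` of the gradient at the input `u` only, and whose
output vanishes. -/
def IsGradUnit (σ σ' : ExtFlt p q → ExtFlt p q) (hs : {x : Fin d → Flt p q // dom x} → Flt p q)
    (B : Block p q l d) (u : {x : Fin d → Flt p q // dom x}) (k : Fin d) (v : ℝ) : Prop :=
  ∀ x t, B.Run σ σ' (inp x) (hs x) 0 t 0
    (if x = u then Function.update t k (t k ⊕ₑ round p q v) else t)

variable {hs : {x : Fin d → Flt p q // dom x} → Flt p q}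

/-- Units of other inputs leave the accumulator alone, so at `x` the copies for `f x` start at 0,
where their partial sums are exact. The second clause, for arbitrary `s`, protects the finished
value from the units of the remaining inputs. -/
theorem exists_value_list (A : Adm p q)
    (hv : ∀ (u : {x : Fin d → Flt p q // dom x}) (i : ℤ) (r : ℝ), eMin q - p ≤ i →
      i ≤ eMax q - p → (r = 1 ∨ r = -1) →
      ∃ B : Block p q l d, IsValueUnit σ σ' hs B u (r * 2 ^ i))
    (f : {x : Fin d → Flt p q // dom x} → Flt p q)
    (us : List {x : Fin d → Flt p q // dom x}) (hus : us.Nodup) :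
    ∃ Bs : List (Block p q l d), ∀ x t,
      (x ∈ us → Block.RunList σ σ' (inp x) (hs x) Bs 0 t (.fin (f x)) t) ∧
      (x ∉ us → ∀ s, Block.RunList σ σ' (inp x) (hs x) Bs s t s t) := by
  induction us with
  | nil => exact ⟨[], fun x t => ⟨fun h => by simp at h, fun _ s => .nil _ _⟩⟩
  | cons u us ih =>
    obtain ⟨Bs, hBs⟩ := ih (List.nodup_cons.1 hus).2
    obtain ⟨m, i, r, h1, h2, hr, -, h4, h5⟩ := exists_copies A (f u)
    obtain ⟨B, hB⟩ := hv u i r h1 h2 hr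
    refine ⟨List.replicate m B ++ Bs, fun x t => ⟨fun hx => ?_, fun hx s => ?_⟩⟩
    · by_cases hxu : x = u
      · subst hxu
        have h6 := Block.RunList.replicate m (fun j => round p q (r * j * 2 ^ i)) (fun _ => t)
          (B := B) (σ := σ) (σ' := σ') (x := inp x) (h := hs x) (fun j hj => by
            have := hB x (round p q (r * j * 2 ^ i)) t
            rw [if_pos rfl, h5 j hj] at this
            exact this)
        rw [h4, Nat.cast_zero, mul_zero, zero_mul, round_zero A] at h6
        exact h6.append ((hBs x t).2 (List.nodup_cons.1 hus).1 _)
      · have h6 := Block.RunList.replicate m (fun _ => 0) (fun _ => t)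
          (B := B) (σ := σ) (σ' := σ') (x := inp x) (h := hs x) (fun j hj => by
            have := hB x 0 t
            rwa [if_neg hxu] at this)
        exact h6.append ((hBs x t).1 ((List.mem_cons.1 hx).resolve_left hxu))
    · rw [List.mem_cons, not_or] at hx
      have h6 := Block.RunList.replicate m (fun _ => s) (fun _ => t)
          (B := B) (σ := σ) (σ' := σ') (x := inp x) (h := hs x) (fun j hj => by
            have := hB x s t
            rwa [if_neg hx.1] at this)
      exact h6.append ((hBs x t).2 hx.2 s)

theorem exists_grad_list_coord (A : Adm p q) (u : {x : Fin d → Flt p q // dom x})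
    (hv : hs u ≠ 0 → ∀ (k : Fin d) (i : ℤ) (r : ℝ), eMin q - p ≤ i → i ≤ eMax q - p →
      (r = 1 ∨ r = -1) → ∃ B : Block p q l d, IsGradUnit σ σ' hs B u k (r * 2 ^ i))
    (g : Fin d → Flt p q) (hg : hs u = 0 → g = 0) (k : Fin d) :
    ∃ Bs : List (Block p q l d), ∀ x t,
      (x = u → t k = 0 →
        Block.RunList σ σ' (inp x) (hs x) Bs 0 t 0 (Function.update t k (.fin (g k)))) ∧
      (x ≠ u → Block.RunList σ σ' (inp x) (hs x) Bs 0 t 0 t) := by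
  obtain ⟨m, i, r, h1, h2, hr, h3, h4, h5⟩ := exists_copies A (g k)
  -- Here it is used that g* vanishes where h* does: a zero input gradient cannot produce anything,
  -- but then no copies are needed and any block may stand in.
  have hB : ∃ B : Block p q l d, 0 < m → IsGradUnit σ σ' hs B u k (r * 2 ^ i) := by
    by_cases h0 : hs u = 0
    · exact ⟨Block.trivial l d, fun hm => absurd (h3 (by rw [hg h0]; rfl)) hm.ne'⟩
    · obtain ⟨B, hB⟩ := hv h0 k i r h1 h2 hr
      exact ⟨B, fun _ => hB⟩
  obtain ⟨B, hB⟩ := hB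
  refine ⟨List.replicate m B, fun x t => ⟨fun hxu ht => ?_, fun hxu => ?_⟩⟩
  · have h6 := Block.RunList.replicate m (fun _ => 0)
      (fun j => Function.update t k (round p q (r * j * 2 ^ i)))
      (B := B) (σ := σ) (σ' := σ') (x := inp x) (h := hs x) (fun j hj => by
        have := hB (by omega) x (Function.update t k (round p q (r * j * 2 ^ i)))
        rw [if_pos hxu, Function.update_self, h5 j hj, Function.update_idem] at this
        exact this)
    beta_reduce at h6
    rwa [h4, Nat.cast_zero, mul_zero, zero_mul, round_zero A, ← ht, Function.update_eq_self, ht] at h6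
  · exact Block.RunList.replicate m (fun _ => 0) (fun _ => t) (fun j hj => by
        have := hB (by omega) x t
        rwa [if_neg hxu] at this)

theorem exists_grad_list_point (A : Adm p q) (u : {x : Fin d → Flt p q // dom x})
    (hv : hs u ≠ 0 → ∀ (k : Fin d) (i : ℤ) (r : ℝ), eMin q - p ≤ i → i ≤ eMax q - p →
      (r = 1 ∨ r = -1) → ∃ B : Block p q l d, IsGradUnit σ σ' hs B u k (r * 2 ^ i))
    (g : Fin d → Flt p q) (hg : hs u = 0 → g = 0) (ks : List (Fin d)) (hks : ks.Nodup) :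
    ∃ Bs : List (Block p q l d), ∀ x t,
      (x = u → (∀ k ∈ ks, t k = 0) → Block.RunList σ σ' (inp x) (hs x) Bs 0 t 0
        (fun k => if k ∈ ks then .fin (g k) else t k)) ∧
      (x ≠ u → Block.RunList σ σ' (inp x) (hs x) Bs 0 t 0 t) := by
  induction ks with
  | nil => exact ⟨[], fun x t => ⟨fun _ _ => by simpa using Block.RunList.nil _ _,
      fun _ => .nil _ _⟩⟩
  | cons k ks ih =>
    obtain ⟨hk, hks⟩ := List.nodup_cons.1 hks
    obtain ⟨Bs, hBs⟩ := ih hks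
    obtain ⟨Cs, hCs⟩ := exists_grad_list_coord A u hv g hg k
    refine ⟨Cs ++ Bs, fun x t => ⟨fun hxu ht => ?_, fun hxu => ?_⟩⟩
    · have h1 := (hCs x t).1 hxu (ht k (by simp))
      have h2 := (hBs x (Function.update t k (.fin (g k)))).1 hxu (fun k' hk' => by
        rw [Function.update_of_ne (fun h => hk (by rwa [h] at hk'))]
        exact ht k' (List.mem_cons_of_mem _ hk'))
      convert h1.append h2 using 1
      funext k'
      by_cases h3 : k' = k
      · subst h3; simp [hk]
      · simp [h3]
    · exact ((hCs x t).2 hxu).append ((hBs x t).2 hxu)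

theorem exists_grad_list (A : Adm p q)
    (hv : ∀ (u : {x : Fin d → Flt p q // dom x}), hs u ≠ 0 → ∀ (k : Fin d) (i : ℤ) (r : ℝ),
      eMin q - p ≤ i → i ≤ eMax q - p →
      (r = 1 ∨ r = -1) → ∃ B : Block p q l d, IsGradUnit σ σ' hs B u k (r * 2 ^ i))
    (g : {x : Fin d → Flt p q // dom x} → Fin d → Flt p q) (hg : ∀ u, hs u = 0 → g u = 0)
    (us : List {x : Fin d → Flt p q // dom x}) (hus : us.Nodup) :
    ∃ Bs : List (Block p q l d), ∀ x,
      (x ∈ us → Block.RunList σ σ' (inp x) (hs x) Bs 0 0 0 (fun k => .fin (g x k))) ∧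
      (x ∉ us → ∀ t, Block.RunList σ σ' (inp x) (hs x) Bs 0 t 0 t) := by
  induction us with
  | nil => exact ⟨[], fun x => ⟨fun h => by simp at h, fun _ t => .nil _ _⟩⟩
  | cons u us ih =>
    obtain ⟨Bs, hBs⟩ := ih (List.nodup_cons.1 hus).2
    obtain ⟨Cs, hCs⟩ := exists_grad_list_point A u (hv u) (g u) (hg u) (List.finRange d)
      (List.nodup_finRange d)
    refine ⟨Cs ++ Bs, fun x => ⟨fun hx => ?_, fun hx t => ?_⟩⟩
    · by_cases hxu : x = u
      · subst hxu
        have h1 := (hCs x 0).1 rfl (fun _ _ => rfl)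
        simp only [List.mem_finRange, if_true] at h1
        exact h1.append ((hBs x).2 (List.nodup_cons.1 hus).1 _)
      · exact ((hCs x 0).2 hxu).append ((hBs x).1 ((List.mem_cons.1 hx).resolve_left hxu))
    · rw [List.mem_cons, not_or] at hx
      exact ((hCs x t).2 hx.1).append ((hBs x).2 hx.2 t)

/-- Networks from value units and gradient units. -/
theorem exists_network (A : Adm p q) (hσ : ∀ y : Flt p q, IsFin (σ (.fin y)))
    (hσ' : ∀ y : Flt p q, IsFin (σ' (.fin y)))
    (hval : ∀ (u : {x : Fin d → Flt p q // dom x}) (i : ℤ) (r : ℝ), eMin q - p ≤ i →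
      i ≤ eMax q - p → (r = 1 ∨ r = -1) →
      ∃ B : Block p q l d, IsValueUnit σ σ' hs B u (r * 2 ^ i))
    (hgrad : ∀ (u : {x : Fin d → Flt p q // dom x}), hs u ≠ 0 → ∀ (k : Fin d) (i : ℤ) (r : ℝ),
      eMin q - p ≤ i → i ≤ eMax q - p →
      (r = 1 ∨ r = -1) → ∃ B : Block p q l d, IsGradUnit σ σ' hs B u k (r * 2 ^ i))
    (f : {x : Fin d → Flt p q // dom x} → Flt p q)
    (g : {x : Fin d → Flt p q // dom x} → Fin d → Flt p q) (hg : ∀ u, hs u = 0 → g u = 0) :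
    ∃ N : Network p q (l + 1 + 1) d 1, ∀ x : {x : Fin d → Flt p q // dom x},
      N.eval σ (inp x) = (fun _ => .fin (f x)) ∧
      N.grad σ σ' (inp x) (fun _ => .fin (hs x)) = fun k => .fin (g x k) := by
  classical
  have : Finite (Flt p q) := (finite_finiteFloats p q).to_subtype
  have : Fintype {x : Fin d → Flt p q // dom x} := Fintype.ofFinite _
  obtain ⟨Bs, hBs⟩ := exists_value_list A hval f Finset.univ.toList (Finset.nodup_toList _)
  obtain ⟨Cs, hCs⟩ := exists_grad_list A hgrad g hg Finset.univ.toList (Finset.nodup_toList _)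
  refine ⟨((Block.parAll (Block.trivial l d) (Cs ++ Bs)).close 0).toNetwork, fun x => ?_⟩
  -- The gradient units come first: their two outputs cancel exactly only on top of the accumulator
  -- 0. Value units tolerate any gradient accumulator.
  have h1 := ((hCs x).1 (by simp)).append ((hBs x (fun k => .fin (g x k))).1 (by simp))
  have h2 : Block.Run _ _ _ (inp x) _ _ _ _ _ := h1.parAll A (Block.trivial_run A hσ hσ' x.1 (hs x))
  obtain ⟨h3, h4, h5, h6⟩ := h2.close A 0
  refine ⟨?_, ?_⟩
  · rw [Tower.eval_toNetwork, h4]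
    funext i
    exact add_zero' A _
  · rw [Tower.grad_toNetwork A _ _ _ h5]
    exact h6

end Assemble

end FloatNet

namespace FloatNet

/-- Beyond this bound, the activation functions are saturated. -/
noncomputable def satur (q : ℕ) : ℝ := (2 : ℝ) ^ ((q : ℤ) + 1)

/-- The pre-activation that stands for a set bit. -/
noncomputable def hiVal (q : ℕ) : ℝ := (2 : ℝ) ^ (eMax q - 1)

/-- `y` lies in the lower saturation region. -/
def Low {p q : ℕ} (y : ExtFlt p q) : Prop := Le y (-satur q)

theorem two_mul_hiVal (q : ℕ) : 2 * hiVal q = 2 ^ eMax q := by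
  unfold hiVal
  rw [← zpow_one_add₀ (by norm_num)]
  congr 1; ring

/-! ### Thresholds of saturation -/

section Constants

variable {p q : ℕ} (A : Adm p q)

include A

theorem satur_mem : satur q ∈ finiteFloats p q := by
  have := A.expRange_ge
  exact two_zpow_mem A (by rw [eMin_eq]; omega) (by rw [eMax_eq]; omega)

theorem hiVal_mem : hiVal q ∈ finiteFloats p q := by
  have := A.expRange_ge
  exact two_zpow_mem A (by rw [eMin_eq, eMax_eq]; omega) (by omega)

theorem two_eMax_mem : (2 : ℝ) ^ eMax q ∈ finiteFloats p q := by
  have := A.expRange_ge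
  exact two_zpow_mem A (by rw [eMin_eq, eMax_eq]; omega) le_rfl

theorem satur_le_hiVal : 16 * satur q ≤ hiVal q := by
  have := A.expRange_ge
  unfold satur hiVal
  rw [show (16 : ℝ) = 2 ^ (4 : ℤ) by norm_num, ← zpow_add₀ (by norm_num)]
  exact zpow_le_zpow_right₀ (by norm_num) (by rw [eMax_eq]; omega)

theorem satur_ge : (128 : ℝ) ≤ satur q := by
  have := A.hq
  unfold satur
  rw [show (128 : ℝ) = 2 ^ (7 : ℤ) by norm_num]
  exact zpow_le_zpow_right₀ (by norm_num) (by omega)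

end Constants

/-! ### Single neurons and towers that stop the gradient -/

section Scalar

variable {p q d l : ℕ} {σ σ' : ExtFlt p q → ExtFlt p q}

/-- A tower with one output whose gradient does not reach the input. -/
structure Tower.Dead (σ σ' : ExtFlt p q → ExtFlt p q) (T : Tower p q l d 1)
    (x : Fin d → ExtFlt p q) (g y : ExtFlt p q) : Prop where
  regular : T.Regular σ σ' x
  eval : T.eval σ x = fun _ => y
  grad : T.GradFinite σ σ' x fun _ => g
  out : ∀ t, T.gradFrom σ σ' t x (fun _ => g) = t

/-- Adds a layer with one neuron. -/
def Tower.scal (T : Tower p q l d 1) (w b : Flt p q) : Tower p q (l + 1) d 1 :=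
  .snoc T one_pos ⟨fun _ _ => w, fun _ => b⟩

/-- A block with one output. -/
def Block.single (T : Tower p q l d 1) (w : Flt p q) : Block p q l d := ⟨1, one_pos, T, fun _ => w⟩

theorem Tower.Dead.of_regular (A : Adm p q) {T : Tower p q l d 1} {x : Fin d → ExtFlt p q}
    {y : ExtFlt p q} (h : T.Regular σ σ' x) (hy : T.eval σ x = fun _ => y) :
    T.Dead σ σ' x 0 y :=
  ⟨h, hy, (T.gradFrom_zero A x h _ (fun _ => rfl) 0).1,
    fun t => (T.gradFrom_zero A x h _ (fun _ => rfl) t).2⟩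

theorem Tower.eval_scal (A : Adm p q) {T : Tower p q l d 1} {x : Fin d → ExtFlt p q}
    {y : ExtFlt p q} (hy : T.eval σ x = fun _ => y) (w b : Flt p q) :
    (T.scal w b).eval σ x = fun _ => .fin w ⊗ₑ σ y ⊕ₑ .fin b := by
  funext i
  simp only [scal, Tower.eval]
  rw [Affine.eval_apply, facc_one, zero_add' A, hy]

theorem Tower.regular_scal {T : Tower p q l d 1} {x : Fin d → ExtFlt p q}
    {y : ExtFlt p q} (h : T.Regular σ σ' x) (hy : T.eval σ x = fun _ => y) (h1 : IsFin (σ y))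
    (h2 : IsFin (σ' y)) (w b : Flt p q) : (T.scal w b).Regular σ σ' x :=
  ⟨h, fun i => by rw [hy]; exact ⟨h1, h2⟩⟩

/-- Deadness is inherited from the gradient that actually arrives one layer below, namely `g` times
the weight times the derivative there. It suffices that this product dies further down. -/
theorem Tower.Dead.scal (A : Adm p q) {T : Tower p q l d 1} {x : Fin d → ExtFlt p q}
    {g y : ExtFlt p q} {w : Flt p q} (h : T.Dead σ σ' x (g ⊗ₑ .fin w ⊗ₑ σ' y) y) (hg : IsFin g)
    (hgw : IsFin (g ⊗ₑ .fin w)) (h1 : IsFin (σ y)) (h2 : IsFin (σ' y)) (b : Flt p q) :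
    (T.scal w b).Dead σ σ' x g (.fin w ⊗ₑ σ y ⊕ₑ .fin b) := by
  have h3 : ∀ j, (⟨fun _ _ => w, fun _ => b⟩ : Affine p q 1 1).grad (fun _ => g) j =
      g ⊗ₑ .fin w := fun j => by
    rw [Affine.grad_apply, facc_one, zero_add' A]
  refine ⟨Tower.regular_scal h.regular h.eval h1 h2 w b, Tower.eval_scal A h.eval w b,
    ⟨fun _ => hg, fun j => by rw [h3]; exact hgw, ?_⟩, fun t => ?_⟩
  · simp only [h3, h.eval]; exact h.grad
  · simp only [Tower.scal, Tower.gradFrom, h3, h.eval]; exact h.out t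

theorem Tower.Dead.run {T : Tower p q l d 1} {x : Fin d → ExtFlt p q}
    {y : ExtFlt p q} {h w : Flt p q} (hT : T.Dead σ σ' x (.fin h ⊗ₑ .fin w ⊗ₑ σ' y) y)
    (hw : IsFin (.fin h ⊗ₑ .fin w)) (h1 : IsFin (σ y)) (h2 : IsFin (σ' y)) (s : ExtFlt p q)
    (t : Fin d → ExtFlt p q) :
    (Block.single T w).Run σ σ' x h s t (s ⊕ₑ (.fin w ⊗ₑ σ y)) t := by
  refine ⟨hT.regular, fun i => ?_, fun i => ?_, fun i => hw, ?_, ?_, ?_⟩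
  · simp only [Block.single, hT.eval]; exact h1
  · simp only [Block.single, hT.eval]; exact h2
  · simp only [Block.single, hT.eval]; exact hT.grad
  · simp only [Block.single, hT.eval]; rfl
  · simp only [Block.single, hT.eval]; exact hT.out t

theorem Block.Run.closeDead (A : Adm p q) {B : Block p q l d} {x : Fin d → ExtFlt p q}
    {h : Flt p q} {s : ExtFlt p q} (R : ∀ t, B.Run σ σ' x h 0 t s t) (b : Flt p q) :
    (B.close b).Dead σ σ' x (.fin h) (s ⊕ₑ .fin b) := by
  obtain ⟨h1, h2, h3, -⟩ := (R 0).close A b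
  exact ⟨h1, h2, h3, fun t => ((R t).close A b).2.2.2⟩

end Scalar

/-- The properties of the rounded activation function that allow to compute with bits: a clear bit
has a pre-activation in the lower saturation region and the value `c`, and a set bit has
pre-activation `hiVal q` and value `Z`. -/
structure Core {p q : ℕ} (σ σ' : ExtFlt p q → ExtFlt p q) (c Z : Flt p q) : Prop where
  low : ∀ y, Low y → σ y = .fin c ∧ σ' y = 0
  high : σ (round p q (hiVal q)) = .fin Z
  val : ∀ y : Flt p q, IsFin (σ (.fin y))
  der : ∀ y : Flt p q, IsFin (σ' (.fin y))
  copy : ∃ w b : Flt p q, .fin w ⊗ₑ .fin Z ⊕ₑ .fin b = round p q (hiVal q) ∧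
    Low (.fin w ⊗ₑ .fin c ⊕ₑ .fin b)
  flip : ∃ w b : Flt p q, Low (.fin w ⊗ₑ .fin Z ⊕ₑ .fin b) ∧
    .fin w ⊗ₑ .fin c ⊕ₑ .fin b = round p q (hiVal q)

/-! ### Detectors and indicator neurons -/

section Indicators

variable {p q d l : ℕ} {σ σ' : ExtFlt p q → ExtFlt p q} {c Z : Flt p q}
  {dom : (Fin d → Flt p q) → Prop}

/-- There are towers that compare coordinates with given numbers. -/
def HasDetectors (σ σ' : ExtFlt p q → ExtFlt p q) (dom : (Fin d → Flt p q) → Prop) (l : ℕ) : Prop :=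
  ∀ (u : {x : Fin d → Flt p q // dom x}) (k : Fin d) (r : ℝ), (r = 1 ∨ r = -1) →
    ∃ T : Tower p q l d 1, ∀ x : {x : Fin d → Flt p q // dom x}, T.Regular σ σ' (inp x) ∧
      ∃ (y : ExtFlt p q) (v : Flt p q), T.eval σ (inp x) = (fun _ => y) ∧ σ y = .fin v ∧
        IsFin (σ' y) ∧ (0 < r * (x.1 k - u.1 k) → 1 ≤ (v : ℝ)) ∧
        (r * (x.1 k - u.1 k) ≤ 0 → v = 0)

/-- The output is low at `u` and high elsewhere. -/
def IsIndicator (σ σ' : ExtFlt p q → ExtFlt p q) (T : Tower p q l d 1)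
    (u : {x : Fin d → Flt p q // dom x}) : Prop :=
  ∀ x : {x : Fin d → Flt p q // dom x}, T.Regular σ σ' (inp x) ∧
    (x = u → ∃ y, Low y ∧ T.eval σ (inp x) = fun _ => y) ∧
    (x ≠ u → T.eval σ (inp x) = fun _ => round p q (hiVal q))

/-- A detector that fires has value at least 1 and subtracts at least 2^eMax; a silent one subtracts
exactly 0. The sum may drop to -∞ but, since all addends are nonpositive, it never recovers. Only
forward values matter here, so the run is made with input gradient 0. -/
theorem exists_mismatch_list (A : Adm p q) (hd : HasDetectors σ σ' dom l)
    (u : {x : Fin d → Flt p q // dom x}) (ls : List (Fin d × ℝ))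
    (hls : ∀ i ∈ ls, i.2 = 1 ∨ i.2 = -1) :
    ∃ Bs : List (Block p q l d), ∀ (x : {x : Fin d → Flt p q // dom x}) (s : ExtFlt p q), Le s 0 →
      ∃ s', (∀ t, Block.RunList σ σ' (inp x) 0 Bs s t s' t) ∧ Le s' 0 ∧
        ((Le s (-2 ^ eMax q) ∨ ∃ i ∈ ls, 0 < i.2 * (x.1 i.1 - u.1 i.1)) → Le s' (-2 ^ eMax q)) ∧
        ((∀ i ∈ ls, i.2 * (x.1 i.1 - u.1 i.1) ≤ 0) → s' = s) := by
  induction ls with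
  | nil =>
    refine ⟨[], fun x s hs => ⟨s, fun t => .nil _ _, hs, fun h => ?_, fun _ => rfl⟩⟩
    simpa using h
  | cons i ls ih =>
    obtain ⟨Bs, hBs⟩ := ih fun j hj => hls j (List.mem_cons_of_mem _ hj)
    obtain ⟨T, hT⟩ := hd u i.1 i.2 (hls i (by simp))
    set w : Flt p q := ⟨-2 ^ eMax q, neg_mem (two_eMax_mem A)⟩ with hw
    refine ⟨Block.single T w :: Bs, fun x s hs => ?_⟩
    obtain ⟨h1, y, v, h2, h3, h4, h5, h6⟩ := hT x
    have hrun : ∀ t, (Block.single T w).Run σ σ' (inp x) 0 s t (s ⊕ₑ (.fin w ⊗ₑ σ y)) t := by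
      have h7 : (ExtFlt.fin 0) ⊗ₑ .fin w = (0 : ExtFlt p q) := zero_mul_fin A (isFin_fin _)
      have h8 : (ExtFlt.fin 0) ⊗ₑ .fin w ⊗ₑ σ' y = 0 := by rw [h7, zero_mul_fin A h4]
      have hD := Tower.Dead.of_regular A h1 h2
      rw [← h8] at hD
      exact fun t => hD.run ⟨_, h7⟩ ⟨_, h3⟩ h4 s t
    have hlow : 0 < i.2 * (x.1 i.1 - u.1 i.1) → Le (s ⊕ₑ (.fin w ⊗ₑ σ y)) (-2 ^ eMax q) := by
      intro hi
      refine hs.add A (s := -2 ^ eMax q) ?_ (neg_mem (two_eMax_mem A)) (by linarith)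
      rw [h3, fin_mul]
      refine round_le A (neg_mem (two_eMax_mem A)) ?_
      have h9 := h5 hi
      have h10 : (0 : ℝ) < 2 ^ eMax q := by positivity
      rw [hw]
      nlinarith
    have hsame : i.2 * (x.1 i.1 - u.1 i.1) ≤ 0 → s ⊕ₑ (.fin w ⊗ₑ σ y) = s := by
      intro hi
      rw [h3, h6 hi, show (ExtFlt.fin 0 : ExtFlt p q) = 0 from rfl, mul_zero_fin A (isFin_fin _),
        add_zero' A]
    have hs0 : Le (s ⊕ₑ (.fin w ⊗ₑ σ y)) 0 := by
      rcases le_or_gt (i.2 * (x.1 i.1 - u.1 i.1 : ℝ)) 0 with h | h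
      · rw [hsame h]; exact hs
      · exact (hlow h).mono (by simp only [Left.neg_nonpos_iff]; positivity)
    obtain ⟨s', h7, h8, h9, h10⟩ := hBs x _ hs0
    refine ⟨s', fun t => .cons (hrun t) (h7 t), h8, fun h => h9 ?_, fun h => ?_⟩
    · rcases le_or_gt (i.2 * (x.1 i.1 - u.1 i.1 : ℝ)) 0 with hi | hi
      · rw [hsame hi]
        rcases h with h | ⟨j, hj, h⟩
        · exact Or.inl h
        · rcases List.mem_cons.1 hj with rfl | hj
          · linarith
          · exact Or.inr ⟨j, hj, h⟩
      · exact Or.inl (hlow hi)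
    · rw [h10 fun j hj => h j (List.mem_cons_of_mem _ hj), hsame (h i (by simp))]

/-- For each coordinate one detector watches x_k > u_k and one x_k < u_k. Their sum is 0 at `u` and
at most -2^eMax = -2 `hiVal q` elsewhere, so the bias `hiVal q` separates the cases widely. -/
theorem exists_coindicator (A : Adm p q) (C : Core σ σ' c Z) (hd : HasDetectors σ σ' dom l)
    (u : {x : Fin d → Flt p q // dom x}) :
    ∃ T : Tower p q (l + 1) d 1, ∀ x : {x : Fin d → Flt p q // dom x}, T.Regular σ σ' (inp x) ∧
      (x = u → T.eval σ (inp x) = fun _ => round p q (hiVal q)) ∧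
      (x ≠ u → ∃ y, Low y ∧ T.eval σ (inp x) = fun _ => y) := by
  obtain ⟨Bs, hBs⟩ := exists_mismatch_list A hd u
    ((List.finRange d).flatMap fun k => [(k, 1), (k, -1)]) (fun i hi => by
      simp only [List.mem_flatMap, List.mem_cons, List.not_mem_nil, or_false] at hi
      obtain ⟨k, -, rfl | rfl⟩ := hi
      · exact Or.inl rfl
      · exact Or.inr rfl)
  refine ⟨(Block.parAll (Block.trivial l d) Bs).close ⟨hiVal q, hiVal_mem A⟩, fun x => ?_⟩
  obtain ⟨s', h1, -, h2, h3⟩ := hBs x 0 (Or.inr ⟨0, rfl, le_rfl⟩)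
  have h4 : ∀ t, (Block.parAll (Block.trivial l d) Bs).Run σ σ' (inp x) 0 0 t s' t := fun t =>
    (h1 t).parAll A (Block.trivial_run A C.val C.der x.1 0)
  have h5 := Block.Run.closeDead A h4 ⟨hiVal q, hiVal_mem A⟩
  refine ⟨h5.regular, fun hx => ?_, fun hx => ?_⟩
  · rw [h5.eval, h3, zero_add' A, round_of_mem A (hiVal_mem A)]
    intro i _
    rw [hx, sub_self, mul_zero]
  · refine ⟨_, ?_, h5.eval⟩
    have hne : ∃ k, x.1 k ≠ u.1 k := by
      by_contra! h
      exact hx (Subtype.ext (funext h))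
    obtain ⟨k, hk⟩ := hne
    have hk' : (x.1 k : ℝ) - u.1 k ≠ 0 := fun h => hk (Subtype.ext (by linarith))
    have h6 : Le s' (-2 ^ eMax q) := by
      refine h2 (Or.inr ?_)
      rcases lt_or_gt_of_ne hk' with h | h
      · exact ⟨(k, -1), by simp, by simp only; linarith⟩
      · exact ⟨(k, 1), by simp, by simp only; linarith⟩
    refine h6.add A (Or.inr ⟨_, rfl, le_rfl⟩) (neg_mem (satur_mem A)) ?_
    have := satur_le_hiVal A
    have := two_mul_hiVal q
    have := satur_ge A
    simp only
    linarith

/-- One `flip` layer negates the coindicator, and `copy` layers then pad the tower to any larger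
depth, so that it can run beside a path of prescribed length. -/
theorem exists_indicator (A : Adm p q) (C : Core σ σ' c Z) (hd : HasDetectors σ σ' dom l)
    (u : {x : Fin d → Flt p q // dom x}) (m : ℕ) (hm : l + 2 ≤ m) :
    ∃ T : Tower p q m d 1, IsIndicator σ σ' T u := by
  obtain ⟨k, rfl⟩ := Nat.exists_eq_add_of_le hm
  clear hm
  have hfin : IsFin (σ (round p q (hiVal q))) ∧ IsFin (σ' (round p q (hiVal q))) := by
    rw [round_of_mem A (hiVal_mem A)]
    exact ⟨C.val _, C.der _⟩
  have hlow : ∀ y, Low y → IsFin (σ y) ∧ IsFin (σ' y) := fun y hy => by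
    rw [(C.low y hy).1, (C.low y hy).2]
    exact ⟨isFin_fin _, isFin_zero⟩
  induction k with
  | zero =>
    obtain ⟨T, hT⟩ := exists_coindicator A C hd u
    obtain ⟨w, b, h1, h2⟩ := C.flip
    refine ⟨T.scal w b, fun x => ?_⟩
    obtain ⟨h3, h4, h5⟩ := hT x
    by_cases hx : x = u
    · refine ⟨Tower.regular_scal h3 (h4 hx) hfin.1 hfin.2 w b, fun _ => ⟨_, ?_,
        Tower.eval_scal A (h4 hx) w b⟩, fun h => absurd hx h⟩
      rwa [C.high]
    · obtain ⟨y, hy, h6⟩ := h5 hx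
      refine ⟨Tower.regular_scal h3 h6 (hlow y hy).1 (hlow y hy).2 w b, fun h => absurd h hx,
        fun _ => ?_⟩
      rw [Tower.eval_scal A h6, (C.low y hy).1, h2]
  | succ k ih =>
    obtain ⟨T, hT⟩ := ih
    obtain ⟨w, b, h1, h2⟩ := C.copy
    refine ⟨T.scal w b, fun x => ?_⟩
    obtain ⟨h3, h4, h5⟩ := hT x
    by_cases hx : x = u
    · obtain ⟨y, hy, h6⟩ := h4 hx
      refine ⟨Tower.regular_scal h3 h6 (hlow y hy).1 (hlow y hy).2 w b, fun _ => ⟨_, ?_,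
        Tower.eval_scal A h6 w b⟩, fun h => absurd hx h⟩
      rwa [(C.low y hy).1]
    · refine ⟨Tower.regular_scal h3 (h5 hx) hfin.1 hfin.2 w b, fun h => absurd h hx,
        fun _ => ?_⟩
      rw [Tower.eval_scal A (h5 hx), C.high, h1]

/-- At `u` the indicator blocks every finite gradient, elsewhere it lets the zero gradient
pass. -/
theorem IsIndicator.dead (A : Adm p q) (C : Core σ σ' c Z) {T : Tower p q l d 1}
    {u : {x : Fin d → Flt p q // dom x}} (hT : IsIndicator σ σ' T u)
    (x : {x : Fin d → Flt p q // dom x}) {g : ExtFlt p q} (hg : IsFin g) (hx : x ≠ u → g = 0) :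
    ∃ y, T.Dead σ σ' (inp x) (g ⊗ₑ σ' y) y ∧ IsFin (σ' y) ∧
      (x = u → σ y = .fin c) ∧ (x ≠ u → σ y = .fin Z) := by
  obtain ⟨h1, h2, h3⟩ := hT x
  by_cases h : x = u
  · obtain ⟨y, hy, h4⟩ := h2 h
    have h5 : g ⊗ₑ σ' y = 0 := by rw [(C.low y hy).2, mul_zero_fin A hg]
    refine ⟨y, by rw [h5]; exact Tower.Dead.of_regular A h1 h4, ?_, fun _ => (C.low y hy).1,
      fun h' => absurd h h'⟩
    rw [(C.low y hy).2]; exact isFin_zero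
  · have h4 : IsFin (σ' (round p q (hiVal q))) := by
      rw [round_of_mem A (hiVal_mem A)]; exact C.der _
    have h5 : g ⊗ₑ σ' (round p q (hiVal q)) = 0 := by rw [hx h, zero_mul_fin A h4]
    exact ⟨_, by rw [h5]; exact Tower.Dead.of_regular A h1 (h3 h), h4, fun h' => absurd h' h,
      fun _ => C.high⟩

variable {hs : {x : Fin d → Flt p q // dom x} → Flt p q}

/-- A value unit that consists of an indicator and one more neuron. -/
theorem IsIndicator.valueUnit (A : Adm p q) (C : Core σ σ' c Z) {T : Tower p q l d 1}
    {u : {x : Fin d → Flt p q // dom x}} (hT : IsIndicator σ σ' T u) {w w' b z y : Flt p q} {v : ℝ}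
    (hc : c = 0) (hon : .fin w' ⊗ₑ .fin c ⊕ₑ .fin b = .fin y) (hz : σ (.fin y) = .fin z)
    (hv : .fin w ⊗ₑ .fin z = round p q v) (hoff : Low (.fin w' ⊗ₑ .fin Z ⊕ₑ .fin b))
    (h1 : ∀ x, IsFin (.fin (hs x) ⊗ₑ .fin w))
    (h2 : ∀ x, IsFin (.fin (hs x) ⊗ₑ .fin w ⊗ₑ σ' (.fin y)))
    (h3 : ∀ x, IsFin (.fin (hs x) ⊗ₑ .fin w ⊗ₑ σ' (.fin y) ⊗ₑ .fin w')) :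
    IsValueUnit σ σ' hs (Block.single (T.scal w' b) w) u v := by
  intro x s t
  by_cases hx : x = u
  · rw [if_pos hx]
    obtain ⟨y', h4, h5, h6, -⟩ := hT.dead A C x (h3 x) (fun h => absurd hx h)
    have h7 := h4.scal A (h2 x) (h3 x) (by rw [h6 hx]; exact isFin_fin _) h5 b
    rw [h6 hx, hon] at h7
    have h8 := h7.run (h1 x) (by rw [hz]; exact isFin_fin _) (C.der y) s t
    rwa [hz, hv] at h8
  · rw [if_neg hx]
    have hl := C.low _ hoff
    obtain ⟨y', h4, h5, -, h6⟩ := hT.dead A C x isFin_zero (fun _ => rfl)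
    have h9 : (ExtFlt.fin (hs x)) ⊗ₑ .fin w ⊗ₑ σ' (.fin w' ⊗ₑ .fin Z ⊕ₑ .fin b) = 0 := by
      rw [hl.2, mul_zero_fin A (h1 x)]
    have h10 : (0 : ExtFlt p q) ⊗ₑ .fin w' = 0 := zero_mul_fin A (isFin_fin _)
    have h7 := Tower.Dead.scal A (g := 0) (w := w') (by rw [h10]; exact h4) isFin_zero
      (by rw [h10]; exact isFin_zero) (by rw [h6 hx]; exact isFin_fin _) h5 b
    rw [h6 hx] at h7
    rw [← h9] at h7
    have h8 := h7.run (h1 x) (by rw [hl.1]; exact isFin_fin _) (by rw [hl.2]; exact isFin_zero)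
      s t
    rwa [hl.1, hc, show (ExtFlt.fin 0 : ExtFlt p q) = 0 from rfl, mul_zero_fin A (isFin_fin _),
      add_zero' A] at h8

end Indicators

end FloatNet

namespace FloatNet

/-! ### Removing the mantissa of a gradient by underflow -/

section Scaling

variable {p q : ℕ}

/-- Scaling by a power of two until only the smallest positive float is left. -/
theorem exists_scale_to_min (A : Adm p q) {δ : ℤ} (hδ : δ = 0 ∨ δ = 2) {γ : ExtFlt p q}
    (hγ : Btw γ (2 ^ (eMin q - p)) 1) :
    ∃ j : ℤ, eMin q - p ≤ j ∧ j ≤ 2 ∧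
      γ ⊗ₑ round p q (2 ^ j) ⊗ₑ round p q (2 ^ (-δ)) = round p q (2 ^ (eMin q - p)) := by
  obtain ⟨γ, rfl, h1, h2⟩ := hγ
  have hE := A.expRange_ge
  have hp := A.hp
  set ω : ℝ := 2 ^ (eMin q - p) with hω
  have hω0 : 0 < ω := by positivity
  have hmem : ∀ m : ℕ, m < 8 → (m : ℝ) * ω ∈ finiteFloats p q := fun m hm => by
    refine nat_mul_mem (lt_of_lt_of_le hm ?_) le_rfl (by rw [eMin_eq, eMax_eq]; omega)
    calc 8 = 2 ^ (2 + 1) := by norm_num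
      _ ≤ 2 ^ (p + 1) := Nat.pow_le_pow_right (by norm_num) (by omega)
  have hωm : ω ∈ finiteFloats p q := by simpa using hmem 1 (by norm_num)
  have hhalf : (2 : ℝ) ^ (eMin q - p - 1) = ω / 2 := by
    rw [zpow_sub_one₀ (by norm_num), hω]; rfl
  -- Some power of two brings γ into the half-open octave (aω, 2aω], where ω is the smallest
  -- positive float; the choice of a depends on the derivative that follows.
  have key : ∀ a : ℝ, 1 / 2 ≤ a → a ≤ 5 / 2 → ∃ j : ℤ, eMin q - p ≤ j ∧ j ≤ 2 ∧
      a * ω < γ * 2 ^ j ∧ γ * 2 ^ j ≤ 2 * a * ω := by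
    intro a ha ha'
    have hpos : 0 < (γ : ℝ) / (a * ω) := by
      have : 0 < (γ : ℝ) := lt_of_lt_of_le hω0 h1
      positivity
    obtain ⟨n, hn1, hn2⟩ := exists_mem_Ioc_zpow hpos (show (1 : ℝ) < 2 by norm_num)
    have haω : 0 < a * ω := by positivity
    rw [lt_div_iff₀ haω] at hn1
    rw [div_le_iff₀ haω, zpow_add_one₀ (by norm_num)] at hn2
    have hnn : (2 : ℝ) ^ n * 2 ^ (-n) = 1 := by rw [← zpow_add₀ (by norm_num)]; simp
    have hn0 : (0 : ℝ) < 2 ^ (-n) := by positivity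
    have hl : a * ω < γ * 2 ^ (-n) := by
      calc a * ω = (2 : ℝ) ^ n * 2 ^ (-n) * (a * ω) := by rw [hnn, one_mul]
        _ = 2 ^ n * (a * ω) * 2 ^ (-n) := by ring
        _ < _ := mul_lt_mul_of_pos_right hn1 hn0
    have hu : γ * 2 ^ (-n) ≤ 2 * a * ω := by
      calc γ * (2 : ℝ) ^ (-n) ≤ 2 ^ n * 2 * (a * ω) * 2 ^ (-n) :=
            mul_le_mul_of_nonneg_right hn2 hn0.le
        _ = 2 ^ n * 2 ^ (-n) * (2 * a * ω) := by ring
        _ = _ := by rw [hnn, one_mul]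
    refine ⟨-n, ?_, ?_, hl, hu⟩
    · have h3 : (2 : ℝ) ^ (eMin q - p - 1) < 2 ^ (-n) := by
        rw [hhalf]
        nlinarith
      have := (zpow_lt_zpow_iff_right₀ (show (1 : ℝ) < 2 by norm_num)).1 h3
      omega
    · have h3 : (2 : ℝ) ^ (-n) < 2 ^ (3 : ℤ) := by
        have : ω * 2 ^ (-n) ≤ 2 * a * ω := (mul_le_mul_of_nonneg_right h1 hn0.le).trans hu
        have : (2 : ℝ) ^ (-n) ≤ 2 * a := by
          by_contra! h
          nlinarith
        calc (2 : ℝ) ^ (-n) ≤ 2 * a := this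
          _ < 2 ^ (3 : ℤ) := by norm_num; linarith
      have := (zpow_lt_zpow_iff_right₀ (show (1 : ℝ) < 2 by norm_num)).1 h3
      omega
  have hjm : ∀ j : ℤ, eMin q - p ≤ j → j ≤ 2 → (2 : ℝ) ^ j ∈ finiteFloats p q := fun j h3 h4 =>
    two_zpow_mem A h3 (by rw [eMax_eq]; omega)
  have hnear : ∀ (x : ℝ) (m : ℕ) (hm : m < 8), |x - m * ω| < ω / 2 →
      round p q x = .fin ⟨m * ω, hmem m hm⟩ := fun x m hm h => by
    refine round_near_of_abs_lt A ⟨m * ω, hmem m hm⟩ ?_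
    rw [hhalf]; exact h
  rcases hδ with rfl | rfl
  -- With derivative 1 the octave is (ω/2, ω], which rounds to ω at once.
  · obtain ⟨j, h3, h4, h5, h6⟩ := key (1 / 2) le_rfl (by norm_num)
    refine ⟨j, h3, h4, ?_⟩
    have h7 := hnear (γ * 2 ^ j) 1 (by norm_num) (by rw [abs_lt]; constructor <;> push_cast <;> linarith)
    rw [round_of_mem A (hjm j h3 h4), fin_mul, h7, neg_zero, zpow_zero,
      round_of_mem A (by simpa using hjm 0 (by rw [eMin_eq]; omega) (by norm_num)), fin_mul]
    simp
  -- With derivative 1/4 the octave is (5ω/2, 5ω]. It rounds into [3ω, 5ω], and a quarter of that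
  -- lies strictly between ω/2 and 3ω/2, hence rounds to ω.
  · obtain ⟨j, h3, h4, h5, h6⟩ := key (5 / 2) (by norm_num) le_rfl
    refine ⟨j, h3, h4, ?_⟩
    have h7 : Btw (round p q (γ * 2 ^ j)) (3 * ω) (5 * ω) := by
      rcases le_or_gt (3 * ω) (γ * 2 ^ j) with h | h
      · exact round_btw A (by simpa using hmem 3 (by norm_num))
          (by simpa using hmem 5 (by norm_num)) h (by linarith)
      · rw [hnear (γ * 2 ^ j) 3 (by norm_num) (by rw [abs_lt]; constructor <;> push_cast <;> linarith)]
        rw [btw_fin]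
        constructor <;> push_cast <;> linarith
    obtain ⟨f, h8, h9, h10⟩ := h7
    rw [round_of_mem A (hjm j h3 h4), fin_mul, h8,
      round_of_mem A (hjm (-2) (by rw [eMin_eq]; omega) (by norm_num)), fin_mul]
    have h11 : (2 : ℝ) ^ (-2 : ℤ) = 1 / 4 := by norm_num
    rw [hnear _ 1 (by norm_num) (by simp only [h11]; rw [abs_lt]; constructor <;> push_cast <;> linarith),
      round_of_mem A hωm]
    simp

end Scaling

/-! ### The gradient path -/

section Chain

variable {p q d l : ℕ} {σ σ' : ExtFlt p q → ExtFlt p q}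

/-- The activation function maps finite floats into `[-1, 1]`. -/
def IsBdd (σ : ExtFlt p q → ExtFlt p q) : Prop := ∀ y : Flt p q, Btw (σ (.fin y)) (-1) 1

/-- Properties of a pre-activation `β` with value `s` where the derivative is `2 ^ (-δ)`. -/
structure PathAct (σ σ' : ExtFlt p q → ExtFlt p q) (c Z β s : Flt p q) (δ : ℤ) (H : ℝ) : Prop where
  hδ : δ = 0 ∨ δ = 2
  val : σ (.fin β) = .fin s
  der : σ' (.fin β) = round p q (2 ^ (-δ))
  bdd : IsBdd σ → β = 0
  step : ∀ a : ℤ, 2 * a ≤ expRange q → |(s : ℝ)| * 2 ^ (a + δ) ≤ maxFloat p q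
  bound : H * 2 ^ δ ≤ maxFloat p q
  gate : ∀ j : ℤ, eMin q - p ≤ j → j ≤ 2 → ∃ w b : Flt p q,
    (∃ y z : Flt p q, .fin w ⊗ₑ .fin c ⊕ₑ (round p q (2 ^ j) ⊗ₑ .fin s) ⊕ₑ .fin b = .fin y ∧
      σ (.fin y) = .fin z ∧ σ' (.fin y) = round p q (2 ^ (-δ)) ∧ |(z : ℝ)| * 2 ^ δ ≤ maxFloat p q) ∧
    ∀ z : Flt p q, (z = s ∨ (IsBdd σ ∧ |(z : ℝ)| ≤ 1)) →
      Low (.fin w ⊗ₑ .fin Z ⊕ₑ (round p q (2 ^ j) ⊗ₑ .fin z) ⊕ₑ .fin b)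

/-- A layer of the gradient path. -/
def stepAffine (β W : Flt p q) : Affine p q 2 2 where
  A := fun i j => if i = 0 then (if j = 0 then W else fneg W) else 0
  b := fun _ => β

/-- The gradient path. -/
def chain (ρ : Affine p q d 2) (β : Flt p q) (W : ℕ → Flt p q) : (n : ℕ) → Tower p q n d 2
  | 0 => .base ρ
  | n + 1 => .snoc (chain ρ β W n) two_pos (stepAffine β (W n))

variable {dom : (Fin d → Flt p q) → Prop}

/-- The first layer of a gradient path for the input `u` and the coordinate `k`. -/
structure PathBase (σ σ' : ExtFlt p q → ExtFlt p q) (δ : ℤ) (u : {x : Fin d → Flt p q // dom x})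
    (k : Fin d) (v : ℝ) (ρ : Affine p q d 2) (v₀ : Flt p q) (i₀ : ℤ) : Prop where
  fin : ∀ x : {x : Fin d → Flt p q // dom x}, ∃ yP yQ : Flt p q,
    ρ.eval (inp x) 0 = .fin yP ∧ ρ.eval (inp x) 1 = .fin yQ ∧
    ((x = u ∨ ¬ IsBdd σ) → σ (.fin yP) = .fin v₀ ∧ σ (.fin yQ) = .fin v₀ ∧
      σ' (.fin yP) = round p q (2 ^ (-δ)) ∧ σ' (.fin yQ) = round p q (2 ^ (-δ)))
  bound : |(v₀ : ℝ)| * 2 ^ δ ≤ maxFloat p q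
  le : eMin q - p ≤ i₀
  le' : i₀ + δ ≤ eMax q
  out : round p q (2 ^ i₀) ⊗ₑ .fin (ρ.A 0 k) = round p q v
  ne : ∀ k', k' ≠ k → ρ.A 0 k' = 0
  one : ∀ k', ρ.A 1 k' = 0

/-- The exponent of the gradient along the path. -/
def pathExp (p q : ℕ) (i₀ : ℤ) (n : ℕ) : ℤ :=
  max (eMin q - p) (i₀ - expRange q / 2 * ((n - 1 : ℕ) : ℤ))

theorem pathExp_zero {i₀ : ℤ} (h : eMin q - p ≤ i₀) : pathExp p q i₀ 0 = i₀ := by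
  unfold pathExp
  simp [h]

/-- Each layer gains at most 2^(E/2), E = `expRange q`, the increase that `PathAct.step` allows in
the forward pass. The first layer gains nothing, because the value `v₀` of the base layer may
already be close to overflow. -/
theorem pathExp_step (A : Adm p q) {i₀ : ℤ} (h : eMin q - p ≤ i₀) (n : ℕ) :
    pathExp p q i₀ (n + 1) ≤ pathExp p q i₀ n ∧
      2 * (pathExp p q i₀ n - pathExp p q i₀ (n + 1)) ≤ expRange q ∧
      eMin q - p ≤ pathExp p q i₀ n ∧ pathExp p q i₀ n ≤ i₀ := by
  have hE := A.expRange_ge.2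
  unfold pathExp
  obtain ⟨a, ha⟩ : ∃ a, a = expRange q / 2 := ⟨_, rfl⟩
  rw [← ha]
  have ha0 : 0 ≤ a := by omega
  have ha1 : 2 * a ≤ expRange q := by omega
  rcases n with _ | n
  · simp only [Nat.zero_sub, Nat.cast_zero, mul_zero, zero_add, Nat.sub_self, sub_zero]
    omega
  · simp only [Nat.add_sub_cancel]
    have h1 : a * ((n + 1 : ℕ) : ℤ) = a * n + a := by push_cast; ring
    have h2 : 0 ≤ a * (n : ℤ) := by positivity
    rw [h1]
    omega

/-- From eMin - p ≥ 2 - 3E/2 to eMax = E - 1 there are fewer than 5E/2 binades, so five steps of E/2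
suffice; with the neutral first step this makes six. -/
theorem pathExp_of_le (A : Adm p q) {i₀ : ℤ} (h : i₀ ≤ eMax q) {n : ℕ} (hn : 6 ≤ n) :
    pathExp p q i₀ n = eMin q - p := by
  have hE := A.expRange_ge.2
  have hp := A.two_mul_le
  unfold pathExp
  obtain ⟨a, ha⟩ : ∃ a, a = expRange q / 2 := ⟨_, rfl⟩
  have h2 : expRange q = 2 * a := by
    have hq := A.hq
    rw [ha]
    unfold expRange
    obtain ⟨k, rfl⟩ : ∃ k, q = k + 2 := ⟨q - 2, by omega⟩
    rw [show k + 2 - 1 = k + 1 by omega, pow_succ]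
    omega
  rw [← ha]
  refine max_eq_left ?_
  have h1 : a * 5 ≤ a * ((n - 1 : ℕ) : ℤ) :=
    mul_le_mul_of_nonneg_left (by omega) (by omega)
  rw [eMin_eq]
  rw [eMax_eq] at h
  omega

/-- The weights along the path. -/
def IsPathWeight (δ i₀ : ℤ) (W : ℕ → Flt p q) : Prop :=
  ∀ n, (W n : ℝ) = 2 ^ (pathExp p q i₀ n - pathExp p q i₀ (n + 1) + δ)

theorem exists_pathWeight (A : Adm p q) {δ i₀ : ℤ} (hδ : δ = 0 ∨ δ = 2) (h : eMin q - p ≤ i₀) :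
    ∃ W : ℕ → Flt p q, IsPathWeight δ i₀ W := by
  have : ∀ n, ∃ W : Flt p q, (W : ℝ) = 2 ^ (pathExp p q i₀ n - pathExp p q i₀ (n + 1) + δ) := by
    intro n
    have h1 := pathExp_step A h n
    have hE := A.expRange_ge.2
    refine ⟨⟨_, two_zpow_mem A ?_ ?_⟩, rfl⟩
    · rw [eMin_eq]; omega
    · rw [eMax_eq]; omega
  choose W hW using this
  exact ⟨W, hW⟩

variable {c Z β s : Flt p q} {δ : ℤ} {H : ℝ}

theorem stepAffine_eval_zero (A : Adm p q) (β W : Flt p q) (z : Fin 2 → ExtFlt p q) :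
    (stepAffine β W).eval z 0 = .fin W ⊗ₑ z 0 ⊕ₑ (.fin (fneg W) ⊗ₑ z 1) ⊕ₑ .fin β := by
  rw [Affine.eval_apply, facc_two, zero_add' A]; rfl

theorem stepAffine_eval_one (A : Adm p q) (β W : Flt p q) {z : Fin 2 → ExtFlt p q}
    (hz : ∀ i, IsFin (z i)) : (stepAffine β W).eval z 1 = .fin β := by
  rw [Affine.eval_apply, facc_two, zero_add' A]
  change 0 ⊗ₑ z 0 ⊕ₑ (0 ⊗ₑ z 1) ⊕ₑ .fin β = _
  rw [zero_mul_fin A (hz 0), zero_mul_fin A (hz 1), zero_add' A, zero_add' A]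

theorem stepAffine_grad (A : Adm p q) (β W : Flt p q) {g : Fin 2 → ExtFlt p q}
    (hg : IsFin (g 1)) : (stepAffine β W).grad g 0 = g 0 ⊗ₑ .fin W ∧
      (stepAffine β W).grad g 1 = g 0 ⊗ₑ .fin (fneg W) := by
  constructor
  · rw [Affine.grad_apply, facc_two, zero_add' A]
    change g 0 ⊗ₑ .fin W ⊕ₑ (g 1 ⊗ₑ 0) = _
    rw [mul_zero_fin A hg, add_zero' A]
  · rw [Affine.grad_apply, facc_two, zero_add' A]
    change g 0 ⊗ₑ .fin (fneg W) ⊕ₑ (g 1 ⊗ₑ 0) = _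
    rw [mul_zero_fin A hg, add_zero' A]

/-- The state of a gradient path after `n` layers. -/
structure ChainState (σ σ' : ExtFlt p q → ExtFlt p q) (β : Flt p q) (δ : ℤ) (W : Flt p q)
    (T : Tower p q l d 2) (x : Fin d → ExtFlt p q) (al inn : Prop) (yP yQ : Flt p q) :
    Prop where
  regular : T.Regular σ σ' x
  evalP : T.eval σ x 0 = .fin yP
  evalQ : T.eval σ x 1 = .fin yQ
  aligned : al → ∃ v : Flt p q, |(v : ℝ)| * W ≤ maxFloat p q ∧ σ (.fin yP) = .fin v ∧
    σ (.fin yQ) = .fin v ∧ σ' (.fin yP) = round p q (2 ^ (-δ)) ∧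
    σ' (.fin yQ) = round p q (2 ^ (-δ))
  inner : inn → yQ = β ∧ (al → yP = β)

/-- If P and Q have the same activation v, then W ⊗ v and its negative cancel exactly and the next P
sees only β. This happens at `u`, and for unbounded σ at every input. Elsewhere σ is bounded and
only finiteness has to be kept. -/
theorem chain_state (A : Adm p q) (C : Core σ σ' c Z) (P : PathAct σ σ' c Z β s δ H)
    {u : {x : Fin d → Flt p q // dom x}} {k : Fin d} {v : ℝ} {ρ : Affine p q d 2} {v₀ : Flt p q}
    {i₀ : ℤ} (hρ : PathBase σ σ' δ u k v ρ v₀ i₀) {W : ℕ → Flt p q} (hW : IsPathWeight δ i₀ W)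
    (x : {x : Fin d → Flt p q // dom x}) (n : ℕ) :
    ∃ yP yQ : Flt p q, ChainState σ σ' β δ (W n) (chain ρ β W n) (inp x) (x = u ∨ ¬ IsBdd σ)
      (0 < n) yP yQ := by
  have hWs := fun n => pathExp_step A hρ.le n
  induction n with
  | zero =>
    obtain ⟨yP, yQ, h1, h2, h3⟩ := hρ.fin x
    refine ⟨yP, yQ, trivial, h1, h2, fun h => ?_, fun h => absurd h (lt_irrefl _)⟩
    obtain ⟨h4, h5, h6, h7⟩ := h3 h
    refine ⟨v₀, ?_, h4, h5, h6, h7⟩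
    rw [hW 0, pathExp_zero hρ.le, show pathExp p q i₀ (0 + 1) = i₀ by
      have := hρ.le; simp [pathExp, this], sub_self, zero_add]
    exact hρ.bound
  | succ n ih =>
    obtain ⟨yP, yQ, S⟩ := ih
    have hreg : ∀ i, IsFin (σ ((chain ρ β W n).eval σ (inp x) i)) ∧
        IsFin (σ' ((chain ρ β W n).eval σ (inp x) i)) := by
      intro i
      fin_cases i
      · change IsFin (σ ((chain ρ β W n).eval σ (inp x) 0)) ∧
          IsFin (σ' ((chain ρ β W n).eval σ (inp x) 0))
        rw [S.evalP]; exact ⟨C.val _, C.der _⟩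
      · change IsFin (σ ((chain ρ β W n).eval σ (inp x) 1)) ∧
          IsFin (σ' ((chain ρ β W n).eval σ (inp x) 1))
        rw [S.evalQ]; exact ⟨C.val _, C.der _⟩
    have hW0 : ∀ n, (0 : ℝ) < W n := fun n => by rw [hW]; positivity
    have hQ : (chain ρ β W (n + 1)).eval σ (inp x) 1 = .fin β :=
      stepAffine_eval_one A β (W n) fun i => (hreg i).1
    have hP : (chain ρ β W (n + 1)).eval σ (inp x) 0 = .fin (W n) ⊗ₑ σ (.fin yP) ⊕ₑ
        (.fin (fneg (W n)) ⊗ₑ σ (.fin yQ)) ⊕ₑ .fin β := by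
      rw [chain, Tower.eval, stepAffine_eval_zero A, S.evalP, S.evalQ]
    by_cases hal : x = u ∨ ¬ IsBdd σ
    · obtain ⟨v, h1, h2, h3, -, -⟩ := S.aligned hal
      have h4 : IsFin (.fin (W n) ⊗ₑ .fin v) := by
        rw [fin_mul]
        refine round_isFin ?_
        rw [abs_mul, abs_of_pos (hW0 n), mul_comm]; exact h1
      obtain ⟨w, hw⟩ := h4
      have hP' : (chain ρ β W (n + 1)).eval σ (inp x) 0 = .fin β := by
        rw [hP, h2, h3, hw, fneg_mul A hw, add_fneg A, zero_add' A]
      refine ⟨β, β, ⟨S.regular, hreg⟩, hP', hQ, fun _ => ⟨s, ?_, P.val, P.val, P.der, P.der⟩,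
        fun _ => ⟨rfl, fun _ => rfl⟩⟩
      rw [hW]
      exact P.step _ (hWs (n + 1)).2.1
    · have hb : IsBdd σ := by
        by_contra h
        exact hal (Or.inr h)
      obtain ⟨zP, hzP, h1, h2⟩ := hb yP
      obtain ⟨zQ, hzQ, h3, h4⟩ := hb yQ
      obtain ⟨h5, h6, -, -⟩ := hWs n
      have hE := A.expRange_ge.2
      set a := pathExp p q i₀ n - pathExp p q i₀ (n + 1) + δ with ha
      have hδ := P.hδ
      have hm : (2 : ℝ) ^ a ∈ finiteFloats p q := by
        refine two_zpow_mem A ?_ ?_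
        · rw [eMin_eq]; omega
        · rw [eMax_eq]; omega
      -- Two activations in [-1, 1] with weights ±2^a give a sum of size at most 2^(a+1), still
      -- finite; β = 0 in the bounded case, so the bias does no harm.
      have hm' : (2 : ℝ) ^ (a + 1) ∈ finiteFloats p q := by
        refine two_zpow_mem A ?_ ?_
        · rw [eMin_eq]; omega
        · rw [eMax_eq]; omega
      have h7 : Btw (.fin (W n) ⊗ₑ .fin zP) (-2 ^ a) (2 ^ a) := by
        refine Btw.mul A (hW0 n).le (btw_fin.2 ⟨h1, h2⟩) (neg_mem hm) hm ?_ ?_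
        · rw [hW]; linarith
        · rw [hW]; linarith
      have h8 : Btw (.fin (fneg (W n)) ⊗ₑ .fin zQ) (-2 ^ a) (2 ^ a) := by
        refine Btw.neg_mul A ?_ (btw_fin.2 ⟨h3, h4⟩) (neg_mem hm) hm ?_ ?_
        · rw [coe_fneg]; linarith [hW0 n]
        · rw [coe_fneg, hW]; linarith
        · rw [coe_fneg, hW]; linarith
      have h9 := h7.add A h8 (neg_mem hm') hm' (by rw [zpow_add_one₀ (by norm_num)]; linarith)
        (by rw [zpow_add_one₀ (by norm_num)]; linarith)
      obtain ⟨y, hy, -⟩ := h9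
      have hP' : (chain ρ β W (n + 1)).eval σ (inp x) 0 = .fin y := by
        rw [hP, hzP, hzQ, hy, P.bdd hb]
        exact add_zero' A _
      exact ⟨y, β, ⟨S.regular, hreg⟩, hP', hQ, fun h => absurd h hal,
        fun _ => ⟨rfl, fun h => absurd h hal⟩⟩

/-- Along P the gradient is multiplied by the weight 2^(difference + δ) and then by the derivative
2^(-δ); both products are powers of two in range, hence exact. The gradient at Q meets only zero
weights in the layer below and just has to be finite. -/
theorem chain_grad (A : Adm p q) (C : Core σ σ' c Z) (P : PathAct σ σ' c Z β s δ H)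
    {u : {x : Fin d → Flt p q // dom x}} {k : Fin d} {v : ℝ} {ρ : Affine p q d 2} {v₀ : Flt p q}
    {i₀ : ℤ} (hρ : PathBase σ σ' δ u k v ρ v₀ i₀) {W : ℕ → Flt p q} (hW : IsPathWeight δ i₀ W)
    (n : ℕ) (g : Fin 2 → ExtFlt p q) (hg : g 0 = round p q (2 ^ pathExp p q i₀ n))
    (hg' : IsFin (g 1)) (t : Fin d → ExtFlt p q) :
    (chain ρ β W n).GradFinite σ σ' (inp u) g ∧ (chain ρ β W n).gradFrom σ σ' t (inp u) g =
      Function.update t k (t k ⊕ₑ round p q v) := by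
  have hWs := fun n => pathExp_step A hρ.le n
  have hδ := P.hδ
  have hle := hρ.le'
  have hm : ∀ n, (2 : ℝ) ^ pathExp p q i₀ n ∈ finiteFloats p q := fun n => by
    have := hWs n
    exact two_zpow_mem A (by omega) (by omega)
  induction n generalizing g with
  | zero =>
    refine ⟨fun i => ?_, funext fun k' => ?_⟩
    · fin_cases i
      · change IsFin (g 0)
        rw [hg, round_of_mem A (hm 0)]; exact isFin_fin _
      · exact hg'
    · simp only [chain, Tower.gradFrom]
      rw [facc_two, hρ.one, show (ExtFlt.fin 0 : ExtFlt p q) = 0 from rfl, mul_zero_fin A hg',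
        add_zero' A, hg, pathExp_zero hρ.le]
      by_cases h : k' = k
      · subst h
        rw [Function.update_self, hρ.out]
      · rw [Function.update_of_ne h, hρ.ne _ h, show (ExtFlt.fin 0 : ExtFlt p q) = 0 from rfl,
          mul_zero_fin A, add_zero' A]
        rw [round_of_mem A (by simpa [pathExp_zero hρ.le] using hm 0)]; exact isFin_fin _
  | succ n ih =>
    obtain ⟨yP, yQ, S⟩ := chain_state A C P hρ hW u n
    obtain ⟨v', -, -, -, h1, h2⟩ := S.aligned (Or.inl rfl)
    obtain ⟨h3, h4⟩ := stepAffine_grad A β (W n) hg'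
    have hm' : (2 : ℝ) ^ (pathExp p q i₀ n + δ) ∈ finiteFloats p q := by
      have := hWs n
      exact two_zpow_mem A (by omega) (by omega)
    have hmd : (2 : ℝ) ^ (-δ) ∈ finiteFloats p q := by
      have := A.expRange_ge.2
      exact two_zpow_mem A (by rw [eMin_eq]; omega) (by rw [eMax_eq]; omega)
    have h5 : g 0 ⊗ₑ .fin (W n) = .fin ⟨_, hm'⟩ := by
      rw [hg, round_of_mem A (hm (n + 1))]
      refine exact_mul A hm' ?_
      rw [hW, ← zpow_add₀ (by norm_num)]
      congr 1; ring
    have h6 : g 0 ⊗ₑ .fin (fneg (W n)) = .fin (fneg ⟨_, hm'⟩) := by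
      rw [hg, round_of_mem A (hm (n + 1))] at h5 ⊢
      exact mul_fneg A h5
    have h7 : (ExtFlt.fin ⟨_, hm'⟩) ⊗ₑ round p q (2 ^ (-δ)) = round p q (2 ^ pathExp p q i₀ n) := by
      rw [round_of_mem A hmd, round_of_mem A (hm n)]
      refine exact_mul A (hm n) ?_
      rw [← zpow_add₀ (by norm_num)]
      congr 1; ring
    have h8 : IsFin (.fin (fneg ⟨_, hm'⟩) ⊗ₑ round p q (2 ^ (-δ))) := by
      rw [round_of_mem A hmd] at h7 ⊢
      rw [round_of_mem A (hm n)] at h7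
      exact ⟨_, fneg_mul A h7⟩
    obtain ⟨h9, h10⟩ := ih (fun j => (stepAffine β (W n)).grad g j ⊗ₑ
        σ' ((chain ρ β W n).eval σ (inp u) j)) (by rw [h3, h5, S.evalP, h1, h7])
        (by rw [h4, h6, S.evalQ, h2]; exact h8)
    refine ⟨⟨fun i => ?_, fun j => ?_, h9⟩, h10⟩
    · fin_cases i
      · change IsFin (g 0)
        rw [hg, round_of_mem A (hm (n + 1))]; exact isFin_fin _
      · exact hg'
    · fin_cases j
      · change IsFin ((stepAffine β (W n)).grad g 0)
        rw [h3, h5]; exact isFin_fin _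
      · change IsFin ((stepAffine β (W n)).grad g 1)
        rw [h4, h6]; exact isFin_fin _

end Chain

end FloatNet

namespace FloatNet

/-! ### Gates and gradient units -/

section Gate

variable {p q d l : ℕ} {σ σ' : ExtFlt p q → ExtFlt p q} {dom : (Fin d → Flt p q) → Prop}
  {c Z β s : Flt p q} {δ : ℤ} {H : ℝ}

/-- The last layer of a gradient path: two neurons with the same indicator. -/
def gateAffine (w ζ b : Flt p q) : Affine p q (1 + 2) 2 where
  A := fun i => Fin.append (fun _ : Fin 1 => w) (fun j : Fin 2 => if i = j then ζ else 0)
  b := fun _ => b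

theorem gateAffine_eval (A : Adm p q) (w ζ b : Flt p q) {z₁ : Fin 1 → ExtFlt p q}
    {z₂ : Fin 2 → ExtFlt p q} (hz : ∀ i, IsFin (z₂ i)) (i : Fin 2) :
    (gateAffine w ζ b).eval (Fin.append z₁ z₂) i =
      .fin w ⊗ₑ z₁ 0 ⊕ₑ (.fin ζ ⊗ₑ z₂ i) ⊕ₑ .fin b := by
  rw [Affine.eval_apply]
  simp only [gateAffine]
  rw [append_map₂ (fun (a : Flt p q) y => (ExtFlt.fin a) ⊗ₑ y), facc_append, facc_one,
    zero_add' A, facc_single A _ 2 i]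
  · rw [if_pos rfl]
  · intro j hj
    rw [if_neg (Ne.symm hj)]
    exact zero_mul_fin A (hz j)

theorem gateAffine_grad_left (w ζ b : Flt p q) (g : Fin 2 → ExtFlt p q) (A : Adm p q)
    (j : Fin 1) : (gateAffine w ζ b).grad g (Fin.castAdd 2 j) = g 0 ⊗ₑ .fin w ⊕ₑ (g 1 ⊗ₑ .fin w) := by
  rw [Affine.grad_apply, facc_two, zero_add' A]
  simp only [gateAffine, Fin.append_left]

theorem gateAffine_grad_right (A : Adm p q) (w ζ b : Flt p q) {g : Fin 2 → ExtFlt p q}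
    (hg : ∀ i, IsFin (g i)) (j : Fin 2) :
    (gateAffine w ζ b).grad g (Fin.natAdd 1 j) = g j ⊗ₑ .fin ζ := by
  rw [Affine.grad_apply, facc_single A 0 2 j, zero_add' A]
  · simp only [gateAffine, Fin.append_right, if_true]
  · intro i hi
    simp only [gateAffine, Fin.append_right, if_neg hi]
    exact mul_zero_fin A (hg i)

/-- Output weights that normalize the input gradient. -/
theorem exists_normalizing_weight (A : Adm p q) (hδ : δ = 0 ∨ δ = 2) {h : Flt p q} (hh : h ≠ 0) :
    ∃ a : Flt p q, |(a : ℝ)| ≤ 2 ^ δ ∧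
      Btw (.fin h ⊗ₑ .fin a ⊗ₑ round p q (2 ^ (-δ))) (2 ^ (eMin q - p)) 1 := by
  have hE := A.expRange_ge.2
  have hp := A.hp
  have hp' := A.two_mul_le
  have hmem : ∀ i : ℤ, eMin q - p ≤ i → i ≤ 2 → (2 : ℝ) ^ i ∈ finiteFloats p q := fun i h1 h2 =>
    two_zpow_mem A h1 (by rw [eMax_eq]; omega)
  have hmin := eMin_eq q
  have h0 : (h : ℝ) ≠ 0 := fun h' => hh (Subtype.ext h')
  have hlo : (2 : ℝ) ^ (eMin q - p) ≤ |(h : ℝ)| := by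
    have := min_sep A (zero_mem_finiteFloats p q) h.2 h0
    rwa [sub_zero] at this
  have hhi : |(h : ℝ)| < 2 ^ expRange q := by
    have h1 := (abs_le_maxFloat A h.2).trans_lt maxFloat_lt
    rwa [eMax_eq, sub_add_cancel] at h1
  -- Small h needs no damping and gets the weight 2^δ, which anticipates the derivative 2^(-δ). For
  -- |h| > 1 the weight 2^(δ-E) is enough, because |h| < 2^E.
  have key : ∃ e : ℤ, eMin q - p ≤ e ∧ e ≤ δ ∧ (2 : ℝ) ^ (eMin q - p + δ) ≤ |(h : ℝ)| * 2 ^ e ∧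
      |(h : ℝ)| * 2 ^ e ≤ 2 ^ δ := by
    rcases le_or_gt |(h : ℝ)| 1 with h1 | h1
    · refine ⟨δ, by omega, le_rfl, ?_, ?_⟩
      · rw [zpow_add₀ (by norm_num)]
        exact mul_le_mul_of_nonneg_right hlo (by positivity)
      · have : (0 : ℝ) < 2 ^ δ := by positivity
        nlinarith
    · refine ⟨δ - expRange q, by omega, by omega, ?_, ?_⟩
      · calc (2 : ℝ) ^ (eMin q - p + δ) ≤ 2 ^ (δ - expRange q) :=
              zpow_le_zpow_right₀ (by norm_num) (by omega)
          _ ≤ _ := le_mul_of_one_le_left (by positivity) h1.le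
      · calc |(h : ℝ)| * 2 ^ (δ - expRange q) ≤ 2 ^ expRange q * 2 ^ (δ - expRange q) :=
              mul_le_mul_of_nonneg_right hhi.le (by positivity)
          _ = 2 ^ δ := by
              rw [← zpow_add₀ (by norm_num)]; congr 1; ring
  obtain ⟨e, he1, he2, he3, he4⟩ := key
  have hsgn : ∃ a : Flt p q, |(a : ℝ)| = 2 ^ e ∧ (h : ℝ) * a = |(h : ℝ)| * 2 ^ e := by
    have hm := hmem e he1 (by omega)
    rcases le_total 0 (h : ℝ) with h1 | h1
    · exact ⟨⟨_, hm⟩, abs_of_pos (by positivity), by rw [abs_of_nonneg h1]⟩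
    · refine ⟨⟨_, neg_mem hm⟩, ?_, ?_⟩
      · rw [abs_neg]; exact abs_of_pos (by positivity)
      · rw [abs_of_nonpos h1]; ring
  obtain ⟨a, ha1, ha2⟩ := hsgn
  refine ⟨a, by rw [ha1]; exact zpow_le_zpow_right₀ (by norm_num) he2, ?_⟩
  have h2 : Btw (.fin h ⊗ₑ .fin a) (2 ^ (eMin q - p + δ)) (2 ^ δ) := by
    rw [fin_mul, ha2]
    exact round_btw A (hmem _ (by omega) (by omega)) (hmem _ (by omega) (by omega)) he3 he4
  obtain ⟨f, hf, h3, h4⟩ := h2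
  rw [hf, round_of_mem A (hmem (-δ) (by omega) (by omega)), fin_mul]
  have hd : (2 : ℝ) ^ δ * 2 ^ (-δ) = 1 := by rw [← zpow_add₀ (by norm_num)]; simp
  have hd0 : (0 : ℝ) < 2 ^ (-δ) := by positivity
  refine round_btw A (hmem _ le_rfl (by omega)) (by simpa using hmem 0 (by omega) (by omega)) ?_ ?_
  · calc (2 : ℝ) ^ (eMin q - p) = 2 ^ (eMin q - p + δ) * 2 ^ (-δ) := by
          rw [← zpow_add₀ (by norm_num)]; congr 1; ring
      _ ≤ _ := mul_le_mul_of_nonneg_right h3 hd0.le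
  · rw [← hd]
    exact mul_le_mul_of_nonneg_right h4 hd0.le

/-- Two neurons on top of a tower `I` and a gradient path `T`. -/
def gateTower (I : Tower p q l d 1) (T : Tower p q l d 2) (w ζ b : Flt p q) :
    Tower p q (l + 1) d 2 :=
  .snoc (I.par T) (by norm_num) (gateAffine w ζ b)

theorem gateTower_eval (A : Adm p q) {I : Tower p q l d 1} {T : Tower p q l d 2}
    {x : Fin d → ExtFlt p q} (hI : I.Regular σ σ' x) (hT : T.Regular σ σ' x) {zI : ExtFlt p q}
    (hzI : σ (I.eval σ x 0) = zI) (hzT : ∀ i, IsFin (σ (T.eval σ x i))) (w ζ b : Flt p q)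
    (i : Fin 2) : (gateTower I T w ζ b).eval σ x i =
      .fin w ⊗ₑ zI ⊕ₑ (.fin ζ ⊗ₑ σ (T.eval σ x i)) ⊕ₑ .fin b := by
  simp only [gateTower, Tower.eval]
  rw [(Tower.eval_par A I T x hI hT).2, append_map σ, gateAffine_eval A _ _ _ hzT, hzI]

/-- Rounding is odd, so the rounded products with a and -a are exact negatives of each other and
their sum is exactly 0, provided that the first is finite. -/
theorem facc_cancel (A : Adm p q) {a z : Flt p q} (h : IsFin ((ExtFlt.fin a) ⊗ₑ .fin z))
    {y : Fin 2 → ExtFlt p q} (hy : ∀ i, y i = .fin z) :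
    facc 0 2 (fun i => .fin (if i = (0 : Fin 2) then a else fneg a) ⊗ₑ y i) = 0 := by
  obtain ⟨f, hf⟩ := h
  rw [facc_two, zero_add' A, hy, hy]
  change (ExtFlt.fin a) ⊗ₑ .fin z ⊕ₑ (.fin (fneg a) ⊗ₑ .fin z) = 0
  rw [fneg_mul A hf, hf, add_fneg A]

/-- Two neurons with output weights `a` and `-a`. -/
def Block.pair (T : Tower p q l d 2) (a : Flt p q) : Block p q l d where
  n := 2
  hn := two_pos
  T := T
  a := fun i => if i = 0 then a else fneg a

theorem Block.pair_run (A : Adm p q) {T : Tower p q l d 2} {x : Fin d → ExtFlt p q}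
    {h a f z z' γ : Flt p q} {t t' : Fin d → ExtFlt p q} (hreg : T.Regular σ σ' x)
    (hz : ∀ i, σ (T.eval σ x i) = .fin z) (hz' : ∀ i, σ' (T.eval σ x i) = .fin z')
    (hf : (ExtFlt.fin h) ⊗ₑ .fin a = .fin f) (hγ : (ExtFlt.fin f) ⊗ₑ .fin z' = .fin γ)
    (haz : IsFin ((ExtFlt.fin a) ⊗ₑ .fin z))
    (hg : T.GradFinite σ σ' x fun i => .fin (if i = 0 then γ else fneg γ))
    (hg' : T.gradFrom σ σ' t x (fun i => .fin (if i = 0 then γ else fneg γ)) = t') :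
    (Block.pair T a).Run σ σ' x h 0 t 0 t' := by
  have h1 : ∀ i : Fin 2, (ExtFlt.fin h) ⊗ₑ .fin (if i = 0 then a else fneg a) =
      .fin (if i = 0 then f else fneg f) :=
    Fin.forall_fin_two.2 ⟨hf, mul_fneg A hf⟩
  have h2 : (fun i : Fin 2 => (ExtFlt.fin h) ⊗ₑ .fin (if i = 0 then a else fneg a) ⊗ₑ
      σ' (T.eval σ x i)) = fun i => .fin (if i = 0 then γ else fneg γ) := by
    funext i
    rw [h1, hz']
    revert i
    exact Fin.forall_fin_two.2 ⟨hγ, fneg_mul A hγ⟩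
  exact ⟨hreg, fun i => ⟨z, hz i⟩, fun i => ⟨z', hz' i⟩, fun i => ⟨_, h1 i⟩,
    Eq.mpr (congrArg (fun g => T.GradFinite σ σ' x g) h2) hg, facc_cancel A haz hz,
    (congrArg (fun g => T.gradFrom σ σ' t x g) h2).trans hg'⟩

theorem isFin_mul_of_abs_le {x y : Flt p q} (h : |(x : ℝ)| * |(y : ℝ)| ≤ maxFloat p q) :
    IsFin ((ExtFlt.fin x) ⊗ₑ .fin y) := by
  rw [fin_mul]
  exact round_isFin (by rwa [abs_mul])

variable {hs : {x : Fin d → Flt p q // dom x} → Flt p q}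

/-- At `u` the gate neurons are active and carry ±γ. The indicator receives γw - γw = 0, and the
path receives ± the smallest positive float, which is where `chain_grad` starts once the path has at
least six layers. Away from `u` both gate neurons are low: equal values, zero derivatives. -/
theorem exists_gradUnit (A : Adm p q) (C : Core σ σ' c Z) (hc : |(c : ℝ)| ≤ 1)
    (hd : HasDetectors σ σ' dom l) (P : PathAct σ σ' c Z β s δ H)
    (hH : ∀ x, |(hs x : ℝ)| ≤ H) {m : ℕ} (hm : 6 ≤ m) (hlm : l + 2 ≤ m)
    {u : {x : Fin d → Flt p q // dom x}} (hu : hs u ≠ 0) {k : Fin d} {v : ℝ}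
    {ρ : Affine p q d 2} {v₀ : Flt p q} {i₀ : ℤ} (hρ : PathBase σ σ' δ u k v ρ v₀ i₀) :
    ∃ B : Block p q (m + 1) d, IsGradUnit σ σ' hs B u k v := by
  have hE := A.expRange_ge.2
  have hδ := P.hδ
  have hmin := eMin_eq q
  have hmax := eMax_eq q
  obtain ⟨I, hI⟩ := exists_indicator A C hd u m hlm
  obtain ⟨W, hW⟩ := exists_pathWeight A hδ hρ.le
  -- The gradient meets, in this order, the output weight a, the derivative of the gate, the gate
  -- weight 2^j and the derivative of the last path neuron; a and j are chosen for h*(u).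
  obtain ⟨a, ha, hγ⟩ := exists_normalizing_weight A hδ hu
  obtain ⟨j, hj1, hj2, hj⟩ := exists_scale_to_min A hδ hγ
  obtain ⟨w, b, ⟨y, z, hy, hz, hz', hz2⟩, hoff⟩ := P.gate j hj1 hj2
  have hjm : (2 : ℝ) ^ j ∈ finiteFloats p q := two_zpow_mem A hj1 (by omega)
  have hdm : (2 : ℝ) ^ (-δ) ∈ finiteFloats p q := two_zpow_mem A (by omega) (by omega)
  have hωm : (2 : ℝ) ^ (eMin q - p) ∈ finiteFloats p q := two_zpow_mem A le_rfl (by omega)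
  rw [round_of_mem A hjm] at hoff hy hj
  have h4 : (2 : ℝ) ^ δ ≤ 4 := by rcases hδ with h | h <;> rw [h] <;> norm_num
  have hmax4 : (4 : ℝ) ≤ maxFloat p q := by
    refine le_trans ?_ (two_zpow_eMax_le A)
    have : (2 : ℝ) ^ (2 : ℤ) ≤ 2 ^ eMax q := zpow_le_zpow_right₀ (by norm_num) (by omega)
    norm_num at this
    linarith
  have hha : ∀ x, IsFin ((ExtFlt.fin (hs x)) ⊗ₑ .fin a) := fun x => by
    refine isFin_mul_of_abs_le (le_trans ?_ P.bound)
    have h1 := hH x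
    exact mul_le_mul h1 ha (abs_nonneg _) ((abs_nonneg _).trans h1)
  have hza : ∀ z : Flt p q, |(z : ℝ)| * 2 ^ δ ≤ maxFloat p q →
      IsFin ((ExtFlt.fin a) ⊗ₑ .fin z) := fun z hz => by
    refine isFin_mul_of_abs_le (le_trans ?_ hz)
    rw [mul_comm]
    exact mul_le_mul_of_nonneg_left ha (abs_nonneg _)
  have hca : IsFin ((ExtFlt.fin a) ⊗ₑ .fin c) := by
    refine hza c (le_trans ?_ hmax4)
    have : (0 : ℝ) < 2 ^ δ := by positivity
    nlinarith
  refine ⟨Block.pair (gateTower I (chain ρ β W m) w ⟨_, hjm⟩ b) a, fun x t => ?_⟩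
  obtain ⟨yP, yQ, S⟩ := chain_state A C P hρ hW x m
  obtain ⟨hin1, hin2⟩ := S.inner (by omega)
  have hvT : ∀ i, IsFin (σ ((chain ρ β W m).eval σ (inp x) i)) ∧
      IsFin (σ' ((chain ρ β W m).eval σ (inp x) i)) := by
    refine Fin.forall_fin_two.2 ⟨?_, ?_⟩
    · rw [S.evalP]; exact ⟨C.val _, C.der _⟩
    · rw [S.evalQ]; exact ⟨C.val _, C.der _⟩
  obtain ⟨yI, DI, hI', hIu, hIn⟩ := hI.dead A C x isFin_zero (fun _ => rfl)
  have hIv : IsFin (σ yI) := by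
    by_cases hx : x = u
    · rw [hIu hx]; exact isFin_fin _
    · rw [hIn hx]; exact isFin_fin _
  have hIreg : I.Regular σ σ' (inp x) := DI.regular
  have hIe : I.eval σ (inp x) = fun _ => yI := DI.eval
  obtain ⟨hpr, hpe⟩ := Tower.eval_par A I (chain ρ β W m) (inp x) hIreg S.regular
  have hreg : (gateTower I (chain ρ β W m) w ⟨_, hjm⟩ b).Regular σ σ' (inp x) := by
    refine ⟨hpr, fun i => ?_⟩
    rw [hpe]
    refine Fin.addCases (fun i => ?_) (fun i => ?_) i
    · rw [Fin.append_left, hIe]; exact ⟨hIv, hI'⟩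
    · rw [Fin.append_right]; exact hvT i
  have hev := gateTower_eval (zI := σ yI) A hIreg S.regular (by rw [hIe]) (fun i => (hvT i).1) w
    ⟨_, hjm⟩ b
  obtain ⟨fa, hfa⟩ := hha x
  by_cases hx : x = u
  · rw [if_pos hx]
    have hal : x = u ∨ ¬ IsBdd σ := Or.inl hx
    have hyP := hin2 hal
    have hT : ∀ i, (chain ρ β W m).eval σ (inp x) i = .fin β := by
      refine Fin.forall_fin_two.2 ⟨?_, ?_⟩
      · rw [S.evalP, hyP]
      · rw [S.evalQ, hin1]
    have hev' : ∀ i, (gateTower I (chain ρ β W m) w ⟨_, hjm⟩ b).eval σ (inp x) i = .fin y := by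
      intro i
      rw [hev, hT, P.val, hIu hx, hy]
    obtain ⟨γ, hγ', hγ1, hγ2⟩ := hγ
    have hg : (ExtFlt.fin fa) ⊗ₑ .fin ⟨_, hdm⟩ = .fin γ := by
      rw [← hfa, hx, ← round_of_mem A hdm, hγ']
    have hγ0 : (0 : ℝ) < 2 ^ (eMin q - p) := by positivity
    have hγw : ∀ w : Flt p q, IsFin ((ExtFlt.fin γ) ⊗ₑ .fin w) := by
      intro w
      refine isFin_mul_of_abs_le ?_
      have h5 := abs_le_maxFloat A w.2
      rw [abs_of_nonneg (by linarith : (0 : ℝ) ≤ γ)]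
      have := abs_nonneg (w : ℝ)
      nlinarith
    obtain ⟨γζ, hγζ⟩ := hγw ⟨_, hjm⟩
    obtain ⟨γw, hγw⟩ := hγw w
    have hGl : ∀ i : Fin 1, (gateAffine w ⟨_, hjm⟩ b).grad
        (fun i : Fin 2 => .fin (if i = 0 then γ else fneg γ)) (Fin.castAdd 2 i) = 0 := by
      intro i
      rw [gateAffine_grad_left _ _ _ _ A]
      change (ExtFlt.fin γ) ⊗ₑ .fin w ⊕ₑ (.fin (fneg γ) ⊗ₑ .fin w) = 0
      rw [fneg_mul A hγw, hγw, add_fneg A]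
    have hGr : ∀ i : Fin 2, (gateAffine w ⟨_, hjm⟩ b).grad
        (fun i : Fin 2 => .fin (if i = 0 then γ else fneg γ)) (Fin.natAdd 1 i) =
        .fin (if i = 0 then γζ else fneg γζ) := by
      intro i
      rw [gateAffine_grad_right A _ _ _ (fun i => isFin_fin _)]
      revert i
      exact Fin.forall_fin_two.2 ⟨hγζ, fneg_mul A hγζ⟩
    have hG : (fun i => (gateAffine w ⟨_, hjm⟩ b).grad
        (fun i : Fin 2 => .fin (if i = 0 then γ else fneg γ)) i ⊗ₑ
        σ' ((I.par (chain ρ β W m)).eval σ (inp x) i)) =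
        Fin.append (fun _ : Fin 1 => 0)
          (fun i : Fin 2 => .fin (if i = 0 then ⟨_, hωm⟩ else fneg ⟨_, hωm⟩)) := by
      have h5 : (ExtFlt.fin γζ) ⊗ₑ .fin ⟨_, hdm⟩ = .fin ⟨_, hωm⟩ := by
        rw [← hγζ, ← hγ', ← round_of_mem A hdm, hj, round_of_mem A hωm]
      refine eq_append (fun i => ?_) (fun i => ?_)
      · rw [hGl, hpe, Fin.append_left, hIe, zero_mul_fin A hI']
      · rw [hGr, hpe, Fin.append_right, hT, P.der, round_of_mem A hdm]
        revert i
        exact Fin.forall_fin_two.2 ⟨h5, fneg_mul A h5⟩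
    obtain ⟨h6, h7⟩ := Tower.gradFrom_zero A I (inp x) hIreg (fun _ => 0) (fun _ => rfl) t
    obtain ⟨h8, h9⟩ := chain_grad A C P hρ hW m
      (fun i : Fin 2 => .fin (if i = 0 then ⟨_, hωm⟩ else fneg ⟨_, hωm⟩)) (by
        rw [pathExp_of_le A (by have := hρ.le'; omega) hm, round_of_mem A hωm]; rfl)
      (isFin_fin _) t
    rw [← hx] at h8 h9
    obtain ⟨h10, h11⟩ := Tower.grad_par A I (chain ρ β W m) (inp x) hIreg S.regular _ _ h6 h8 t
    refine Block.pair_run A hreg (fun i => by rw [hev', hz])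
      (fun i => by rw [hev', hz', round_of_mem A hdm]) hfa hg (hza z hz2)
      ⟨fun i => isFin_fin _, fun i => ?_, Eq.mpr (congrArg _ hG) h10⟩ ?_
    · refine Fin.addCases (fun i => ?_) (fun i => ?_) i
      · rw [hGl]; exact isFin_zero
      · rw [hGr]; exact isFin_fin _
    · refine (congrArg (fun g => (I.par (chain ρ β W m)).gradFrom σ σ' t (inp x) g) hG).trans ?_
      rw [h11, h7, h9]
  · rw [if_neg hx]
    have hlow : ∀ i, Low ((gateTower I (chain ρ β W m) w ⟨_, hjm⟩ b).eval σ (inp x) i) := by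
      intro i
      rw [hev, hIn hx]
      have h5 : ∃ z : Flt p q, σ ((chain ρ β W m).eval σ (inp x) i) = .fin z ∧
          (z = s ∨ (IsBdd σ ∧ |(z : ℝ)| ≤ 1)) := by
        -- Q is always at β, and so is P if σ is unbounded; a bounded σ gives P some value in [-1,
        -- 1]. These are the alternatives that the gate condition of `PathAct` admits.
        revert i
        refine Fin.forall_fin_two.2 ⟨?_, ?_⟩
        · rw [S.evalP]
          by_cases hb : IsBdd σ
          · obtain ⟨f, h6, h7, h8⟩ := hb yP
            exact ⟨f, h6, Or.inr ⟨hb, abs_le.2 ⟨h7, h8⟩⟩⟩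
          · rw [hin2 (Or.inr hb)]
            exact ⟨s, P.val, Or.inl rfl⟩
        · rw [S.evalQ, hin1]
          exact ⟨s, P.val, Or.inl rfl⟩
      obtain ⟨z', h6, h7⟩ := h5
      rw [h6]
      exact hoff z' h7
    have hg : ∀ i : Fin 2, (ExtFlt.fin (if i = 0 then 0 else fneg 0) : ExtFlt p q) = 0 := by
      refine Fin.forall_fin_two.2 ⟨rfl, ?_⟩
      exact congrArg ExtFlt.fin (Subtype.ext neg_zero)
    obtain ⟨h5, h6⟩ := Tower.gradFrom_zero A _ _ hreg _ hg t
    exact Block.pair_run A hreg (fun i => (C.low _ (hlow i)).1) (fun i => (C.low _ (hlow i)).2)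
      hfa (mul_zero_fin A (isFin_fin _)) hca h5 h6

end Gate

end FloatNet

namespace FloatNet

open Filter Topology

/-! ### The real activation functions and their tails -/

section RealFunctions

/-- A smooth function that increases from `0` to `1`, with exponentially small tails. -/
structure SmoothStep (Ψ : ℝ → ℝ) : Prop where
  diff : Differentiable ℝ Ψ
  symm : ∀ y, Ψ (-y) = 1 - Ψ y
  deriv_nonneg : ∀ y, 0 ≤ deriv Ψ y
  deriv_le : ∀ y, 0 ≤ y → deriv Ψ y ≤ Real.exp (-y)
  lim : Tendsto Ψ atTop (𝓝 1)

namespace SmoothStep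

variable {Ψ : ℝ → ℝ} (h : SmoothStep Ψ)

include h

theorem zero : Ψ 0 = 1 / 2 := by
  have := h.symm 0
  rw [neg_zero] at this
  linarith

theorem mono : Monotone Ψ := monotone_of_deriv_nonneg h.diff h.deriv_nonneg

theorem le_one (y : ℝ) : Ψ y ≤ 1 := h.mono.ge_of_tendsto h.lim y

theorem nonneg (y : ℝ) : 0 ≤ Ψ y := by
  have := h.le_one (-y)
  rw [h.symm] at this
  linarith

theorem half_le {y : ℝ} (hy : 0 ≤ y) : 1 / 2 ≤ Ψ y := h.zero ▸ h.mono hy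

/-- The bound on Ψ' makes Ψ(y) + e^(-y) decreasing. Comparison with its limit 1 gives the tail
estimate `one_sub_le`, comparison with its value at 0 the growth estimate `lt_add`. -/
theorem antitone_add_exp : AntitoneOn (fun y => Ψ y + Real.exp (-y)) (Set.Ici 0) := by
  have hd : ∀ y, HasDerivAt (fun y => Ψ y + Real.exp (-y)) (deriv Ψ y + Real.exp (-y) * -1) y :=
    fun y => (h.diff y).hasDerivAt.add (hasDerivAt_neg y).exp
  refine antitoneOn_of_deriv_nonpos (convex_Ici 0)
    (fun y _ => (hd y).continuousAt.continuousWithinAt)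
    (fun y _ => (hd y).differentiableAt.differentiableWithinAt) fun y hy => ?_
  rw [interior_Ici, Set.mem_Ioi] at hy
  rw [(hd y).deriv]
  have := h.deriv_le y hy.le
  linarith

theorem one_sub_le {y : ℝ} (hy : 0 ≤ y) : 1 - Ψ y ≤ Real.exp (-y) := by
  have hl : Tendsto (fun y => Ψ y + Real.exp (-y)) atTop (𝓝 (1 + 0)) :=
    h.lim.add (Real.tendsto_exp_neg_atTop_nhds_zero)
  have : 1 + 0 ≤ Ψ y + Real.exp (-y) := by
    refine le_of_tendsto hl ?_
    filter_upwards [eventually_ge_atTop y] with z hz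
    exact h.antitone_add_exp hy (Set.mem_Ici.2 (hy.trans hz)) hz
  linarith

theorem lt_add {y : ℝ} (hy : 0 < y) : Ψ y < 1 / 2 + y := by
  have h1 := h.antitone_add_exp (Set.mem_Ici.2 le_rfl) (Set.mem_Ici.2 hy.le) hy.le
  simp only [h.zero, neg_zero, Real.exp_zero] at h1
  have h2 := Real.add_one_lt_exp (neg_ne_zero.2 hy.ne')
  linarith

theorem deriv_symm (y : ℝ) : deriv Ψ (-y) = deriv Ψ y := by
  have h1 : HasDerivAt (fun z => Ψ (-z)) (deriv Ψ (-y) * -1) y :=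
    (h.diff (-y)).hasDerivAt.comp y (hasDerivAt_neg y)
  have h2 : HasDerivAt (fun z => Ψ (-z)) (-deriv Ψ y) y := by
    have : (fun z => Ψ (-z)) = fun z => 1 - Ψ z := funext h.symm
    rw [this]
    exact (h.diff y).hasDerivAt.const_sub 1
  have := h1.unique h2
  linarith

end SmoothStep

theorem two_mul_le_exp (t : ℝ) (ht : 0 ≤ t) : 2 * t ≤ Real.exp t := by
  have := Real.quadratic_le_exp_of_nonneg ht
  nlinarith [sq_nonneg (t - 1)]

/-- Functions that are close to the identity for large arguments, and close to `c` for small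
ones. -/
structure Ramp (f : ℝ → ℝ) (c : ℝ) : Prop where
  nonneg : ∀ y, 0 ≤ y → y / 2 ≤ f y ∧ f y ≤ y
  nonpos : ∀ y, y ≤ 0 → -1 ≤ f y ∧ f y ≤ 0
  top : ∀ y, 4 ≤ y → |f y - y| ≤ Real.exp (-y / 2)
  bot : ∀ y, y ≤ -4 → |f y - c| ≤ Real.exp (y / 2)
  diff : ∀ y, y ≠ 0 → DifferentiableAt ℝ f y
  dtop : ∀ y, 4 ≤ y → |deriv f y - 1| ≤ Real.exp (-y / 2)
  dbot : ∀ y, y ≤ -4 → |deriv f y| ≤ Real.exp (y / 2)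

section MulStep

variable {Ψ : ℝ → ℝ} (h : SmoothStep Ψ)

include h

theorem SmoothStep.hasDerivAt_mul (y : ℝ) :
    HasDerivAt (fun y => y * Ψ y) (Ψ y + y * deriv Ψ y) y := by
  refine HasDerivAt.congr_deriv ((hasDerivAt_id y).fun_mul (h.diff y).hasDerivAt) ?_
  rw [one_mul]; rfl

theorem SmoothStep.mul_top {y : ℝ} (hy : 4 ≤ y) :
    |y * Ψ y - y| ≤ Real.exp (-y / 2) ∧ |Ψ y + y * deriv Ψ y - 1| ≤ Real.exp (-y / 2) := by
  have h0 : Real.exp (-y) = Real.exp (-y / 2) * Real.exp (-y / 2) := by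
    rw [← Real.exp_add]; congr 1; ring
  -- All errors are at most (1+y)e^(-y), and 1 + y ≤ e^(y/2) by the quadratic bound 1 + y/2 + y²/8,
  -- precisely from y = 4 on.
  have h1 : (1 + y) * Real.exp (-y) ≤ Real.exp (-y / 2) := by
    have h2 := Real.quadratic_le_exp_of_nonneg (show 0 ≤ y / 2 by linarith)
    have h3 : Real.exp (y / 2) * Real.exp (-y / 2) = 1 := by
      rw [← Real.exp_add, ← Real.exp_zero]; congr 1; ring
    have h4 : 1 + y ≤ Real.exp (y / 2) := by nlinarith
    rw [h0, ← mul_assoc]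
    have h5 := Real.exp_pos (-y / 2)
    calc (1 + y) * Real.exp (-y / 2) * Real.exp (-y / 2)
        ≤ Real.exp (y / 2) * Real.exp (-y / 2) * Real.exp (-y / 2) := by gcongr
      _ = _ := by rw [h3, one_mul]
  have h2 := h.one_sub_le (show 0 ≤ y by linarith)
  have h3 := h.le_one y
  have h4 := h.deriv_le y (by linarith)
  have h5 := h.deriv_nonneg y
  have h6 : y * deriv Ψ y ≤ y * Real.exp (-y) := mul_le_mul_of_nonneg_left h4 (by linarith)
  have h7 : y * (1 - Ψ y) ≤ y * Real.exp (-y) := mul_le_mul_of_nonneg_left h2 (by linarith)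
  have h8 : 0 ≤ y * deriv Ψ y := mul_nonneg (by linarith) h5
  have h9 : 0 ≤ y * (1 - Ψ y) := mul_nonneg (by linarith) (by linarith)
  have h10 := Real.exp_pos (-y)
  have h11 : 0 ≤ y * Real.exp (-y) := mul_nonneg (by linarith) h10.le
  constructor <;> rw [abs_le] <;> constructor <;> nlinarith

theorem SmoothStep.ramp : Ramp (fun y => y * Ψ y) 0 := by
  have hd : ∀ y, deriv (fun y => y * Ψ y) y = Ψ y + y * deriv Ψ y := fun y =>
    (h.hasDerivAt_mul y).deriv
  refine ⟨fun y hy => ?_, fun y hy => ?_, fun y hy => (h.mul_top hy).1, fun y hy => ?_,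
    fun y _ => (h.hasDerivAt_mul y).differentiableAt, fun y hy => ?_, fun y hy => ?_⟩
  · have h1 := h.half_le hy
    have h2 := h.le_one y
    constructor <;> nlinarith
  · have h1 := h.nonneg y
    have h2 := h.one_sub_le (neg_nonneg.2 hy)
    rw [h.symm, neg_neg] at h2
    have h3 := two_mul_le_exp (-y) (by linarith)
    have h4 : Real.exp (-y) * Real.exp y = 1 := by
      rw [← Real.exp_add, ← Real.exp_zero]; congr 1; ring
    have h5 := Real.exp_pos y
    have h6 : -y * Real.exp y ≤ 1 := by nlinarith
    have h7 : -y * Ψ y ≤ -y * Real.exp y := mul_le_mul_of_nonneg_left (by linarith) (by linarith)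
    have h8 : 0 ≤ -y * Ψ y := mul_nonneg (by linarith) h1
    constructor <;> linarith
  · have h1 := (h.mul_top (y := -y) (by linarith)).1
    rw [h.symm, neg_neg, show -y * (1 - Ψ y) - -y = y * Ψ y - 0 by ring] at h1
    exact h1
  · rw [hd]; exact (h.mul_top hy).2
  · have h1 := (h.mul_top (y := -y) (by linarith)).2
    rw [h.symm, h.deriv_symm, neg_neg,
      show 1 - Ψ y + -y * deriv Ψ y - 1 = -(Ψ y + y * deriv Ψ y) by ring, abs_neg] at h1
    rw [hd]; exact h1

theorem SmoothStep.mul_lt {y : ℝ} (hy : 0 < y) : y * Ψ y < y / 2 + y ^ 2 := by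
  have := h.lt_add hy
  nlinarith

theorem SmoothStep.abs_deriv_mul_le {y : ℝ} (hy : 0 ≤ y) : |deriv (fun y => y * Ψ y) y| ≤ 2 := by
  rw [(h.hasDerivAt_mul y).deriv]
  have h1 := h.nonneg y
  have h2 := h.le_one y
  have h3 := h.deriv_nonneg y
  have h4 := h.deriv_le y hy
  have h5 : 0 ≤ y * deriv Ψ y := mul_nonneg hy h3
  have h6 : y * deriv Ψ y ≤ y * Real.exp (-y) := mul_le_mul_of_nonneg_left h4 hy
  have h7 : y * Real.exp (-y) ≤ 1 := by
    have h8 := two_mul_le_exp y hy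
    have h9 : Real.exp y * Real.exp (-y) = 1 := by
      rw [← Real.exp_add, ← Real.exp_zero]; congr 1; ring
    have := Real.exp_pos (-y)
    nlinarith
  rw [abs_le]
  constructor <;> linarith

end MulStep

theorem hasDerivAt_sigmoid (y : ℝ) : HasDerivAt (fun y => 1 / (1 + Real.exp (-y)))
    (Real.exp (-y) / (1 + Real.exp (-y)) ^ 2) y := by
  have h1 : HasDerivAt (fun y => 1 + Real.exp (-y)) (Real.exp (-y) * -1) y :=
    (hasDerivAt_neg y).exp.const_add 1
  simp only [one_div]
  refine (h1.fun_inv (by positivity)).congr_deriv ?_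
  ring

theorem smoothStep_sigmoid : SmoothStep fun y => 1 / (1 + Real.exp (-y)) := by
  refine ⟨fun y => (hasDerivAt_sigmoid y).differentiableAt, fun y => ?_, fun y => ?_,
    fun y _ => ?_, ?_⟩
  · have h1 : Real.exp (-y) * Real.exp y = 1 := by
      rw [← Real.exp_add, ← Real.exp_zero]; congr 1; ring
    have := Real.exp_pos y
    have := Real.exp_pos (-y)
    rw [neg_neg]
    field_simp
    nlinarith
  · rw [(hasDerivAt_sigmoid y).deriv]; positivity
  · rw [(hasDerivAt_sigmoid y).deriv]
    have := Real.exp_pos (-y)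
    refine div_le_self this.le ?_
    nlinarith
  · have h1 : Tendsto (fun y => 1 / (1 + Real.exp (-y))) atTop (𝓝 (1 / (1 + 0))) :=
      Tendsto.div tendsto_const_nhds (Real.tendsto_exp_neg_atTop_nhds_zero.const_add 1) (by norm_num)
    simpa using h1

theorem hasDerivAt_erf (x : ℝ) : HasDerivAt erf (2 / √Real.pi * Real.exp (-x ^ 2)) x := by
  have hc : Continuous fun t : ℝ => Real.exp (-t ^ 2) := by fun_prop
  exact (intervalIntegral.integral_hasDerivAt_right (hc.intervalIntegrable _ _)
    (hc.stronglyMeasurableAtFilter _ _) hc.continuousAt).const_mul _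

theorem erf_neg (x : ℝ) : erf (-x) = -erf x := by
  unfold erf
  have h := intervalIntegral.integral_comp_neg (a := 0) (b := x) fun t => Real.exp (-t ^ 2)
  simp only [neg_sq, neg_zero] at h
  rw [h, intervalIntegral.integral_symm]
  ring

theorem tendsto_erf : Tendsto erf atTop (𝓝 1) := by
  have h1 := integral_gaussian_Ioi 1
  have h2 := MeasureTheory.intervalIntegral_tendsto_integral_Ioi (μ := MeasureTheory.volume) 0
    ((integrable_exp_neg_mul_sq (b := 1) one_pos).integrableOn) tendsto_id
  rw [h1] at h2
  have h3 := h2.const_mul (2 / √Real.pi)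
  have h4 : 0 < √Real.pi := Real.sqrt_pos.2 Real.pi_pos
  simp only [div_one, neg_mul, one_mul, id] at h3
  rw [show 2 / √Real.pi * (√Real.pi / 2) = 1 by field_simp] at h3
  exact h3

theorem hasDerivAt_gaussianStep (y : ℝ) : HasDerivAt (fun y => 1 / 2 * (1 + erf (y / √2)))
    (1 / √(2 * Real.pi) * Real.exp (-y ^ 2 / 2)) y := by
  have h1 := ((hasDerivAt_erf (y / √2)).comp y ((hasDerivAt_id y).div_const (√2))).const_add 1
  refine (h1.const_mul (1 / 2)).congr_deriv ?_
  rw [Real.sqrt_mul (by norm_num), div_pow, Real.sq_sqrt (by norm_num), neg_div]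
  field_simp

theorem smoothStep_gaussian : SmoothStep fun y => 1 / 2 * (1 + erf (y / √2)) := by
  refine ⟨fun y => (hasDerivAt_gaussianStep y).differentiableAt, fun y => ?_, fun y => ?_,
    fun y _ => ?_, ?_⟩
  · rw [neg_div, erf_neg]; ring
  · rw [(hasDerivAt_gaussianStep y).deriv]; positivity
  · rw [(hasDerivAt_gaussianStep y).deriv]
    -- The density is at most e^(-y) because -y²/2 ≤ 1/2 - y and e ≤ 2π.
    have h1 : Real.exp (1 / 2) ≤ √(2 * Real.pi) := by
      refine Real.le_sqrt_of_sq_le ?_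
      rw [← Real.exp_nat_mul]
      norm_num
      have := Real.exp_one_lt_d9
      have := Real.pi_gt_three
      linarith
    have h2 : Real.exp (-y ^ 2 / 2) ≤ Real.exp (1 / 2) * Real.exp (-y) := by
      rw [← Real.exp_add]
      refine Real.exp_le_exp.2 ?_
      nlinarith [sq_nonneg (y - 1)]
    have h3 : 0 < √(2 * Real.pi) := Real.sqrt_pos.2 (by positivity)
    rw [one_div, inv_mul_le_iff₀ h3]
    exact h2.trans (mul_le_mul_of_nonneg_right h1 (Real.exp_pos _).le)
  · have h1 : Tendsto (fun y : ℝ => y / √2) atTop atTop :=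
      tendsto_id.atTop_div_const (Real.sqrt_pos.2 (by norm_num))
    have h2 := ((tendsto_erf.comp h1).const_add 1).const_mul (1 / 2)
    norm_num at h2
    simpa [Function.comp_def] using h2

theorem gelu_eq : Activation.gelu.real = fun y => y * (1 / 2 * (1 + erf (y / √2))) := by
  funext y
  simp only [Activation.real]
  ring

theorem swish_eq : Activation.swish.real = fun y => y * (1 / (1 + Real.exp (-y))) := by
  funext y
  simp only [Activation.real]
  ring

theorem ramp_relu : Ramp Activation.relu.real 0 := by
  have h1 : ∀ y, 0 < y → Activation.relu.real =ᶠ[𝓝 y] id := fun y hy => by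
    filter_upwards [lt_mem_nhds hy] with z hz
    exact max_eq_right hz.le
  have h2 : ∀ y, y < 0 → Activation.relu.real =ᶠ[𝓝 y] fun _ => 0 := fun y hy => by
    filter_upwards [gt_mem_nhds hy] with z hz
    exact max_eq_left hz.le
  have h3 : ∀ y, 0 ≤ y → Activation.relu.real y = y := fun y hy => max_eq_right hy
  have h4 : ∀ y, y ≤ 0 → Activation.relu.real y = 0 := fun y hy => max_eq_left hy
  refine ⟨fun y hy => ?_, fun y hy => ?_, fun y hy => ?_, fun y hy => ?_, fun y hy => ?_,
    fun y hy => ?_, fun y hy => ?_⟩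
  · rw [h3 y hy]; constructor <;> linarith
  · rw [h4 y hy]; norm_num
  · rw [h3 y (by linarith), sub_self, abs_zero]; positivity
  · rw [h4 y (by linarith), sub_self, abs_zero]; positivity
  · rcases lt_or_gt_of_ne hy with hy | hy
    · exact (differentiableAt_const 0).congr_of_eventuallyEq (h2 y hy)
    · exact differentiableAt_id.congr_of_eventuallyEq (h1 y hy)
  · rw [(h1 y (by linarith)).deriv_eq, deriv_id, sub_self, abs_zero]; positivity
  · rw [(h2 y (by linarith)).deriv_eq, deriv_const, abs_zero]; positivity

theorem deriv_relu {y : ℝ} (hy : 0 < y) : deriv Activation.relu.real y = 1 := by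
  have h1 : Activation.relu.real =ᶠ[𝓝 y] id := by
    filter_upwards [lt_mem_nhds hy] with z hz
    exact max_eq_right hz.le
  rw [h1.deriv_eq, deriv_id]

theorem elu_eventuallyEq {y : ℝ} (hy : 0 < y) : Activation.elu.real =ᶠ[𝓝 y] id := by
  filter_upwards [lt_mem_nhds hy] with z hz
  exact if_pos hz.le

theorem ramp_elu : Ramp Activation.elu.real (-1) := by
  have h2 : ∀ y, y < 0 → Activation.elu.real =ᶠ[𝓝 y] fun y => Real.exp y - 1 := fun y hy => by
    filter_upwards [gt_mem_nhds hy] with z hz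
    exact if_neg (not_le.2 hz)
  have h3 : ∀ y, 0 ≤ y → Activation.elu.real y = y := fun y hy => if_pos hy
  have h4 : ∀ y, y < 0 → Activation.elu.real y = Real.exp y - 1 := fun y hy =>
    if_neg (not_le.2 hy)
  have h5 : ∀ y, HasDerivAt (fun y => Real.exp y - 1) (Real.exp y) y := fun y =>
    (Real.hasDerivAt_exp y).sub_const 1
  refine ⟨fun y hy => ?_, fun y hy => ?_, fun y hy => ?_, fun y hy => ?_, fun y hy => ?_,
    fun y hy => ?_, fun y hy => ?_⟩
  · rw [h3 y hy]; constructor <;> linarith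
  · rcases hy.lt_or_eq with hy | rfl
    · rw [h4 y hy]
      have := Real.exp_pos y
      have := Real.exp_lt_one_iff.2 hy
      constructor <;> linarith
    · rw [h3 0 le_rfl]; norm_num
  · rw [h3 y (by linarith), sub_self, abs_zero]; positivity
  · rw [h4 y (by linarith), sub_neg_eq_add, sub_add_cancel, abs_of_pos (Real.exp_pos _)]
    exact Real.exp_le_exp.2 (by linarith)
  · rcases lt_or_gt_of_ne hy with hy | hy
    · exact (h5 y).differentiableAt.congr_of_eventuallyEq (h2 y hy)
    · exact differentiableAt_id.congr_of_eventuallyEq (elu_eventuallyEq hy)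
  · rw [(elu_eventuallyEq (by linarith)).deriv_eq, deriv_id, sub_self, abs_zero]; positivity
  · rw [(h2 y (by linarith)).deriv_eq, (h5 y).deriv, abs_of_pos (Real.exp_pos _)]
    exact Real.exp_le_exp.2 (by linarith)

/-- Bounded functions that increase from `c` to `1`. -/
structure Squash (f : ℝ → ℝ) (c s : ℝ) (δ : ℤ) : Prop where
  mono : Monotone f
  bounds : ∀ y, c ≤ f y ∧ f y ≤ 1
  zero : f 0 = s
  diff : Differentiable ℝ f
  deriv_zero : deriv f 0 = 2 ^ (-δ)
  deriv_bounds : ∀ y, 0 ≤ deriv f y ∧ deriv f y ≤ 1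
  top : ∀ y, 4 ≤ y → |f y - 1| ≤ Real.exp (-y / 2)
  bot : ∀ y, y ≤ -4 → |f y - c| ≤ Real.exp (y / 2)
  dtop : ∀ y, 4 ≤ y → |deriv f y| ≤ Real.exp (-y / 2)
  dbot : ∀ y, y ≤ -4 → |deriv f y| ≤ Real.exp (y / 2)

theorem SmoothStep.squash {Ψ : ℝ → ℝ} (h : SmoothStep Ψ) {δ : ℤ} (h0 : deriv Ψ 0 = 2 ^ (-δ)) :
    Squash Ψ 0 (1 / 2) δ := by
  have ht : ∀ y, 4 ≤ y → Real.exp (-y) ≤ Real.exp (-y / 2) := fun y hy =>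
    Real.exp_le_exp.2 (by linarith)
  have h1 : ∀ y, 4 ≤ y → |Ψ y - 1| ≤ Real.exp (-y / 2) := fun y hy => by
    rw [abs_sub_comm, abs_of_nonneg (by linarith [h.le_one y])]
    exact (h.one_sub_le (by linarith)).trans (ht y hy)
  have h2 : ∀ y, 4 ≤ y → |deriv Ψ y| ≤ Real.exp (-y / 2) := fun y hy => by
    rw [abs_of_nonneg (h.deriv_nonneg y)]
    exact (h.deriv_le y (by linarith)).trans (ht y hy)
  refine ⟨h.mono, fun y => ⟨h.nonneg y, h.le_one y⟩, h.zero, h.diff, h0, fun y =>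
    ⟨h.deriv_nonneg y, ?_⟩, h1, fun y hy => ?_, h2, fun y hy => ?_⟩
  · have h3 : ∀ y, 0 ≤ y → deriv Ψ y ≤ 1 := fun y hy =>
      (h.deriv_le y hy).trans (Real.exp_le_one_iff.2 (by linarith))
    rcases le_total 0 y with hy | hy
    · exact h3 y hy
    · rw [← h.deriv_symm]; exact h3 _ (by linarith)
  · have h3 := h1 (-y) (by linarith)
    rw [h.symm, neg_neg, show 1 - Ψ y - 1 = -(Ψ y - 0) by ring, abs_neg] at h3
    exact h3
  · have h3 := h2 (-y) (by linarith)
    rwa [h.deriv_symm, neg_neg] at h3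

theorem squash_sigmoid : Squash Activation.sigmoid.real 0 (1 / 2) 2 := by
  refine smoothStep_sigmoid.squash ?_
  rw [(hasDerivAt_sigmoid 0).deriv]
  norm_num

theorem tanh_eq (y : ℝ) : Activation.tanh.real y = 2 * (1 / (1 + Real.exp (-(2 * y)))) - 1 := by
  simp only [Activation.real]
  rw [Real.tanh_eq_sinh_div_cosh, Real.sinh_eq, Real.cosh_eq]
  have h1 := Real.exp_pos y
  have h2 := Real.exp_pos (-y)
  have h3 : Real.exp (-(2 * y)) = Real.exp (-y) * Real.exp (-y) := by
    rw [← Real.exp_add]; congr 1; ring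
  have h4 : Real.exp y * Real.exp (-y) = 1 := by
    rw [← Real.exp_add, ← Real.exp_zero]; congr 1; ring
  rw [h3, div_div_div_cancel_right₀ (by norm_num), div_eq_iff (by positivity)]
  field_simp
  nlinarith

/-- Everything is transported from the sigmoid Ψ by tanh y = 2Ψ(2y) - 1; the extra factor 4 in the
derivative is absorbed by the decay e^(-2y) for y ≥ 4. -/
theorem squash_tanh : Squash Activation.tanh.real (-1) 0 0 := by
  obtain ⟨Ψ, hΨ⟩ : ∃ Ψ : ℝ → ℝ, Ψ = fun y => 1 / (1 + Real.exp (-y)) := ⟨_, rfl⟩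
  have h : SmoothStep Ψ := hΨ ▸ smoothStep_sigmoid
  have he : Activation.tanh.real = fun y => 2 * Ψ (2 * y) - 1 := by
    funext y; rw [tanh_eq, hΨ]
  have hd : ∀ y, HasDerivAt (fun y => 2 * Ψ (2 * y) - 1) (4 * deriv Ψ (2 * y)) y := fun y => by
    have h1 := (((h.diff (2 * y)).hasDerivAt.comp y ((hasDerivAt_id y).const_mul 2)).const_mul
      2).sub_const 1
    refine h1.congr_deriv ?_
    ring
  have h4 : ∀ y, deriv Ψ y ≤ 1 / 4 := fun y => by
    rw [hΨ, (hasDerivAt_sigmoid y).deriv, div_le_div_iff₀ (by positivity) (by norm_num)]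
    nlinarith [sq_nonneg (1 - Real.exp (-y))]
  have ht : ∀ y, 4 ≤ y → 4 * Real.exp (-(2 * y)) ≤ Real.exp (-y / 2) := fun y hy => by
    have h5 : Real.exp (-(2 * y)) = Real.exp (-y / 2) * Real.exp (-(3 * y / 2)) := by
      rw [← Real.exp_add]; congr 1; ring
    have h6 : Real.exp (-(3 * y / 2)) * Real.exp (3 * y / 2) = 1 := by
      rw [← Real.exp_add, ← Real.exp_zero]; congr 1; ring
    have h7 := Real.add_one_le_exp (3 * y / 2)
    have h8 := Real.exp_pos (-y / 2)
    have h9 := Real.exp_pos (-(3 * y / 2))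
    have h10 : 4 * Real.exp (-(3 * y / 2)) ≤ 1 := by nlinarith
    rw [h5]
    nlinarith
  have h1 : ∀ y, 4 ≤ y → |2 * Ψ (2 * y) - 1 - 1| ≤ Real.exp (-y / 2) := fun y hy => by
    have h5 := h.one_sub_le (y := 2 * y) (by linarith)
    have h6 := h.le_one (2 * y)
    have h7 := Real.exp_pos (-(2 * y))
    refine le_trans ?_ (ht y hy)
    rw [abs_le]
    constructor <;> linarith
  have h2 : ∀ y, 4 ≤ y → |4 * deriv Ψ (2 * y)| ≤ Real.exp (-y / 2) := fun y hy => by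
    have h5 := h.deriv_nonneg (2 * y)
    rw [abs_of_nonneg (by linarith)]
    exact le_trans (by linarith [h.deriv_le (2 * y) (by linarith)]) (ht y hy)
  rw [he]
  refine ⟨fun y z hyz => ?_, fun y => ?_, ?_, fun y => (hd y).differentiableAt, ?_, fun y => ?_, h1,
    fun y hy => ?_, fun y hy => ?_, fun y hy => ?_⟩
  · have := h.mono (show 2 * y ≤ 2 * z by linarith)
    linarith
  · have := h.le_one (2 * y)
    have := h.nonneg (2 * y)
    constructor <;> linarith
  · rw [mul_zero, h.zero]; norm_num
  · rw [(hd 0).deriv, hΨ, mul_zero, (hasDerivAt_sigmoid 0).deriv]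
    norm_num
  · rw [(hd y).deriv]
    have := h.deriv_nonneg (2 * y)
    have := h4 (2 * y)
    constructor <;> linarith
  · have h5 := h1 (-y) (by linarith)
    rw [mul_neg, h.symm, neg_neg,
      show 2 * (1 - Ψ (2 * y)) - 1 - 1 = -(2 * Ψ (2 * y) - 1 - -1) by ring, abs_neg] at h5
    exact h5
  · rw [(hd y).deriv]; exact h2 y hy
  · have h5 := h2 (-y) (by linarith)
    rw [mul_neg, h.deriv_symm, neg_neg] at h5
    rw [(hd y).deriv]; exact h5

theorem lt_sigmoid {y : ℝ} (hy : 0 < y) (hy' : y < 2) :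
    1 / 2 + y / 8 < Activation.sigmoid.real y := by
  simp only [Activation.real]
  have h1 := Real.add_one_le_exp y
  have h2 : Real.exp (-y) * Real.exp y = 1 := by
    rw [← Real.exp_add, ← Real.exp_zero]; congr 1; ring
  have h3 := Real.exp_pos (-y)
  have h4 : Real.exp (-y) * (1 + y) ≤ 1 := by nlinarith
  rw [lt_div_iff₀ (by positivity)]
  -- Since e^(-y)(1+y) ≤ 1, the claim follows from (4+y)(2+y) < 8(1+y), which says y < 2.
  have h5 : (4 + y) * (1 + Real.exp (-y)) * (1 + y) < 8 * (1 + y) := by nlinarith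
  have h6 := lt_of_mul_lt_mul_right h5 (by linarith)
  linarith

theorem lt_tanh {y : ℝ} (hy : 0 < y) (hy' : y < 1) : y / 2 < Activation.tanh.real y := by
  have h1 := lt_sigmoid (y := 2 * y) (by linarith) (by linarith)
  simp only [Activation.real] at h1
  rw [tanh_eq]
  linarith

end RealFunctions

end FloatNet

namespace FloatNet

open Filter Topology

/-! ### Exact saturation after rounding -/

section Tails

variable {p q : ℕ}

theorem roundLimit_eq {f : ℝ → ℝ} {l : Filter ℝ} [l.NeBot] {c : ℝ} (h : Tendsto f l (𝓝 c)) :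
    roundLimit p q f l = round p q c := by
  have h1 : ∃ c : ℝ, Tendsto f l (𝓝 c) := ⟨c, h⟩
  unfold roundLimit
  rw [dif_pos h1, tendsto_nhds_unique h1.choose_spec h]

/-- The threshold 2^(q+1) is made for this: y/2 ≥ 2^q = 2E gives e^(-y/2) ≤ 2^(-2E), below half the
smallest float because E + p ≤ 3E/2. -/
theorem exp_neg_lt (A : Adm p q) {y : ℝ} (hy : satur q ≤ y) :
    Real.exp (-y / 2) < 2 ^ (eMin q - p - 1) := by
  have hE := A.expRange_ge
  have hp := A.two_mul_le
  have hq := A.hq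
  have h1 : (2 : ℝ) ^ (2 ^ q) ≤ Real.exp ((2 ^ q : ℕ) : ℝ) := by
    rw [← Real.exp_one_pow]
    refine pow_le_pow_left₀ (by norm_num) ?_ _
    have := Real.add_one_le_exp 1
    linarith
  have h2 : ((2 ^ q : ℕ) : ℝ) ≤ y / 2 := by
    have h3 : satur q = 2 * ((2 ^ q : ℕ) : ℝ) := by
      unfold satur
      rw [zpow_add_one₀ (by norm_num), zpow_natCast]
      push_cast; ring
    linarith
  have h3 : Real.exp (-y / 2) ≤ ((2 : ℝ) ^ (2 ^ q))⁻¹ := by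
    rw [neg_div, Real.exp_neg]
    exact inv_anti₀ (by positivity) (h1.trans (Real.exp_le_exp.2 h2))
  refine h3.trans_lt ?_
  rw [← zpow_natCast, ← zpow_neg]
  refine zpow_lt_zpow_right₀ (by norm_num) ?_
  have h4 : ((2 ^ q : ℕ) : ℤ) = 2 * expRange q := by
    unfold expRange
    obtain ⟨k, rfl⟩ : ∃ k, q = k + 1 := ⟨q - 1, by omega⟩
    push_cast
    rw [pow_succ]; ring
  rw [h4, eMin_eq]
  omega

theorem round_tail (A : Adm p q) {x y : ℝ} (z : Flt p q) (hy : satur q ≤ y)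
    (h : |x - z| ≤ Real.exp (-y / 2)) : round p q x = .fin z :=
  round_near_of_abs_lt A z (h.trans_lt (exp_neg_lt A hy))

theorem tendsto_of_tail_bot {f : ℝ → ℝ} {c : ℝ} (h : ∀ y, y ≤ -4 → |f y - c| ≤ Real.exp (y / 2)) :
    Tendsto f atBot (𝓝 c) := by
  rw [tendsto_iff_norm_sub_tendsto_zero]
  have h1 : Tendsto (fun y : ℝ => Real.exp (y / 2)) atBot (𝓝 0) :=
    Real.tendsto_exp_atBot.comp (tendsto_id.atBot_div_const (by norm_num))
  refine tendsto_of_tendsto_of_tendsto_of_le_of_le' tendsto_const_nhds h1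
    (Eventually.of_forall fun y => norm_nonneg _) ?_
  filter_upwards [eventually_le_atBot (-4)] with y hy
  exact h y hy

theorem tendsto_of_tail_top {f : ℝ → ℝ} {c : ℝ} (h : ∀ y, 4 ≤ y → |f y - c| ≤ Real.exp (-y / 2)) :
    Tendsto f atTop (𝓝 c) := by
  have h1 : Tendsto (fun y => f (-y)) atBot (𝓝 c) :=
    tendsto_of_tail_bot fun y hy => by simpa using h (-y) (by linarith)
  simpa [Function.comp_def] using h1.comp tendsto_neg_atTop_atBot

variable {f : ℝ → ℝ} {σ' : ExtFlt p q → ExtFlt p q}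

/-- At finite arguments the tail is below half the smallest float and rounds away; at -∞ the same
tail determines the limits. Thus underflow to -∞ in a preceding sum is harmless. -/
theorem low_of_tail (A : Adm p q) (hσ' : IsRoundedDeriv f σ') (c : Flt p q)
    (h : ∀ y, y ≤ -4 → |f y - c| ≤ Real.exp (y / 2))
    (hd : ∀ y, y ≤ -4 → DifferentiableAt ℝ f y)
    (h' : ∀ y, y ≤ -4 → |deriv f y| ≤ Real.exp (y / 2)) {y : ExtFlt p q} (hy : Low y) :
    rounded p q f y = .fin c ∧ σ' y = 0 := by
  have hK := satur_ge A
  rcases hy with rfl | ⟨y, rfl, hy⟩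
  · constructor
    · simp only [rounded]
      rw [roundLimit_eq (tendsto_of_tail_bot h), round_coe A]
    · rw [hσ'.2 _ (fun y hy => by cases hy)]
      simp only [rounded]
      rw [roundLimit_eq (tendsto_of_tail_bot (c := 0) fun y hy => by simpa using h' y hy),
        round_zero A]
  · constructor
    · exact round_tail A c (y := -y) (by linarith) (by rw [neg_neg]; exact h y (by linarith))
    · rw [hσ'.2 _ (fun z hz => by cases hz; exact hd y (by linarith))]
      refine round_tail A 0 (y := -y) (by linarith) ?_
      rw [neg_neg, coe_zero, sub_zero]
      exact h' y (by linarith)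

/-- `y` lies in the upper saturation region. -/
def High (y : ExtFlt p q) : Prop := y = .posInf ∨ ∃ f : Flt p q, y = .fin f ∧ satur q ≤ f

theorem high_of_tail (A : Adm p q) (hσ' : IsRoundedDeriv f σ') (c : Flt p q)
    (h : ∀ y, 4 ≤ y → |f y - c| ≤ Real.exp (-y / 2))
    (hd : ∀ y, 4 ≤ y → DifferentiableAt ℝ f y)
    (h' : ∀ y, 4 ≤ y → |deriv f y| ≤ Real.exp (-y / 2)) {y : ExtFlt p q} (hy : High y) :
    rounded p q f y = .fin c ∧ σ' y = 0 := by
  have hK := satur_ge A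
  rcases hy with rfl | ⟨y, rfl, hy⟩
  · constructor
    · simp only [rounded]
      rw [roundLimit_eq (tendsto_of_tail_top h), round_coe A]
    · rw [hσ'.2 _ (fun y hy => by cases hy)]
      simp only [rounded]
      rw [roundLimit_eq (tendsto_of_tail_top (c := 0) fun y hy => by simpa using h' y hy),
        round_zero A]
  · constructor
    · exact round_tail A c hy (h y (by linarith))
    · rw [hσ'.2 _ (fun z hz => by cases hz; exact hd y (by linarith))]
      refine round_tail A 0 hy ?_
      rw [coe_zero, sub_zero]
      exact h' y (by linarith)

end Tails

/-! ### Rounded ramps and rounded squashing functions -/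

section Interfaces

variable {p q : ℕ}

/-- Rounded versions of functions like ReLU. -/
structure FloatRamp (σ σ' : ExtFlt p q → ExtFlt p q) (c : Flt p q) : Prop where
  hc : (c : ℝ) = 0 ∨ (c : ℝ) = -1
  low : ∀ y, Low y → σ y = .fin c ∧ σ' y = 0
  top : ∀ y : Flt p q, satur q ≤ y → σ (.fin y) = .fin y ∧ σ' (.fin y) = round p q 1
  nonneg : ∀ y : Flt p q, 0 ≤ (y : ℝ) → ∀ a ∈ finiteFloats p q, a ≤ (y : ℝ) / 2 →
    Btw (σ (.fin y)) a y
  nonpos : ∀ y : Flt p q, (y : ℝ) ≤ 0 → Btw (σ (.fin y)) (-1) 0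
  der : ∀ y : Flt p q, IsFin (σ' (.fin y))

theorem one_mem (A : Adm p q) : (1 : ℝ) ∈ finiteFloats p q := by
  have := A.expRange_ge
  simpa using two_zpow_mem A (i := 0) (by rw [eMin_eq]; omega) (by rw [eMax_eq]; omega)

theorem Ramp.floatRamp (A : Adm p q) {f : ℝ → ℝ} {σ' : ExtFlt p q → ExtFlt p q}
    (hσ' : IsRoundedDeriv f σ') {c : Flt p q} (hf : Ramp f c)
    (hc : (c : ℝ) = 0 ∨ (c : ℝ) = -1) : FloatRamp (rounded p q f) σ' c := by
  have hK := satur_ge A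
  refine ⟨hc, fun y hy => low_of_tail A hσ' c hf.bot (fun y hy => hf.diff y (by linarith)) hf.dbot
    hy, fun y hy => ⟨round_tail A y hy (hf.top y (by linarith)), ?_⟩, fun y hy a ha hay => ?_,
    fun y hy => ?_, hσ'.1⟩
  · rw [hσ'.2 _ (fun z hz => by cases hz; exact hf.diff y (by linarith)), round_of_mem A (one_mem A)]
    exact round_tail A ⟨1, one_mem A⟩ hy (hf.dtop y (by linarith))
  · have := hf.nonneg y hy
    exact round_btw A ha y.2 (hay.trans this.1) this.2
  · have := hf.nonpos y hy
    exact round_btw A (neg_mem (one_mem A)) (zero_mem_finiteFloats p q) this.1 this.2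

/-- Rounded versions of sigmoidal functions. -/
structure FloatSquash (σ σ' : ExtFlt p q → ExtFlt p q) (c s : Flt p q) (δ : ℤ) : Prop where
  cases : ((c : ℝ) = 0 ∧ (s : ℝ) = 1 / 2 ∧ δ = 2) ∨ ((c : ℝ) = -1 ∧ (s : ℝ) = 0 ∧ δ = 0)
  low : ∀ y, Low y → σ y = .fin c ∧ σ' y = 0
  high : ∀ y, High y → σ y = round p q 1 ∧ σ' y = 0
  bounds : ∀ y : Flt p q, Btw (σ (.fin y)) c 1
  zero : σ (.fin 0) = .fin s
  zero' : σ' (.fin 0) = round p q (2 ^ (-δ))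
  pos : ∀ y : Flt p q, (2 : ℝ) ^ (1 - p : ℤ) ≤ y → Btw (σ (.fin y)) (s + 2 ^ (-1 - p : ℤ)) 1
  nonpos : ∀ y : Flt p q, (y : ℝ) ≤ 0 → Btw (σ (.fin y)) c s
  nonneg : ∀ y : Flt p q, 0 ≤ (y : ℝ) → Btw (σ (.fin y)) s 1
  der : ∀ y : Flt p q, Btw (σ' (.fin y)) 0 1

theorem step_mem (A : Adm p q) {s : ℝ} (hs : s = 1 / 2 ∨ s = 0) :
    s + 2 ^ (-1 - p : ℤ) ∈ finiteFloats p q := by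
  have hE := A.expRange_ge
  have hp := A.hp
  have hp' := A.two_mul_le
  rcases hs with rfl | rfl
  · have h := nat_mul_mem (p := p) (q := q) (m := 2 ^ p + 1) (e := -1) ?_ (by rw [eMin_eq]; omega)
      (by rw [eMax_eq]; omega)
    · convert h using 1
      rw [zpow_sub₀ (by norm_num)]
      push_cast
      rw [zpow_natCast]
      field_simp
    · have : 2 ≤ 2 ^ p := by
        calc 2 = 2 ^ 1 := rfl
          _ ≤ 2 ^ p := Nat.pow_le_pow_right (by norm_num) (by omega)
      rw [pow_succ]; omega
  · rw [zero_add]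
    exact two_zpow_mem A (by rw [eMin_eq]; omega) (by rw [eMax_eq]; omega)

/-- The delicate field is `pos`: an argument of 2^(1-p) or more must be seen after rounding. For s =
0 the value itself is at least 2^(-1-p). For s = 1/2 it exceeds the midpoint between 1/2 and the
next float and rounds up. -/
theorem Squash.floatSquash (A : Adm p q) {f : ℝ → ℝ} {σ' : ExtFlt p q → ExtFlt p q}
    (hσ' : IsRoundedDeriv f σ') {c s : Flt p q} {δ : ℤ} (hf : Squash f c s δ)
    (hcases : ((c : ℝ) = 0 ∧ (s : ℝ) = 1 / 2 ∧ δ = 2) ∨ ((c : ℝ) = -1 ∧ (s : ℝ) = 0 ∧ δ = 0))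
    (hpos : s + (2 : ℝ) ^ (1 - p : ℤ) / 8 < f (2 ^ (1 - p : ℤ)))
    (hpos' : (s : ℝ) = 0 → (2 : ℝ) ^ (-1 - p : ℤ) ≤ f (2 ^ (1 - p : ℤ))) :
    FloatSquash (rounded p q f) σ' c s δ := by
  have hder : ∀ y : Flt p q, σ' (.fin y) = round p q (deriv f y) := fun y =>
    hσ'.2 _ fun z _ => hf.diff z
  refine ⟨hcases, fun y hy => low_of_tail A hσ' c hf.bot (fun y _ => hf.diff y) hf.dbot hy,
    fun y hy => ?_, fun y => ?_, ?_, ?_, fun y hy => ?_, fun y hy => ?_,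
    fun y hy => ?_, fun y => ?_⟩
  · rw [round_of_mem A (one_mem A)]
    exact high_of_tail A hσ' ⟨1, one_mem A⟩ hf.top (fun y _ => hf.diff y) hf.dtop hy
  · exact round_btw A c.2 (one_mem A) (hf.bounds y).1 (hf.bounds y).2
  · change round p q (f 0) = _
    rw [hf.zero, round_coe A]
  · rw [hder, coe_zero, hf.deriv_zero]
  · have h1 := hf.mono hy
    have h2 := (hf.bounds y).2
    have hm : s + (2 : ℝ) ^ (-1 - p : ℤ) ∈ finiteFloats p q :=
      step_mem A (hcases.elim (fun h => Or.inl h.2.1) fun h => Or.inr h.2.1)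
    change Btw (round p q (f y)) _ _
    rcases le_or_gt (s + (2 : ℝ) ^ (-1 - p : ℤ)) (f y) with h3 | h3
    · exact round_btw A hm (one_mem A) h3 h2
    · have hs : (s : ℝ) = 1 / 2 := by
        rcases hcases with h | h
        · exact h.2.1
        · have := hpos' h.2.1
          rw [h.2.1] at h3
          linarith
      -- The spacing above 1/2 is 2^(-1-p), and 2^(1-p)/8 is exactly half of it.
      have h4 : (2 : ℝ) ^ (1 - p : ℤ) / 8 = 2 ^ (-1 - p - 1 : ℤ) := by
        rw [show (8 : ℝ) = 2 ^ (3 : ℤ) by norm_num, ← zpow_sub₀ (by norm_num)]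
        congr 1; ring
      have h5 : (2 : ℝ) ^ (-1 - p : ℤ) = 2 * 2 ^ (-1 - p - 1 : ℤ) := by
        rw [← zpow_one_add₀ (by norm_num)]
        congr 1; ring
      have h6 : (0 : ℝ) < 2 ^ (-1 - p - 1 : ℤ) := by positivity
      have hE := A.expRange_ge
      rw [round_near_of_binade A (y := ⟨_, hm⟩) (n := 2 ^ p + 1) (e := -1) ?_
        (by rw [eMax_eq]; omega) (by rw [hs, h4] at hpos; norm_num; linarith) ?_]
      · rw [btw_fin]
        refine ⟨le_rfl, ?_⟩
        have : (2 : ℝ) ^ (-1 - p : ℤ) ≤ 2 ^ (-1 : ℤ) := zpow_le_zpow_right₀ (by norm_num) (by omega)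
        norm_num at this
        simp only [hs]
        linarith
      · simp only [hs]
        rw [zpow_sub₀ (by norm_num)]
        push_cast
        rw [zpow_natCast]
        field_simp
      · simp only
        rw [abs_lt]
        constructor <;> linarith
  · refine round_btw A c.2 s.2 (hf.bounds y).1 ?_
    rw [← hf.zero]
    exact hf.mono hy
  · refine round_btw A s.2 (one_mem A) ?_ (hf.bounds y).2
    rw [← hf.zero]
    exact hf.mono hy
  · rw [hder]
    exact round_btw A (zero_mem_finiteFloats p q) (one_mem A) (hf.deriv_bounds y).1
      (hf.deriv_bounds y).2

end Interfaces

/-! ### Affine maps of one coordinate and exact scaling -/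

section Coordinates

variable {p q d n : ℕ}

open Classical in
/-- An affine map that depends on one coordinate only. -/
noncomputable def coordAffine (k : Fin d) (w b : Fin n → Flt p q) : Affine p q d n where
  A := fun i j => if j = k then w i else 0
  b := b

theorem coordAffine_eval (A : Adm p q) (k : Fin d) (w b : Fin n → Flt p q) (x : Fin d → Flt p q)
    (i : Fin n) : (coordAffine k w b).eval (fun k => .fin (x k)) i =
      .fin (w i) ⊗ₑ .fin (x k) ⊕ₑ .fin (b i) := by
  rw [Affine.eval_apply, facc_single A 0 d k, zero_add' A]
  · simp only [coordAffine, if_true]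
  · intro j hj
    simp only [coordAffine, if_neg hj]
    exact zero_mul_fin A (isFin_fin _)

/-- Scaling a float up either is exact or overflows. -/
theorem scale_mem_or_large (A : Adm p q) {x : ℝ} (hx : x ∈ finiteFloats p q) {j : ℤ} (hj : 0 ≤ j)
    (hj' : j ≤ eMax q) : 2 ^ j * x ∈ finiteFloats p q ∨ (2 : ℝ) ^ (eMax q + 1) ≤ |2 ^ j * x| := by
  obtain ⟨n, e, rfl, hn, h1, h2, h3⟩ := exists_scaled A hx
  have hE := A.expRange_ge
  have h4 : (2 : ℝ) ^ j * (n * 2 ^ (e - p)) = n * 2 ^ (e + j - p) := by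
    rw [show e + j - (p : ℤ) = j + (e - p) by ring, zpow_add₀ (by norm_num)]; ring
  rw [h4]
  rcases le_or_gt (e + j) (eMax q) with h5 | h5
  · exact Or.inl (int_mul_mem hn (by omega) h5)
  · right
    have h6 : 2 ^ p ≤ |n| := h3.resolve_right fun h => by
      rw [eMin_eq] at h; omega
    have h7 : (2 : ℝ) ^ p ≤ |(n : ℝ)| := by exact_mod_cast h6
    rw [abs_mul, abs_of_pos (show (0 : ℝ) < 2 ^ (e + j - p) by positivity)]
    calc (2 : ℝ) ^ (eMax q + 1) ≤ 2 ^ (e + j) := zpow_le_zpow_right₀ (by norm_num) (by omega)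
      _ = 2 ^ p * 2 ^ (e + j - p) := by
          rw [← zpow_natCast, ← zpow_add₀ (by norm_num)]; congr 1; ring
      _ ≤ _ := mul_le_mul_of_nonneg_right h7 (by positivity)

end Coordinates

end FloatNet

namespace FloatNet

/-! ### Ramps: bits, gradient path and detectors -/

section FloatRamps

variable {p q d : ℕ} {σ σ' : ExtFlt p q → ExtFlt p q} {c : Flt p q}

theorem satur_mul_mem (A : Adm p q) {k : ℤ} (h : 0 ≤ k) (h' : k ≤ 4) :
    2 ^ k * satur q ∈ finiteFloats p q := by
  have := A.expRange_ge
  unfold satur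
  rw [← zpow_add₀ (by norm_num)]
  exact two_zpow_mem A (by rw [eMin_eq]; omega) (by rw [eMax_eq]; omega)

theorem two_mem (A : Adm p q) : (2 : ℝ) ∈ finiteFloats p q := by
  have := A.expRange_ge
  have h := two_zpow_mem A (i := 1) (by rw [eMin_eq]; omega) (by rw [eMax_eq]; omega)
  rwa [zpow_one] at h

theorem three_halves_mul_eMax (A : Adm p q) :
    (3 : ℝ) / 2 * 2 ^ eMax q = (3 * 2 ^ (p - 1) : ℕ) * 2 ^ (eMax q - p) := by
  have hp := A.hp
  obtain ⟨k, rfl⟩ : ∃ k, p = k + 1 := ⟨p - 1, by omega⟩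
  rw [zpow_sub₀ (by norm_num), zpow_natCast, Nat.add_sub_cancel, pow_succ]
  push_cast
  field_simp

namespace FloatRamp

variable (F : FloatRamp σ σ' c)

include F

theorem c_nonpos : (c : ℝ) ≤ 0 ∧ -1 ≤ (c : ℝ) := by
  rcases F.hc with h | h <;> rw [h] <;> norm_num

theorem val (y : Flt p q) : IsFin (σ (.fin y)) := by
  rcases le_total 0 (y : ℝ) with h | h
  · exact (F.nonneg y h 0 (zero_mem_finiteFloats p q) (by linarith)).isFin
  · exact (F.nonpos y h).isFin

theorem of_le {y : ExtFlt p q} (hy : Le y 0) :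
    Btw (σ y) (-1) 0 ∧ IsFin (σ' y) := by
  rcases hy with rfl | ⟨y, rfl, hy⟩
  · obtain ⟨h1, h2⟩ := F.low .negInf (Or.inl rfl)
    rw [h1, h2]
    exact ⟨btw_fin.2 ⟨F.c_nonpos.2, F.c_nonpos.1⟩, isFin_zero⟩
  · exact ⟨F.nonpos y hy, F.der y⟩

theorem core (A : Adm p q) : Core σ σ' c ⟨hiVal q, hiVal_mem A⟩ := by
  have h1 := satur_le_hiVal A
  have h2 := satur_ge A
  have h3 := two_mul_hiVal q
  have h4 := A.expRange_ge
  have h5 := F.c_nonpos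
  refine ⟨F.low, ?_, F.val, F.der, ?_, ?_⟩
  · rw [round_of_mem A (hiVal_mem A)]
    exact (F.top _ (by simp only; linarith)).1
  · refine ⟨⟨2, two_mem A⟩, ⟨-hiVal q, neg_mem (hiVal_mem A)⟩, ?_, ?_⟩
    · rw [exact_mul A (two_eMax_mem A) (by rw [← h3]), round_of_mem A (hiVal_mem A)]
      exact exact_add A _ (by simp only; linarith)
    · refine Le.mono (r := -hiVal q) ?_ (by linarith)
      refine Le.add A (r := 0) (s := -hiVal q) ?_ (Or.inr ⟨_, rfl, le_rfl⟩)
        (neg_mem (hiVal_mem A)) (by linarith)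
      rw [fin_mul]
      exact round_le A (zero_mem_finiteFloats p q) (by simp only; linarith)
  · have h6 : (2 : ℝ) ^ (eMax q - 2) ∈ finiteFloats p q :=
      two_zpow_mem A (by rw [eMin_eq, eMax_eq]; omega) (by omega)
    have h7 : 2 * (2 : ℝ) ^ (eMax q - 2) = hiVal q := by
      unfold hiVal
      rw [← zpow_one_add₀ (by norm_num)]
      congr 1; ring
    -- The bias compensates the contribution of c exactly. The weight -2^(eMax-2) is chosen so that
    -- for c = -1 the bias 2^(eMax-1) - 2^(eMax-2) is again a power of two.
    have h8 : hiVal q + -2 ^ (eMax q - 2) * -c ∈ finiteFloats p q := by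
      rcases F.hc with h | h <;> rw [h]
      · simpa using hiVal_mem A
      · rw [← h7]; convert h6 using 1; ring
    refine ⟨⟨_, neg_mem h6⟩, ⟨_, h8⟩, ?_, ?_⟩
    · refine Le.mono (r := -satur q) ?_ le_rfl
      refine Le.add A (r := -2 ^ eMax q) (s := hiVal q) ?_ (Or.inr ⟨_, rfl, ?_⟩)
        (neg_mem (satur_mem A)) (by linarith)
      · rw [fin_mul]
        refine round_le A (neg_mem (two_eMax_mem A)) ?_
        simp only
        nlinarith
      · simp only
        nlinarith
    · have h9 : -2 ^ (eMax q - 2) * (c : ℝ) ∈ finiteFloats p q := by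
        rcases F.hc with h | h <;> rw [h]
        · simpa using zero_mem_finiteFloats p q
        · simpa using h6
      rw [exact_mul A h9 rfl, round_of_mem A (hiVal_mem A)]
      exact exact_add A _ (by simp only; ring)

theorem notBdd (A : Adm p q) : ¬ IsBdd σ := by
  intro h
  have h1 := satur_ge A
  obtain ⟨f, h2, -, h3⟩ := h ⟨satur q, satur_mem A⟩
  rw [(F.top _ le_rfl).1] at h2
  cases h2
  simp only at h3
  linarith

/-- `satur q` is a fixed point with derivative 1, so it serves both as β and as s. The size of s
restricts the weights of the path, and 2^(q+1+E/2) ≤ 2^eMax still holds. -/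
theorem pathAct (A : Adm p q) : PathAct σ σ' c ⟨hiVal q, hiVal_mem A⟩ ⟨satur q, satur_mem A⟩
    ⟨satur q, satur_mem A⟩ 0 (maxFloat p q) := by
  have hE := A.expRange_ge
  have h1 := satur_le_hiVal A
  have h2 := satur_ge A
  have h5 := F.c_nonpos
  have hmax := two_zpow_eMax_le A
  refine ⟨Or.inl rfl, (F.top _ le_rfl).1, by simpa using (F.top _ le_rfl).2,
    fun h => absurd h (F.notBdd A), fun a ha => ?_, by simp, fun j hj hj' => ?_⟩
  · simp only
    rw [abs_of_pos (by linarith)]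
    unfold satur
    rw [← zpow_add₀ (by norm_num)]
    refine le_trans (zpow_le_zpow_right₀ (by norm_num)
      (show (q : ℤ) + 1 + (a + 0) ≤ eMax q by rw [eMax_eq]; omega)) ?_
    have : (0 : ℝ) < 2 ^ eMax q := by positivity
    linarith
  · have hjm : (2 : ℝ) ^ j ∈ finiteFloats p q := two_zpow_mem A hj (by rw [eMax_eq]; omega)
    have hj4 : (2 : ℝ) ^ j ≤ 4 := by
      calc (2 : ℝ) ^ j ≤ 2 ^ (2 : ℤ) := zpow_le_zpow_right₀ (by norm_num) hj'
        _ = 4 := by norm_num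
    have hj0 : (0 : ℝ) < 2 ^ j := by positivity
    have hK : ∀ k : ℕ, k ≤ 4 → 2 ^ k * satur q ∈ finiteFloats p q := fun k hk => by
      have := satur_mul_mem A (k := (k : ℤ)) (by omega) (by omega)
      rwa [zpow_natCast] at this
    have hjK : Btw (round p q (2 ^ j) ⊗ₑ .fin ⟨satur q, satur_mem A⟩) 0 (2 ^ 2 * satur q) := by
      rw [round_of_mem A hjm, fin_mul]
      refine round_btw A (zero_mem_finiteFloats p q) (hK 2 (by norm_num)) ?_ ?_
      · simp only; nlinarith
      · simp only; nlinarith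
    -- With K = `satur q`: at `u` the pre-activation lies in [K, 16K], where σ is the identity;
    -- elsewhere -`hiVal q` outweighs the remaining at most 4K + K.
    refine ⟨⟨-1, neg_mem (one_mem A)⟩, ⟨satur q, satur_mem A⟩, ?_, ?_⟩
    · have h6 : Btw ((ExtFlt.fin ⟨-1, neg_mem (one_mem A)⟩) ⊗ₑ .fin c) 0 1 := by
        rw [fin_mul]
        refine round_btw A (zero_mem_finiteFloats p q) (one_mem A) ?_ ?_ <;> simp only <;> linarith
      have h7 := h6.add A hjK (zero_mem_finiteFloats p q) (hK 3 (by norm_num)) (by linarith)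
        (by linarith)
      have h8 := h7.add A (btw_fin.2 (⟨le_rfl, le_rfl⟩ : satur q ≤ (⟨satur q, satur_mem A⟩ : Flt p q) ∧
        ((⟨satur q, satur_mem A⟩ : Flt p q) : ℝ) ≤ satur q)) (satur_mem A) (hK 4 (by norm_num))
        (by linarith) (by linarith)
      obtain ⟨y, hy, h9, -⟩ := h8
      obtain ⟨h10, h11⟩ := F.top y h9
      exact ⟨y, y, hy, h10, by simpa using h11, by simpa using abs_le_maxFloat A y.2⟩
    · intro z hz
      have hz' : z = ⟨satur q, satur_mem A⟩ := hz.resolve_right fun h => F.notBdd A h.1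
      subst hz'
      refine Le.add A (r := -(2 ^ 3 * satur q)) (s := satur q) ?_ (Or.inr ⟨_, rfl, le_rfl⟩)
        (neg_mem (satur_mem A)) (by linarith)
      refine Le.add A (r := -hiVal q) (s := 2 ^ 2 * satur q) ?_ hjK.le
        (neg_mem (hK 3 (by norm_num))) (by linarith)
      rw [fin_mul]
      refine round_le A (neg_mem (hiVal_mem A)) ?_
      simp only
      linarith

/-- Absorption: the bias is 3/2 · 2^eMax, in the middle of the top binade, and x_k enters with
weight ±2^(-p). By |x_k| ≤ 2^(eMax-2) this perturbation is below half a spacing and is rounded away,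
so the forward value does not depend on x at all, whereas the gradient sees the weight. The path
must deliver 2^(i+p), which is in range as i ≤ eMax - p. -/
theorem exists_pathBase (A : Adm p q)
    (u : {x : Fin d → Flt p q // ∀ k, |(x k : ℝ)| ≤ 2 ^ (eMax q - 2)}) (k : Fin d) {i : ℤ} {r : ℝ}
    (hi : eMin q - p ≤ i) (hi' : i ≤ eMax q - p) (hr : r = 1 ∨ r = -1) :
    ∃ (ρ : Affine p q d 2) (v₀ : Flt p q) (i₀ : ℤ), PathBase σ σ' 0 u k (r * 2 ^ i) ρ v₀ i₀ := by
  have hE := A.expRange_ge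
  have hp := A.two_mul_le
  have hp' := A.hp
  have hmin := eMin_eq q
  have hmax := eMax_eq q
  have hpm : (2 : ℝ) ^ (-p : ℤ) ∈ finiteFloats p q := two_zpow_mem A (by omega) (by omega)
  have hrm : r * (2 : ℝ) ^ (-p : ℤ) ∈ finiteFloats p q := by
    rcases hr with rfl | rfl
    · rwa [one_mul]
    · rw [neg_one_mul]; exact neg_mem hpm
  have h32 : (3 : ℝ) / 2 * 2 ^ eMax q ∈ finiteFloats p q := by
    have h := nat_mul_mem (p := p) (q := q) (m := 3 * 2 ^ (p - 1)) (e := eMax q) ?_ (by omega) le_rfl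
    · rwa [← three_halves_mul_eMax A] at h
    · obtain ⟨k, rfl⟩ : ∃ k, p = k + 1 := ⟨p - 1, by omega⟩
      rw [Nat.add_sub_cancel, pow_succ, pow_succ]
      have : 0 < 2 ^ k := by positivity
      omega
  set Y : Flt p q := ⟨_, h32⟩ with hY
  have hYs : satur q ≤ Y := by
    have := satur_le_hiVal A
    have := two_mul_hiVal q
    have := satur_ge A
    simp only [hY]
    linarith
  have hYt := F.top Y hYs
  refine ⟨coordAffine k (fun i => if i = 0 then ⟨_, hrm⟩ else 0) (fun _ => Y), Y, i + p,
    fun x => ⟨Y, Y, ?_, ?_, fun _ => ⟨hYt.1, hYt.1, by simpa using hYt.2, by simpa using hYt.2⟩⟩,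
    by simpa using abs_le_maxFloat A Y.2, by omega, by omega, ?_, fun k' hk' => ?_, fun k' => ?_⟩
  · have h1 := coordAffine_eval A k (fun i : Fin 2 => if i = 0 then ⟨_, hrm⟩ else 0) (fun _ => Y)
      x.1 0
    refine h1.trans ?_
    rw [if_pos rfl]
    have h2 : |r * (2 : ℝ) ^ (-p : ℤ) * x.1 k| ≤ 2 ^ (eMax q - 2 - p) := by
      have h3 : |r| = 1 := by rcases hr with rfl | rfl <;> simp
      rw [abs_mul, abs_mul, h3, one_mul, abs_of_pos (by positivity),
        show eMax q - 2 - (p : ℤ) = -p + (eMax q - 2) by ring, zpow_add₀ (by norm_num)]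
      exact mul_le_mul_of_nonneg_left (x.2 k) (by positivity)
    have h4 : (2 : ℝ) ^ (eMax q - 2 - p) ∈ finiteFloats p q := two_zpow_mem A (by omega) (by omega)
    obtain ⟨f, hf, h5, h6⟩ := round_btw A (neg_mem h4) h4 (abs_le.1 h2).1 (abs_le.1 h2).2
    rw [fin_mul, hf, fin_add]
    have h7 : (2 : ℝ) ^ (eMax q - 2 - p) < 2 ^ (eMax q - p - 1) :=
      zpow_lt_zpow_right₀ (by norm_num) (by omega)
    have h8 : (2 : ℝ) ^ (eMax q - p - 1) ≤ 2 ^ (eMax q - 1) :=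
      zpow_le_zpow_right₀ (by norm_num) (by omega)
    have h9 : 2 * (2 : ℝ) ^ (eMax q - 1) = 2 ^ eMax q := two_mul_hiVal q
    refine round_near_of_binade A (n := 3 * 2 ^ (p - 1)) (e := eMax q) (three_halves_mul_eMax A)
      le_rfl ?_ ?_
    · simp only [hY]; linarith
    · rw [add_sub_cancel_right, abs_lt]
      constructor <;> linarith
  · have h1 := coordAffine_eval A k (fun i : Fin 2 => if i = 0 then ⟨_, hrm⟩ else 0) (fun _ => Y)
      x.1 1
    refine h1.trans ?_
    change 0 ⊗ₑ _ ⊕ₑ _ = _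
    rw [zero_mul_fin A (isFin_fin _), zero_add' A]
  · have h1 : (2 : ℝ) ^ (i + p) ∈ finiteFloats p q := two_zpow_mem A (by omega) (by omega)
    rw [round_of_mem A h1]
    simp only [coordAffine, if_true]
    rw [fin_mul]
    congr 1
    simp only
    rw [mul_left_comm, ← zpow_add₀ (by norm_num), add_neg_cancel_right]
  · simp only [coordAffine, if_neg hk']
  · simp [coordAffine]

/-- The smallest positive difference has to be amplified to at least 1 although it is of size
2^(eMin-p). One factor 2^eMax brings it to size 2^(-p), and a second one, 2^(p+q+2), to the
saturation scale. The initial factor 2 compensates σ(y) ≥ y/2, and the domain bound keeps 2x - 2u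
finite. -/
theorem detectors (A : Adm p q) :
    HasDetectors σ σ' (fun x : Fin d → Flt p q => ∀ k, |(x k : ℝ)| ≤ 2 ^ (eMax q - 2)) 3 := by
  intro u k r hr
  have hE := A.expRange_ge
  have hp := A.two_mul_le
  have hp' := A.hp
  have hmin := eMin_eq q
  have hmax := eMax_eq q
  have hK := satur_ge A
  have hc := F.c_nonpos
  have hmaxF := two_zpow_eMax_le A
  have hm : ∀ i : ℤ, eMin q - p ≤ i → i ≤ eMax q → (2 : ℝ) ^ i ∈ finiteFloats p q := fun i =>
    two_zpow_mem A
  have hz := zero_mem_finiteFloats p q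
  have hsc : ∀ x : Flt p q, |(x : ℝ)| ≤ 2 ^ (eMax q - 2) → r * 2 * x ∈ finiteFloats p q ∧
      |r * 2 * (x : ℝ)| ≤ 2 ^ (eMax q - 1) := fun x hx => by
    have h1 : 2 * (2 : ℝ) ^ (eMax q - 2) = 2 ^ (eMax q - 1) := by
      rw [← zpow_one_add₀ (by norm_num)]; congr 1; ring
    have h2 : |2 * (x : ℝ)| ≤ 2 ^ (eMax q - 1) := by
      rw [abs_mul, abs_two]; linarith
    have h3 : 2 * (x : ℝ) ∈ finiteFloats p q := by
      have h4 := (scale_mem_or_large A x.2 (j := 1) (by norm_num) (by omega)).resolve_right fun h => by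
        have h5 : (2 : ℝ) ^ (eMax q - 1) < 2 ^ (eMax q + 1) :=
          zpow_lt_zpow_right₀ (by norm_num) (by omega)
        rw [zpow_one] at h
        linarith
      rwa [zpow_one] at h4
    rcases hr with rfl | rfl
    · rw [one_mul]; exact ⟨h3, h2⟩
    · rw [show -1 * 2 * (x : ℝ) = -(2 * x) by ring, abs_neg]; exact ⟨neg_mem h3, h2⟩
  have hrm : r * 2 ∈ finiteFloats p q := by
    have h1 := two_mem A
    rcases hr with rfl | rfl
    · rwa [one_mul]
    · rw [neg_one_mul]; exact neg_mem h1
  have h4m : (4 : ℝ) ∈ finiteFloats p q := by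
    have := hm 2 (by omega) (by omega)
    norm_num at this
    exact this
  have h2K : 2 * satur q ∈ finiteFloats p q := by
    simpa using satur_mul_mem A (k := 1) (by norm_num) (by norm_num)
  -- A silent detector must output exactly 0. If c = 0 the last neuron is kept low; if c = -1 the
  -- bias 4 cancels 4c and the neuron sits at 0, where σ vanishes.
  have hb4 : ∃ b : Flt p q, (b : ℝ) ≤ 4 ∧ -(2 * satur q) ≤ (b : ℝ) ∧
      ((c : ℝ) = 0 ∧ (b : ℝ) = -(2 * satur q) ∨ (c : ℝ) = -1 ∧ (b : ℝ) = 4) := by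
    rcases F.hc with h | h
    · exact ⟨⟨_, neg_mem h2K⟩, by simp only; linarith, le_rfl, Or.inl ⟨h, rfl⟩⟩
    · exact ⟨⟨4, h4m⟩, le_rfl, by simp only; linarith, Or.inr ⟨h, rfl⟩⟩
  obtain ⟨b4, hb1, hb2, hb4⟩ := hb4
  have hw3 : (2 : ℝ) ^ ((p : ℤ) + q + 2) ∈ finiteFloats p q := hm _ (by omega) (by omega)
  have hw3' : (2 : ℝ) ^ ((p : ℤ) + q + 3) ∈ finiteFloats p q := hm _ (by omega) (by omega)
  have hw3'' : (2 : ℝ) ^ ((p : ℤ) + q + 5) ∈ finiteFloats p q := hm _ (by omega) (by omega)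
  have hb2' : (2 : ℝ) ^ (1 - p : ℤ) ∈ finiteFloats p q := hm _ (by omega) (by omega)
  refine ⟨(((Tower.base (coordAffine k (fun _ => ⟨_, hrm⟩)
    (fun _ => ⟨_, neg_mem (hsc (u.1 k) (u.2 k)).1⟩))).scal ⟨_, neg_mem (two_eMax_mem A)⟩
    ⟨_, hb2'⟩).scal ⟨_, neg_mem hw3⟩ ⟨_, satur_mem A⟩).scal ⟨4, h4m⟩ b4, fun x => ?_⟩
  obtain ⟨hx1, hx2⟩ := hsc (x.1 k) (x.2 k)
  obtain ⟨hu1, hu2⟩ := hsc (u.1 k) (u.2 k)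
  have h2V : 2 * (2 : ℝ) ^ (eMax q - 1) = 2 ^ eMax q := two_mul_hiVal q
  have hV : (0 : ℝ) < 2 ^ eMax q := by positivity
  obtain ⟨y1, hy1⟩ : IsFin (round p q (r * 2 * (x.1 k : ℝ) + -(r * 2 * (u.1 k : ℝ)))) := by
    refine round_isFin ?_
    rw [abs_le] at hx2 hu2 ⊢
    constructor <;> linarith
  have he1 : (Tower.base (coordAffine k (fun _ : Fin 1 => ⟨_, hrm⟩)
      (fun _ => ⟨_, neg_mem (hsc (u.1 k) (u.2 k)).1⟩))).eval σ (inp x) = fun _ => .fin y1 := by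
    funext i
    refine (coordAffine_eval A k _ _ x.1 i).trans ?_
    rw [exact_mul A hx1 rfl, fin_add, hy1]
  have hfin1 := F.val y1
  have hr1 : ((Tower.base (coordAffine k (fun _ : Fin 1 => ⟨_, hrm⟩)
      (fun _ => ⟨_, neg_mem (hsc (u.1 k) (u.2 k)).1⟩)))).Regular σ σ' (inp x) := trivial
  have he2 := Tower.eval_scal A he1 ⟨_, neg_mem (two_eMax_mem A)⟩ ⟨_, hb2'⟩
  have hr2 := Tower.regular_scal hr1 he1 (F.val y1) (F.der y1) ⟨_, neg_mem (two_eMax_mem A)⟩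
    ⟨_, hb2'⟩
  have he3 := Tower.eval_scal A he2 ⟨_, neg_mem hw3⟩ ⟨_, satur_mem A⟩
  have hpp : (2 : ℝ) ^ (-p : ℤ) ∈ finiteFloats p q := hm _ (by omega) (by omega)
  have hpp2 : (2 : ℝ) ^ (1 - p : ℤ) = 2 * 2 ^ (-p : ℤ) := by
    rw [← zpow_one_add₀ (by norm_num)]; congr 1
  have hpp0 : (0 : ℝ) < 2 ^ (-p : ℤ) := by positivity
  have hs23 : (2 : ℝ) ^ ((p : ℤ) + q + 3) = 2 * 2 ^ ((p : ℤ) + q + 2) := by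
    rw [← zpow_one_add₀ (by norm_num)]; congr 1; ring
  have hs25 : (2 : ℝ) ^ ((p : ℤ) + q + 5) = 4 * 2 ^ ((p : ℤ) + q + 3) := by
    rw [show (4 : ℝ) = 2 ^ (2 : ℤ) by norm_num, ← zpow_add₀ (by norm_num)]; congr 1; ring
  have hsK : satur q ≤ 2 ^ ((p : ℤ) + q + 2) :=
    zpow_le_zpow_right₀ (by norm_num) (by omega)
  have hs5 : (2 : ℝ) ^ ((p : ℤ) + q + 5) ≤ 2 ^ eMax q :=
    zpow_le_zpow_right₀ (by norm_num) (by omega)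
  rcases le_or_gt (r * ((x.1 k : ℝ) - u.1 k)) 0 with hcase | hcase
  · have hy1' : (y1 : ℝ) ≤ 0 := by
      have := round_btw A (x := r * 2 * (x.1 k : ℝ) + -(r * 2 * (u.1 k : ℝ)))
        (neg_mem (two_eMax_mem A)) hz
        (by rw [abs_le] at hx2 hu2; linarith) (by linarith)
      rw [hy1, btw_fin] at this
      exact this.2
    obtain ⟨z1, hz1, hz2, hz3⟩ := F.nonpos y1 hy1'
    have h2 : Btw (.fin ⟨_, neg_mem (two_eMax_mem A)⟩ ⊗ₑ σ (.fin y1) ⊕ₑ .fin ⟨_, hb2'⟩)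
        (2 ^ (1 - p : ℤ)) (maxFloat p q) := by
      have h3 : (2 : ℝ) ^ (1 - p : ℤ) ≤ 1 := zpow_le_one_of_nonpos₀ (by norm_num) (by omega)
      have h4 : (1 : ℝ) ≤ 2 ^ (eMax q - 1) := one_le_zpow₀ (by norm_num) (by omega)
      refine Btw.add A (a := 0) (b := 2 ^ eMax q) ?_ (btw_fin.2 ⟨le_rfl, le_rfl⟩) hb2'
        (maxFloat_mem A) (by simp) (by simp only; linarith)
      rw [hz1, fin_mul]
      refine round_btw A hz (two_eMax_mem A) ?_ ?_ <;> simp only <;> nlinarith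
    obtain ⟨y2, hy2, h3, h4⟩ := h2
    obtain ⟨z2, hz4, hz5, -⟩ := F.nonneg y2 (by linarith) _ hpp (by linarith)
    rw [hy2] at he2 he3
    have hr3 := Tower.regular_scal hr2 he2 (F.val y2) (F.der y2) ⟨_, neg_mem hw3⟩ ⟨_, satur_mem A⟩
    have hl3 : Low (.fin ⟨_, neg_mem hw3⟩ ⊗ₑ σ (.fin y2) ⊕ₑ .fin ⟨_, satur_mem A⟩) := by
      refine Le.add A (r := -(2 * satur q)) (s := satur q) ?_ (Or.inr ⟨_, rfl, le_rfl⟩)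
        (neg_mem (satur_mem A)) (by linarith)
      rw [hz4, fin_mul]
      refine round_le A (neg_mem h2K) ?_
      have h5 : 2 * satur q = 2 ^ ((p : ℤ) + q + 2) * 2 ^ (-p : ℤ) := by
        unfold satur
        rw [← zpow_one_add₀ (by norm_num), ← zpow_add₀ (by norm_num)]
        congr 1; ring
      have h6 : (0 : ℝ) < 2 ^ ((p : ℤ) + q + 2) := by positivity
      rw [h5]
      simp only
      nlinarith
    have he4 := Tower.eval_scal A he3 ⟨4, h4m⟩ b4
    obtain ⟨h7, h8⟩ := F.low _ hl3
    rw [h7] at he4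
    refine ⟨Tower.regular_scal hr3 he3 (by rw [h7]; exact isFin_fin _)
      (by rw [h8]; exact isFin_zero) _ _, ?_⟩
    rcases hb4 with ⟨hc0, hb⟩ | ⟨hc1, hb⟩
    · have hl4 : Low (.fin ⟨4, h4m⟩ ⊗ₑ .fin c ⊕ₑ .fin b4) := by
        rw [fin_mul, hc0, mul_zero, round_zero A, zero_add' A]
        exact Or.inr ⟨_, rfl, by rw [hb]; linarith⟩
      refine ⟨_, c, he4, (F.low _ hl4).1, ?_, fun h => absurd h (not_lt.2 hcase),
        fun _ => Subtype.ext hc0⟩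
      rw [(F.low _ hl4).2]; exact isFin_zero
    · have h9 : (ExtFlt.fin ⟨4, h4m⟩) ⊗ₑ .fin c ⊕ₑ .fin b4 = .fin 0 := by
        rw [exact_mul A (neg_mem h4m) (by rw [hc1]; norm_num), fin_add, hb]
        simp only [neg_add_cancel]
        exact round_zero A
      rw [h9] at he4
      refine ⟨_, 0, he4, ?_, F.der _, fun h => absurd h (not_lt.2 hcase), fun _ => rfl⟩
      obtain ⟨v, hv, h10, -⟩ := F.nonneg 0 le_rfl 0 hz (by simp [coe_zero])
      obtain ⟨v', hv', -, h11⟩ := F.nonpos 0 le_rfl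
      rw [hv] at hv' ⊢
      cases hv'
      exact congrArg _ (Subtype.ext (le_antisymm h11 h10))
  · have hne : (x.1 k : ℝ) ≠ u.1 k := fun h => by rw [h, sub_self, mul_zero] at hcase; linarith
    have hsep : (2 : ℝ) ^ (eMin q - p) ≤ r * ((x.1 k : ℝ) - u.1 k) := by
      refine (min_sep A (u.1 k).2 (x.1 k).2 hne).trans (le_of_eq ?_)
      rcases hr with rfl | rfl
      · rw [one_mul] at hcase ⊢; exact abs_of_pos hcase
      · rw [neg_one_mul] at hcase ⊢; exact abs_of_neg (by linarith)
    have hω2 : (2 : ℝ) ^ (eMin q - p + 1) = 2 * 2 ^ (eMin q - p) := by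
      rw [← zpow_one_add₀ (by norm_num)]; congr 1; ring
    have hω0 : (0 : ℝ) < 2 ^ (eMin q - p) := by positivity
    have hy1' : (2 : ℝ) ^ (eMin q - p + 1) ≤ y1 := by
      have := round_btw A (x := r * 2 * (x.1 k : ℝ) + -(r * 2 * (u.1 k : ℝ)))
        (hm (eMin q - p + 1) (by omega) (by omega)) (two_eMax_mem A) (by rw [hω2]; linarith)
        (by rw [abs_le] at hx2 hu2; linarith)
      rw [hy1, btw_fin] at this
      exact this.1
    obtain ⟨z1, hz1, hz2, -⟩ := F.nonneg y1 (by linarith) _ (hm (eMin q - p) le_rfl (by omega))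
      (by linarith)
    have hl2 : Le (.fin ⟨_, neg_mem (two_eMax_mem A)⟩ ⊗ₑ σ (.fin y1) ⊕ₑ .fin ⟨_, hb2'⟩) 0 := by
      refine Le.add A (r := -2 ^ (1 - p : ℤ)) (s := 2 ^ (1 - p : ℤ)) ?_ (Or.inr ⟨_, rfl, le_rfl⟩)
        hz (by linarith)
      rw [hz1, fin_mul]
      refine round_le A (neg_mem hb2') ?_
      -- Since eMin + eMax = 1, even the smallest positive float times 2^eMax reaches the bias
      -- 2^(1-p), so the sum is nonpositive.
      have : (2 : ℝ) ^ (1 - p : ℤ) = 2 ^ eMax q * 2 ^ (eMin q - p) := by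
        rw [← zpow_add₀ (by norm_num), hmin, hmax]; congr 1; ring
      rw [this]
      simp only
      nlinarith
    obtain ⟨⟨z2, hz3, hz4, hz5⟩, h2⟩ := F.of_le hl2
    have hr3 := Tower.regular_scal hr2 he2 ⟨z2, hz3⟩ h2 ⟨_, neg_mem hw3⟩ ⟨_, satur_mem A⟩
    have hw0 : (0 : ℝ) < 2 ^ ((p : ℤ) + q + 2) := by positivity
    have h3 : Btw (.fin ⟨_, neg_mem hw3⟩ ⊗ₑ σ (.fin ⟨_, neg_mem (two_eMax_mem A)⟩ ⊗ₑ σ (.fin y1) ⊕ₑ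
        .fin ⟨_, hb2'⟩) ⊕ₑ .fin ⟨_, satur_mem A⟩) (satur q) (2 ^ ((p : ℤ) + q + 3)) := by
      refine Btw.add A (a := 0) (b := 2 ^ ((p : ℤ) + q + 2)) ?_ (btw_fin.2 ⟨le_rfl, le_rfl⟩)
        (satur_mem A) hw3' (by simp) (by simp only; linarith)
      rw [hz3, fin_mul]
      refine round_btw A hz hw3 ?_ ?_ <;> simp only <;> nlinarith
    obtain ⟨y3, hy3, h4, h5⟩ := h3
    rw [hy3] at he3
    obtain ⟨h6, -⟩ := F.top y3 h4
    have he4 := Tower.eval_scal A he3 ⟨4, h4m⟩ b4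
    rw [h6] at he4
    have h7 : Btw (.fin ⟨4, h4m⟩ ⊗ₑ .fin y3 ⊕ₑ .fin b4) (satur q) (maxFloat p q) := by
      have h4K : 2 ^ (2 : ℤ) * satur q ∈ finiteFloats p q :=
        satur_mul_mem A (by norm_num) (by norm_num)
      refine Btw.add A (a := 2 ^ (2 : ℤ) * satur q) (b := 2 ^ ((p : ℤ) + q + 5)) ?_
        (btw_fin.2 ⟨hb2, hb1⟩)
        (satur_mem A) (maxFloat_mem A) (by norm_num; linarith) ?_
      · rw [fin_mul]
        refine round_btw A h4K hw3'' ?_ ?_ <;> norm_num <;> linarith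
      · have : (2 : ℝ) ^ (3 : ℤ) ≤ 2 ^ eMax q := zpow_le_zpow_right₀ (by norm_num) (by omega)
        norm_num at this
        linarith
    obtain ⟨y4, hy4, h8, -⟩ := h7
    rw [hy4] at he4
    exact ⟨Tower.regular_scal hr3 he3 (F.val y3) (F.der y3) _ _, _, y4, he4, (F.top y4 h8).1,
      F.der y4, fun _ => by linarith, fun h => absurd h (not_le.2 hcase)⟩

end FloatRamp

end FloatRamps

end FloatNet

namespace FloatNet

/-! ### Squashing functions: bits, gradient path and detectors -/

section FloatSquashes

variable {p q d : ℕ} {σ σ' : ExtFlt p q → ExtFlt p q} {c s : Flt p q} {δ : ℤ}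

theorem round_of_large {x : ℝ} (h : (2 : ℝ) ^ (eMax q + 1) ≤ |x|) :
    round p q x = if 0 < x then .posInf else .negInf := by
  unfold round
  rw [if_neg]
  rw [not_lt]
  refine le_trans ?_ h
  have h1 : (2 : ℝ) ^ (eMax q - p - 1) = 2 ^ eMax q * 2 ^ (-p : ℤ) / 2 := by
    rw [zpow_sub_one₀ (by norm_num), zpow_sub₀ (by norm_num), zpow_neg]; rfl
  rw [h1, zpow_add_one₀ (by norm_num)]
  unfold maxFloat
  have h2 : (0 : ℝ) < 2 ^ eMax q * 2 ^ (-p : ℤ) := by positivity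
  nlinarith

/-- A power of two that separates `u` from all other floats. -/
theorem exists_scale_sep (A : Adm p q) (u : Flt p q) (hu : |(u : ℝ)| ≤ 2 ^ (eMax q - 1)) :
    ∃ j : ℤ, 0 ≤ j ∧ j ≤ eMax q ∧ 2 ^ j * (u : ℝ) ∈ finiteFloats p q ∧
      |2 ^ j * (u : ℝ)| ≤ 2 ^ eMax q ∧
      ∀ x : Flt p q, (x : ℝ) ≠ u → (2 : ℝ) ^ (1 - p : ℤ) ≤ 2 ^ j * |(x : ℝ) - u| := by
  have hE := A.expRange_ge
  have hp := A.two_mul_le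
  have hmin := eMin_eq q
  have hmax := eMax_eq q
  obtain ⟨n, e, hn0, hn, h1, h2, h3⟩ := exists_scaled A u.2
  have key : ∀ j : ℤ, eMin q ≤ e + j → e + j < eMax q → 2 ^ j * (u : ℝ) ∈ finiteFloats p q ∧
      |2 ^ j * (u : ℝ)| ≤ 2 ^ eMax q := by
    intro j hj hj'
    have h4 : (2 : ℝ) ^ j * u = n * 2 ^ (e + j - p) := by
      rw [hn0, show e + j - (p : ℤ) = j + (e - p) by ring, zpow_add₀ (by norm_num)]; ring
    rw [h4]
    refine ⟨int_mul_mem hn hj hj'.le, ?_⟩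
    have h5 : |(n : ℝ)| ≤ 2 ^ (p + 1) := by exact_mod_cast hn.le
    rw [abs_mul, abs_of_pos (show (0 : ℝ) < 2 ^ (e + j - p) by positivity)]
    calc |(n : ℝ)| * 2 ^ (e + j - p) ≤ 2 ^ (p + 1) * 2 ^ (e + j - p) := by gcongr
      _ = 2 ^ (e + j + 1) := by
          rw [← zpow_natCast, ← zpow_add₀ (by norm_num)]; congr 1; push_cast; ring
      _ ≤ 2 ^ eMax q := zpow_le_zpow_right₀ (by norm_num) (by omega)
  rcases lt_or_ge e 0 with he | he
  -- If |u| is small, the largest scaling is possible and the smallest gap 2^(eMin-p) becomes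
  -- 2^(1-p).
  · obtain ⟨h4, h5⟩ := key (eMax q) (by omega) (by omega)
    refine ⟨eMax q, by omega, le_rfl, h4, h5, fun x hx => ?_⟩
    calc (2 : ℝ) ^ (1 - p : ℤ) = 2 ^ eMax q * 2 ^ (eMin q - p) := by
          rw [← zpow_add₀ (by norm_num)]; congr 1; omega
      _ ≤ _ := mul_le_mul_of_nonneg_left (min_sep A u.2 x.2 hx) (by positivity)
  · have h6 : 2 ^ p ≤ |n| := h3.resolve_right (by omega)
    have h7 : (2 : ℝ) ^ e ≤ |(u : ℝ)| := by
      have h8 : (2 : ℝ) ^ p ≤ |(n : ℝ)| := by exact_mod_cast h6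
      rw [hn0, abs_mul, abs_of_pos (show (0 : ℝ) < 2 ^ (e - p) by positivity)]
      calc (2 : ℝ) ^ e = 2 ^ p * 2 ^ (e - p) := by
            rw [← zpow_natCast, ← zpow_add₀ (by norm_num)]; congr 1; ring
        _ ≤ _ := mul_le_mul_of_nonneg_right h8 (by positivity)
    have h8 : e ≤ eMax q - 1 :=
      (zpow_le_zpow_iff_right₀ (show (1 : ℝ) < 2 by norm_num)).1 (h7.trans hu)
    obtain ⟨h4, h5⟩ := key (eMax q - 1 - e) (by omega) (by omega)
    refine ⟨eMax q - 1 - e, by omega, by omega, h4, h5, fun x hx => ?_⟩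
    -- If |u| ≥ 2^e, the nearest competitor may lie in the binade below, whose spacing is 2^(e-1-p);
    -- floats below 2^(e-1) are even farther away.
    have h9 : (2 : ℝ) ^ (e - 1 - p) ≤ |(x : ℝ) - u| := by
      have h10 : 2 * (2 : ℝ) ^ (e - 1) = 2 ^ e := by
        rw [← zpow_one_add₀ (by norm_num)]; congr 1; ring
      have h12 : (0 : ℝ) < 2 ^ (e - 1) := by positivity
      rcases le_or_gt ((2 : ℝ) ^ (e - 1)) |(x : ℝ)| with h11 | h11
      · obtain ⟨m, hm⟩ := exists_eq_mul A x.2 h11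
        obtain ⟨n', hn'⟩ := exists_eq_mul A u.2 (e := e - 1) (by linarith)
        exact sep_of_grid (by positivity) hn' hm hx
      · have h13 : (2 : ℝ) ^ (e - 1 - p) ≤ 2 ^ (e - 1) := zpow_le_zpow_right₀ (by norm_num) (by omega)
        have h14 := abs_sub_abs_le_abs_sub (u : ℝ) x
        rw [abs_sub_comm] at h14
        linarith
    calc (2 : ℝ) ^ (1 - p : ℤ) ≤ 2 ^ (eMax q - 1 - e + (e - 1 - p)) :=
          zpow_le_zpow_right₀ (by norm_num) (by omega)
      _ = 2 ^ (eMax q - 1 - e) * 2 ^ (e - 1 - p) := zpow_add₀ (by norm_num) _ _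
      _ ≤ _ := mul_le_mul_of_nonneg_left h9 (by positivity)

namespace FloatSquash

variable (F : FloatSquash σ σ' c s δ)

include F

theorem c_bounds : -1 ≤ (c : ℝ) ∧ (c : ℝ) ≤ 0 ∧ 0 ≤ (s : ℝ) ∧ (s : ℝ) ≤ 1 / 2 := by
  rcases F.cases with ⟨h1, h2, -⟩ | ⟨h1, h2, -⟩ <;> rw [h1, h2] <;> norm_num

theorem val (y : Flt p q) : IsFin (σ (.fin y)) := (F.bounds y).isFin

theorem one (A : Adm p q) {y : ExtFlt p q} (hy : High y) :
    σ y = .fin ⟨1, one_mem A⟩ ∧ σ' y = 0 := by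
  rw [← round_of_mem A (one_mem A)]
  exact F.high y hy

theorem core (A : Adm p q) : Core σ σ' c ⟨1, one_mem A⟩ := by
  have h1 := satur_le_hiVal A
  have h2 := satur_ge A
  have h3 := two_mul_hiVal q
  have h5 := F.c_bounds
  have hm := hiVal_mem A
  have hM := two_eMax_mem A
  have hV : (0 : ℝ) < 2 ^ eMax q := by positivity
  refine ⟨F.low, ?_, F.val, fun y => (F.der y).isFin, ⟨⟨_, hM⟩, ⟨_, neg_mem hm⟩, ?_, ?_⟩, ?_⟩
  · rw [round_of_mem A hm]
    exact (F.one A (Or.inr ⟨_, rfl, by simp only; linarith⟩)).1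
  · rw [exact_mul A hM (mul_one _), round_of_mem A hm]
    exact exact_add A _ (by simp only; linarith)
  · refine Le.mono (r := -hiVal q) ?_ (by linarith)
    refine Le.add A (r := 0) (s := -hiVal q) ?_ (Or.inr ⟨_, rfl, le_rfl⟩) (neg_mem hm) (by linarith)
    rw [fin_mul]
    refine round_le A (zero_mem_finiteFloats p q) ?_
    simp only
    nlinarith
  · have h8 : hiVal q + 2 ^ eMax q * c ∈ finiteFloats p q := by
      rcases F.cases with ⟨h, -⟩ | ⟨h, -⟩ <;> rw [h]
      · simpa using hm
      · rw [← h3]; convert neg_mem hm using 1; ring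
    have h9 : -2 ^ eMax q * (c : ℝ) ∈ finiteFloats p q := by
      rcases F.cases with ⟨h, -⟩ | ⟨h, -⟩ <;> rw [h]
      · simpa using zero_mem_finiteFloats p q
      · simpa using hM
    refine ⟨⟨_, neg_mem hM⟩, ⟨_, h8⟩, ?_, ?_⟩
    · rw [exact_mul A (neg_mem hM) (mul_one _)]
      refine Le.add A (r := -2 ^ eMax q) (s := hiVal q) (Or.inr ⟨_, rfl, le_rfl⟩)
        (Or.inr ⟨_, rfl, ?_⟩) (neg_mem (satur_mem A)) (by linarith)
      simp only
      nlinarith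
    · rw [exact_mul A h9 rfl, round_of_mem A hm]
      exact exact_add A _ (by simp only; ring)

theorem isBdd : IsBdd σ := fun y => (F.bounds y).mono F.c_bounds.1 le_rfl

/-- The gate bias is the negative of the rounded sum at `u`, so the gate sits exactly at 0 like the
path neurons, with derivative 2^(-δ). Elsewhere the indicator contributes -2K, K = `satur q`, the
path at most 4 and the bias nothing positive. -/
theorem pathAct (A : Adm p q) {H : ℝ} (hH : H * 2 ^ δ ≤ maxFloat p q) :
    PathAct σ σ' c ⟨1, one_mem A⟩ 0 s δ H := by
  have hE := A.expRange_ge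
  have h2 := satur_ge A
  have h5 := F.c_bounds
  have hmax := two_zpow_eMax_le A
  have hmin' := eMin_eq q
  have hmax' := eMax_eq q
  have hδ : δ = 0 ∨ δ = 2 := F.cases.elim (fun h => Or.inr h.2.2) fun h => Or.inl h.2.2
  have hV : (0 : ℝ) < 2 ^ eMax q := by positivity
  have hstep : ∀ a : ℤ, 2 * a ≤ expRange q → |(s : ℝ)| * 2 ^ (a + δ) ≤ maxFloat p q := by
    intro a ha
    have h6 : (2 : ℝ) ^ (a + δ) ≤ 2 ^ eMax q := zpow_le_zpow_right₀ (by norm_num) (by omega)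
    have h7 : (0 : ℝ) < 2 ^ (a + δ) := by positivity
    rw [abs_of_nonneg h5.2.2.1]
    nlinarith
  refine ⟨hδ, F.zero, F.zero', fun _ => rfl, hstep, hH, fun j hj hj' => ?_⟩
  have hjm : (2 : ℝ) ^ j ∈ finiteFloats p q := two_zpow_mem A hj (by omega)
  have hj4 : (2 : ℝ) ^ j ≤ 4 := by
    calc (2 : ℝ) ^ j ≤ 2 ^ (2 : ℤ) := zpow_le_zpow_right₀ (by norm_num) hj'
      _ = 4 := by norm_num
  have hj0 : (0 : ℝ) < 2 ^ j := by positivity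
  have h4m : (4 : ℝ) ∈ finiteFloats p q := by
    have := two_zpow_mem A (i := 2) (by omega) (by omega)
    norm_num at this
    exact this
  have h2K : 2 * satur q ∈ finiteFloats p q := by
    simpa using satur_mul_mem A (k := 1) (by norm_num) (by norm_num)
  have h4K : 2 ^ (2 : ℤ) * satur q ∈ finiteFloats p q :=
    satur_mul_mem A (by norm_num) (by norm_num)
  have hz := zero_mem_finiteFloats p q
  have h6 : Btw (.fin ⟨_, neg_mem h2K⟩ ⊗ₑ .fin c) 0 (2 * satur q) := by
    rw [fin_mul]
    refine round_btw A hz h2K ?_ ?_ <;> simp only <;> nlinarith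
  have h7 : Btw (round p q (2 ^ j) ⊗ₑ .fin s) 0 4 := by
    rw [round_of_mem A hjm, fin_mul]
    refine round_btw A hz h4m ?_ ?_ <;> simp only <;> nlinarith
  obtain ⟨v, hv, hv0, -⟩ := h6.add A h7 hz h4K (by norm_num) (by norm_num; linarith)
  refine ⟨⟨_, neg_mem h2K⟩, fneg v, ⟨0, s, ?_, F.zero, F.zero', ?_⟩, fun z hz => ?_⟩
  · rw [hv, add_fneg A]; rfl
  · simpa using hstep 0 (by omega)
  · have hz1 : |(z : ℝ)| ≤ 1 := by
      rcases hz with rfl | h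
      · rw [abs_of_nonneg h5.2.2.1]; linarith
      · exact h.2
    refine Le.add A (r := -satur q) (s := 0) ?_ (Or.inr ⟨_, rfl, by rw [coe_fneg]; linarith⟩)
      (neg_mem (satur_mem A)) (by linarith)
    refine Le.add A (r := -(2 * satur q)) (s := 4) ?_ ?_ (neg_mem (satur_mem A)) (by linarith)
    · rw [exact_mul A (neg_mem h2K) (mul_one _)]
      exact Or.inr ⟨_, rfl, le_rfl⟩
    · rw [round_of_mem A hjm, fin_mul]
      refine round_le A h4m ?_
      have := (abs_le.1 hz1).2
      simp only
      nlinarith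

/-- Here P sees ±(x_k - u_k), which vanishes exactly at `u`, and Q sees 0. Agreement elsewhere is
not needed since σ is bounded; the domain bound 2^(eMax-1) keeps the difference finite. -/
theorem exists_pathBase (A : Adm p q)
    (u : {x : Fin d → Flt p q // ∀ k, |(x k : ℝ)| ≤ 2 ^ (eMax q - 1)}) (k : Fin d) {i : ℤ} {r : ℝ}
    (hi : eMin q - p ≤ i) (hi' : i ≤ eMax q - p) (hr : r = 1 ∨ r = -1) :
    ∃ (ρ : Affine p q d 2) (v₀ : Flt p q) (i₀ : ℤ), PathBase σ σ' δ u k (r * 2 ^ i) ρ v₀ i₀ := by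
  have hp' := A.hp
  have hsg : ∀ x ∈ finiteFloats p q, r * x ∈ finiteFloats p q := fun x hx => by
    rcases hr with rfl | rfl
    · rwa [one_mul]
    · rw [neg_one_mul]; exact neg_mem hx
  have hrm : r ∈ finiteFloats p q := by simpa using hsg 1 (one_mem A)
  have hr1 : |r| = 1 := by rcases hr with rfl | rfl <;> simp
  have hδ : δ = 0 ∨ δ = 2 := F.cases.elim (fun h => Or.inr h.2.2) fun h => Or.inl h.2.2
  have h5 := F.c_bounds
  have hmax := two_zpow_eMax_le A
  have h2V : 2 * (2 : ℝ) ^ (eMax q - 1) = 2 ^ eMax q := two_mul_hiVal q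
  have hV : (0 : ℝ) < 2 ^ eMax q := by positivity
  have hP := F.pathAct A (H := 0) (by rw [zero_mul]; exact (maxFloat_pos A).le)
  refine ⟨coordAffine k (fun i => if i = 0 then ⟨r, hrm⟩ else 0)
    (fun i => if i = 0 then ⟨_, neg_mem (hsg _ (u.1 k).2)⟩ else 0), s, i, fun x => ?_,
    by simpa using hP.step 0 (by have := A.expRange_ge; omega), hi, by omega, ?_, fun k' hk' => ?_,
    fun k' => ?_⟩
  · have h1 := coordAffine_eval A k (fun i : Fin 2 => if i = 0 then ⟨r, hrm⟩ else 0)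
      (fun i => if i = 0 then ⟨_, neg_mem (hsg _ (u.1 k).2)⟩ else 0) x.1 0
    have h2 := coordAffine_eval A k (fun i : Fin 2 => if i = 0 then ⟨r, hrm⟩ else 0)
      (fun i => if i = 0 then ⟨_, neg_mem (hsg _ (u.1 k).2)⟩ else 0) x.1 1
    rw [if_pos rfl, if_pos rfl, exact_mul A (hsg _ (x.1 k).2) rfl, fin_add] at h1
    change _ = 0 ⊗ₑ _ ⊕ₑ 0 at h2
    rw [zero_mul_fin A (isFin_fin _), zero_add' A] at h2
    simp only at h1
    obtain ⟨yP, hyP⟩ : IsFin (round p q (r * (x.1 k : ℝ) + -(r * (u.1 k : ℝ)))) := by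
      refine round_isFin ?_
      have h3 := x.2 k
      have h4 := u.2 k
      rw [show r * (x.1 k : ℝ) + -(r * (u.1 k : ℝ)) = r * (x.1 k - u.1 k) by ring, abs_mul, hr1,
        one_mul]
      have := abs_sub (x.1 k : ℝ) (u.1 k)
      linarith
    refine ⟨yP, 0, h1.trans hyP, h2, fun h => ?_⟩
    have hx : x = u := h.resolve_right fun h => h F.isBdd
    rw [hx, add_neg_cancel, round_zero A] at hyP
    cases hyP
    exact ⟨F.zero, F.zero, F.zero', F.zero'⟩
  · rw [round_of_mem A (two_zpow_mem A hi (by omega))]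
    simp only [coordAffine, if_true]
    rw [fin_mul, mul_comm]
  · simp only [coordAffine, if_neg hk']
  · simp [coordAffine]

/-- After the separating scaling, a positive difference lifts σ from at most s to at least the float
s + 2^(-1-p). Multiplied by 2^eMax, this single gap exceeds the saturation threshold, so the second
neuron is either low or nonnegative. -/
theorem detectors (A : Adm p q) :
    HasDetectors σ σ' (fun x : Fin d → Flt p q => ∀ k, |(x k : ℝ)| ≤ 2 ^ (eMax q - 1)) 2 := by
  intro u k r hr
  have hE := A.expRange_ge
  have hp := A.two_mul_le
  have hp' := A.hp
  have hmin := eMin_eq q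
  have hmax := eMax_eq q
  have hK := satur_ge A
  have hc := F.c_bounds
  have hz := zero_mem_finiteFloats p q
  obtain ⟨j, hj0, hj1, hj2, hj3, hj4⟩ := exists_scale_sep A (u.1 k) (u.2 k)
  have hsg : ∀ x ∈ finiteFloats p q, r * x ∈ finiteFloats p q := fun x hx => by
    rcases hr with rfl | rfl
    · rwa [one_mul]
    · rw [neg_one_mul]; exact neg_mem hx
  have hr1 : |r| = 1 := by rcases hr with rfl | rfl <;> simp
  have hw1 := hsg _ (two_zpow_mem A (i := j) (by omega) hj1)
  have hb1 := neg_mem (hsg _ hj2)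
  have hs : (s : ℝ) = 1 / 2 ∨ (s : ℝ) = 0 :=
    F.cases.elim (fun h => Or.inl h.2.1) fun h => Or.inr h.2.1
  have hst := step_mem A hs
  have hst1 : (2 : ℝ) ^ (-1 - p : ℤ) ≤ 1 / 2 := by
    calc (2 : ℝ) ^ (-1 - p : ℤ) ≤ 2 ^ (-1 : ℤ) := zpow_le_zpow_right₀ (by norm_num) (by omega)
      _ = 1 / 2 := by norm_num
  have hst0 : (0 : ℝ) < 2 ^ (-1 - p : ℤ) := by positivity
  have hV : (0 : ℝ) < 2 ^ eMax q := by positivity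
  have hup : ∀ x ∈ finiteFloats p q, 0 ≤ x → x ≤ 1 → 2 ^ eMax q * x ∈ finiteFloats p q := by
    intro x hx hx0 hx1
    refine (scale_mem_or_large A hx (by omega) le_rfl).resolve_right fun h => ?_
    rw [abs_of_nonneg (by positivity), zpow_add_one₀ (by norm_num)] at h
    nlinarith
  have hb2 := hup _ hst (by linarith) (by linarith)
  have h8K : 2 ^ (3 : ℤ) * satur q ∈ finiteFloats p q :=
    satur_mul_mem A (by norm_num) (by norm_num)
  have h16K : 2 ^ (4 : ℤ) * satur q ∈ finiteFloats p q :=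
    satur_mul_mem A (by norm_num) (by norm_num)
  have h2K : 2 ^ (1 : ℤ) * satur q ∈ finiteFloats p q :=
    satur_mul_mem A (by norm_num) (by norm_num)
  -- With weight 8K, K = `satur q`, the low value c and values at least s are sent to -2K and at
  -- least 2K for sigmoid, and to 0 and at least 8K for tanh; in both cases the output is exactly 0
  -- or 1.
  have hb3 : ∃ b : Flt p q, (c : ℝ) = 0 ∧ (s : ℝ) = 1 / 2 ∧ (b : ℝ) = -(2 ^ (1 : ℤ) * satur q) ∨
      (c : ℝ) = -1 ∧ (s : ℝ) = 0 ∧ (b : ℝ) = 2 ^ (3 : ℤ) * satur q := by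
    rcases F.cases with h | h
    · exact ⟨⟨_, neg_mem h2K⟩, Or.inl ⟨h.1, h.2.1, rfl⟩⟩
    · exact ⟨⟨_, h8K⟩, Or.inr ⟨h.1, h.2.1, rfl⟩⟩
  obtain ⟨b3, hb3⟩ := hb3
  refine ⟨((Tower.base (coordAffine k (fun _ => ⟨_, hw1⟩) (fun _ => ⟨_, hb1⟩))).scal
    ⟨_, two_eMax_mem A⟩ ⟨_, neg_mem hb2⟩).scal ⟨_, h8K⟩ b3, fun x => ?_⟩
  obtain ⟨y1, hy1⟩ : ∃ y1, y1 = (ExtFlt.fin ⟨_, hw1⟩) ⊗ₑ .fin (x.1 k) ⊕ₑ .fin ⟨_, hb1⟩ := ⟨_, rfl⟩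
  have he1 : (Tower.base (coordAffine k (fun _ : Fin 1 => ⟨_, hw1⟩)
      (fun _ => ⟨_, hb1⟩))).eval σ (inp x) = fun _ => y1 := by
    funext i
    rw [hy1]
    exact coordAffine_eval A k _ _ x.1 i
  have hr1' : (Tower.base (coordAffine k (fun _ : Fin 1 => ⟨_, hw1⟩)
      (fun _ => ⟨_, hb1⟩))).Regular σ σ' (inp x) := trivial
  have he2 := Tower.eval_scal A he1 ⟨_, two_eMax_mem A⟩ ⟨_, neg_mem hb2⟩
  have hcmp : (0 < r * ((x.1 k : ℝ) - u.1 k) → y1 = .posInf ∨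
      ∃ f : Flt p q, y1 = .fin f ∧ (2 : ℝ) ^ (1 - p : ℤ) ≤ f) ∧
      (r * ((x.1 k : ℝ) - u.1 k) ≤ 0 → Le y1 0) := by
    have hj5 : (0 : ℝ) < 2 ^ j := by positivity
    have hdiff : r * 2 ^ j * (x.1 k : ℝ) + -(r * (2 ^ j * (u.1 k : ℝ))) =
        2 ^ j * (r * ((x.1 k : ℝ) - u.1 k)) := by ring
    rcases scale_mem_or_large A (x.1 k).2 hj0 hj1 with h | h
    · have h1 : y1 = round p q (2 ^ j * (r * ((x.1 k : ℝ) - u.1 k))) := by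
        rw [hy1, exact_mul A (hsg _ h) (mul_assoc _ _ _), fin_add]
        congr 1
        simp only
        ring
      rw [h1]
      constructor
      · intro hpos
        refine round_ge A (two_zpow_mem A (by omega) (by omega)) ?_
        refine (hj4 (x.1 k) fun h => by rw [h, sub_self, mul_zero] at hpos; linarith).trans
          (le_of_eq ?_)
        rw [← abs_of_pos hpos, abs_mul, hr1, one_mul]
      · intro hneg
        exact round_le A hz (mul_nonpos_of_nonneg_of_nonpos hj5.le hneg)
    -- If 2^j x_k overflows, the infinity has the sign of the difference, because |2^j u_k| ≤ 2^eMax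
    -- is smaller.
    · have h0 : r * 2 ^ j * (x.1 k : ℝ) = r * (2 ^ j * (x.1 k : ℝ)) := mul_assoc _ _ _
      have h1 : (2 : ℝ) ^ (eMax q + 1) ≤ |r * 2 ^ j * (x.1 k : ℝ)| := by
        rw [h0, abs_mul, hr1, one_mul]; exact h
      have h2 : |r * (2 ^ j * (u.1 k : ℝ))| ≤ 2 ^ eMax q := by
        rw [abs_mul, hr1, one_mul]; exact hj3
      have h3 : y1 = (if 0 < r * 2 ^ j * (x.1 k : ℝ) then .posInf else .negInf) ⊕ₑ
          .fin ⟨_, hb1⟩ := by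
        rw [hy1, fin_mul, round_of_large h1]
      rw [zpow_add_one₀ (by norm_num)] at h1
      rw [abs_le] at h2
      by_cases h4 : 0 < r * 2 ^ j * (x.1 k : ℝ)
      · rw [if_pos h4] at h3
        rw [abs_of_pos h4] at h1
        refine ⟨fun _ => Or.inl h3, fun hneg => ?_⟩
        have := mul_nonpos_of_nonneg_of_nonpos hj5.le hneg
        linarith
      · rw [if_neg h4] at h3
        rw [abs_of_nonpos (not_lt.1 h4)] at h1
        refine ⟨fun hpos => ?_, fun _ => Or.inl h3⟩
        have := mul_pos hj5 hpos
        linarith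
  rcases le_or_gt (r * ((x.1 k : ℝ) - u.1 k)) 0 with hcase | hcase
  · have h1 : Btw (σ y1) c s ∧ IsFin (σ' y1) := by
      rcases hcmp.2 hcase with h | ⟨f, h, hf⟩
      · have h2 := F.low y1 (Or.inl h)
        rw [h2.1, h2.2]
        exact ⟨btw_fin.2 ⟨le_rfl, by linarith⟩, isFin_zero⟩
      · rw [h]; exact ⟨F.nonpos f hf, (F.der f).isFin⟩
    obtain ⟨⟨z1, hz1, -, hz2⟩, h1'⟩ := h1
    have hr2 := Tower.regular_scal hr1' he1 ⟨z1, hz1⟩ h1' ⟨_, two_eMax_mem A⟩ ⟨_, neg_mem hb2⟩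
    have hl2 : Low (.fin ⟨_, two_eMax_mem A⟩ ⊗ₑ σ y1 ⊕ₑ .fin ⟨_, neg_mem hb2⟩) := by
      refine Le.add A (r := 2 ^ eMax q * s) (s := -(2 ^ eMax q * (s + 2 ^ (-1 - p : ℤ)))) ?_
        (Or.inr ⟨_, rfl, le_rfl⟩) (neg_mem (satur_mem A)) ?_
      · rw [hz1, fin_mul]
        exact round_le A (hup _ s.2 hc.2.2.1 (by linarith))
          (mul_le_mul_of_nonneg_left hz2 (by positivity))
      · have h2 : satur q ≤ 2 ^ eMax q * 2 ^ (-1 - p : ℤ) := by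
          unfold satur
          rw [← zpow_add₀ (by norm_num)]
          exact zpow_le_zpow_right₀ (by norm_num) (by omega)
        linarith
    obtain ⟨h2, h3⟩ := F.low _ hl2
    have hr3 := Tower.regular_scal hr2 he2 (by rw [h2]; exact isFin_fin _)
      (by rw [h3]; exact isFin_zero) ⟨_, h8K⟩ b3
    have he3 := Tower.eval_scal A he2 ⟨_, h8K⟩ b3
    rw [h2] at he3
    rcases hb3 with ⟨hc0, hs0, hb⟩ | ⟨hc1, hs0, hb⟩
    · have hl : Low (.fin ⟨_, h8K⟩ ⊗ₑ .fin c ⊕ₑ .fin b3) := by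
        rw [fin_mul, hc0, mul_zero, round_zero A, zero_add' A]
        refine Or.inr ⟨_, rfl, ?_⟩
        rw [hb]
        norm_num
        linarith
      refine ⟨hr3, _, c, he3, (F.low _ hl).1, ?_, fun h => absurd h (not_lt.2 hcase),
        fun _ => Subtype.ext hc0⟩
      rw [(F.low _ hl).2]; exact isFin_zero
    · have h9 : (ExtFlt.fin ⟨_, h8K⟩) ⊗ₑ .fin c ⊕ₑ .fin b3 = .fin 0 := by
        rw [exact_mul A (neg_mem h8K) (by rw [hc1]; ring), fin_add, hb]
        simp only [neg_add_cancel]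
        exact round_zero A
      rw [h9] at he3
      exact ⟨hr3, _, s, he3, F.zero, (F.der 0).isFin, fun h => absurd h (not_lt.2 hcase),
        fun _ => Subtype.ext hs0⟩
  · have h1 : Btw (σ y1) (s + 2 ^ (-1 - p : ℤ)) 1 ∧ IsFin (σ' y1) := by
      rcases hcmp.1 hcase with h | ⟨f, h, hf⟩
      · have h2 := F.one A (y := y1) (Or.inl h)
        rw [h2.1, h2.2]
        exact ⟨btw_fin.2 ⟨by simp only; linarith, le_rfl⟩, isFin_zero⟩
      · rw [h]; exact ⟨F.pos f hf, (F.der f).isFin⟩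
    obtain ⟨⟨z1, hz1, hz2, hz3⟩, h1'⟩ := h1
    have hr2 := Tower.regular_scal hr1' he1 ⟨z1, hz1⟩ h1' ⟨_, two_eMax_mem A⟩ ⟨_, neg_mem hb2⟩
    have h2 : Btw (.fin ⟨_, two_eMax_mem A⟩ ⊗ₑ σ y1 ⊕ₑ .fin ⟨_, neg_mem hb2⟩) 0 (2 ^ eMax q) := by
      have h3 : (0 : ℝ) ≤ 2 ^ eMax q * (s + 2 ^ (-1 - p : ℤ)) := by
        refine mul_nonneg hV.le ?_
        linarith
      refine Btw.add A (a := 2 ^ eMax q * (s + 2 ^ (-1 - p : ℤ))) (b := 2 ^ eMax q) ?_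
        (btw_fin.2 ⟨le_rfl, le_rfl⟩) hz (two_eMax_mem A) (by simp) (by simp only; linarith)
      rw [hz1, fin_mul]
      refine round_btw A hb2 (two_eMax_mem A) ?_ ?_ <;> simp only <;> nlinarith
    obtain ⟨y2, hy2, h3, -⟩ := h2
    rw [hy2] at he2
    obtain ⟨z2, hz4, hz5, hz6⟩ := F.nonneg y2 h3
    have hr3 := Tower.regular_scal hr2 he2 ⟨z2, hz4⟩ (F.der y2).isFin ⟨_, h8K⟩ b3
    have he3 := Tower.eval_scal A he2 ⟨_, h8K⟩ b3
    have hy3 : Btw (.fin ⟨_, h8K⟩ ⊗ₑ σ (.fin y2) ⊕ₑ .fin b3) (satur q) (2 ^ (4 : ℤ) * satur q) := by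
      have h4K : 2 ^ (2 : ℤ) * satur q ∈ finiteFloats p q :=
        satur_mul_mem A (by norm_num) (by norm_num)
      rw [hz4, fin_mul]
      rcases hb3 with ⟨hc0, hs0, hb⟩ | ⟨hc1, hs0, hb⟩
      · refine Btw.add A (a := 2 ^ (2 : ℤ) * satur q) (b := 2 ^ (3 : ℤ) * satur q)
          (round_btw A h4K h8K ?_ ?_) (btw_fin.2 ⟨hb.ge, hb.le⟩) (satur_mem A) h16K ?_ ?_
        all_goals norm_num
        all_goals nlinarith
      · refine Btw.add A (a := 0) (b := 2 ^ (3 : ℤ) * satur q)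
          (round_btw A hz h8K ?_ ?_) (btw_fin.2 ⟨hb.ge, hb.le⟩) (satur_mem A) h16K ?_ ?_
        all_goals norm_num
        all_goals nlinarith
    obtain ⟨y3, hy3, h4, -⟩ := hy3
    rw [hy3] at he3
    have h5 := F.one A (y := .fin y3) (Or.inr ⟨_, rfl, h4⟩)
    refine ⟨hr3, _, _, he3, h5.1, ?_, fun _ => le_rfl, fun h => absurd h (not_le.2 hcase)⟩
    rw [h5.2]; exact isFin_zero

end FloatSquash

end FloatSquashes

end FloatNet

namespace FloatNet

open Filter Topology

/-! ### Value units -/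

section ValueUnits

variable {p q d l : ℕ} {σ σ' : ExtFlt p q → ExtFlt p q} {dom : (Fin d → Flt p q) → Prop}
  {hs : {x : Fin d → Flt p q // dom x} → Flt p q} {c s : Flt p q} {δ : ℤ}

theorem abs_eq_one {r : ℝ} (hr : r = 1 ∨ r = -1) : |r| = 1 := by
  rcases hr with rfl | rfl <;> simp

theorem sign_mul_mem {r : ℝ} (hr : r = 1 ∨ r = -1) {x : ℝ} (hx : x ∈ finiteFloats p q) :
    r * x ∈ finiteFloats p q := by
  rcases hr with rfl | rfl
  · rwa [one_mul]
  · rw [neg_one_mul]; exact neg_mem hx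

theorem isFin_mul_of_abs_le_one (A : Adm p q) {w : Flt p q} (hw : |(w : ℝ)| ≤ 1) (h : Flt p q) :
    IsFin ((ExtFlt.fin h) ⊗ₑ .fin w) := by
  refine isFin_mul_of_abs_le ((mul_le_of_le_one_right (abs_nonneg _) hw).trans ?_)
  exact abs_le_maxFloat A h.2

theorem mul_round_one (A : Adm p q) {x : ExtFlt p q} (hx : IsFin x) : x ⊗ₑ round p q 1 = x := by
  obtain ⟨f, rfl⟩ := hx
  rw [round_of_mem A (one_mem A), fin_mul]
  simp only [mul_one]
  exact round_coe A f

/-- Since |h| may be as large as Ω, the output weight must satisfy |w| ≤ 1; size has to come from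
the activation z. The weight -1 from the indicator shuts the neuron off away from `u`, whatever the
moderate bias b. -/
theorem FloatRamp.valueUnit (F : FloatRamp σ σ' c) (A : Adm p q) (hc : c = 0) {T : Tower p q l d 1}
    {u : {x : Fin d → Flt p q // dom x}} (hT : IsIndicator σ σ' T u) {w b z : Flt p q} {v : ℝ}
    (hb : (b : ℝ) ≤ 2 ^ (eMax q - 2)) (hz : σ (.fin b) = .fin z)
    (hv : .fin w ⊗ₑ .fin z = round p q v) (hw : |(w : ℝ)| ≤ 1)
    (hder : ∀ h : Flt p q, IsFin (.fin h ⊗ₑ .fin w ⊗ₑ σ' (.fin b))) :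
    ∃ B : Block p q (l + 1) d, IsValueUnit σ σ' hs B u v := by
  have h1 : |((⟨-1, neg_mem (one_mem A)⟩ : Flt p q) : ℝ)| ≤ 1 := by simp
  refine ⟨_, hT.valueUnit (w' := ⟨-1, neg_mem (one_mem A)⟩) (b := b) A (F.core A) hc ?_ hz hv ?_
    (fun x => isFin_mul_of_abs_le_one A hw _) (fun x => hder _) (fun x => ?_)⟩
  · rw [hc, show (ExtFlt.fin 0 : ExtFlt p q) = 0 from rfl, mul_zero_fin A (isFin_fin _),
      zero_add' A]
  · have h2 := satur_le_hiVal A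
    have h3 : 2 * (2 : ℝ) ^ (eMax q - 2) = hiVal q := by
      unfold hiVal
      rw [← zpow_one_add₀ (by norm_num)]
      congr 1; ring
    have h4 := satur_ge A
    refine Le.add A (r := -hiVal q) (s := 2 ^ (eMax q - 2)) ?_ (Or.inr ⟨_, rfl, hb⟩)
      (neg_mem (satur_mem A)) (by linarith)
    rw [fin_mul]
    exact round_le A (neg_mem (hiVal_mem A)) (by simp only; linarith)
  · obtain ⟨f, hf⟩ := hder (hs x)
    rw [hf]
    exact isFin_mul_of_abs_le_one A h1 f

theorem FloatRamp.valueUnit_of_deriv (F : FloatRamp σ σ' c) (A : Adm p q) (hc : c = 0)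
    {T : Tower p q l d 1} {u : {x : Fin d → Flt p q // dom x}} (hT : IsIndicator σ σ' T u) {k i : ℤ}
    {r : ℝ} (hr : r = 1 ∨ r = -1) (hki : i ≤ k) (hki' : eMin q - p ≤ i - k)
    (hk : k ≤ eMax q - 2) (hkm : (2 : ℝ) ^ k ∈ finiteFloats p q)
    (hz : σ (.fin ⟨_, hkm⟩) = .fin ⟨_, hkm⟩)
    (hz' : σ' (.fin ⟨_, hkm⟩) = round p q 1) :
    ∃ B : Block p q (l + 1) d, IsValueUnit σ σ' hs B u (r * 2 ^ i) := by
  have hE := A.expRange_ge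
  have hm : (2 : ℝ) ^ (i - k) ∈ finiteFloats p q :=
    two_zpow_mem A hki' (by rw [eMax_eq]; omega)
  have hw : |r * (2 : ℝ) ^ (i - k)| ≤ 1 := by
    rw [abs_mul, abs_eq_one hr, one_mul, abs_of_pos (by positivity)]
    exact zpow_le_one_of_nonpos₀ (by norm_num) (by omega)
  refine F.valueUnit A hc hT (w := ⟨_, sign_mul_mem hr hm⟩) ?_ hz ?_ hw fun h => ?_
  · exact zpow_le_zpow_right₀ (by norm_num) hk
  · rw [fin_mul]
    congr 1
    simp only
    rw [mul_assoc, ← zpow_add₀ (by norm_num), sub_add_cancel]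
  · rw [hz', mul_round_one A (isFin_mul_of_abs_le_one A hw h)]
    exact isFin_mul_of_abs_le_one A hw h

/-- Exactly known values σ(2^k) = 2^k exist only for k ≥ q+1. With such k and |w| ≤ 1 all but the
tiniest 2^i are reached, since w cannot be smaller than 2^(eMin-p). The tiniest use the value
2^(-p-3) at 2^(-p-2); there w is so small that even h ⊗ w times a derivative of size at most 2 is
finite. -/
theorem FloatRamp.valueUnit_of_small (F : FloatRamp σ σ' c) (A : Adm p q) (hc : c = 0)
    {T : Tower p q l d 1} {u : {x : Fin d → Flt p q // dom x}} (hT : IsIndicator σ σ' T u) {i : ℤ}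
    {r : ℝ} (hr : r = 1 ∨ r = -1) (hi : eMin q - p ≤ i) (hi' : i ≤ eMax q - p)
    {b : Flt p q} (hb : (b : ℝ) = 2 ^ (-p - 2 : ℤ)) {z : Flt p q} (hz' : (z : ℝ) = 2 ^ (-p - 3 : ℤ))
    (hz : σ (.fin b) = .fin z) (hder : Btw (σ' (.fin b)) (-2) 2) :
    ∃ B : Block p q (l + 1) d, IsValueUnit σ σ' hs B u (r * 2 ^ i) := by
  have hE := A.expRange_ge
  have hp := A.two_mul_le
  have hp' := A.hp
  have hmin := eMin_eq q
  have hmax := eMax_eq q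
  have htop : ∀ (k : ℤ) (hk : (2 : ℝ) ^ k ∈ finiteFloats p q), (q : ℤ) + 1 ≤ k →
      σ (.fin ⟨_, hk⟩) = .fin ⟨_, hk⟩ ∧ σ' (.fin ⟨_, hk⟩) = round p q 1 := fun k hk h =>
    F.top _ (zpow_le_zpow_right₀ (by norm_num) h)
  rcases le_or_gt ((q : ℤ) + 1) i with h1 | h1
  · have hm := two_zpow_mem A hi (by omega)
    obtain ⟨h2, h3⟩ := htop i hm h1
    exact F.valueUnit_of_deriv A hc hT hr le_rfl (by omega) (by omega) hm h2 h3
  rcases le_or_gt (eMin q - p + (q + 1)) i with h4 | h4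
  · have hm := satur_mem A
    obtain ⟨h2, h3⟩ := htop _ hm le_rfl
    exact F.valueUnit_of_deriv A hc hT hr h1.le (by omega) (by omega) hm h2 h3
  have hm : (2 : ℝ) ^ (i + p + 3) ∈ finiteFloats p q := two_zpow_mem A (by omega) (by omega)
  have hw : |r * (2 : ℝ) ^ (i + p + 3)| = 2 ^ (i + p + 3) := by
    rw [abs_mul, abs_eq_one hr, one_mul, abs_of_pos (by positivity)]
  have hw1 : |r * (2 : ℝ) ^ (i + p + 3)| ≤ 1 := by
    rw [hw]
    exact zpow_le_one_of_nonpos₀ (by norm_num) (by omega)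
  refine F.valueUnit A hc hT (w := ⟨_, sign_mul_mem hr hm⟩) ?_ hz ?_ hw1 fun h => ?_
  · rw [hb]
    exact zpow_le_zpow_right₀ (by norm_num) (by omega)
  · rw [fin_mul, hz']
    congr 1
    simp only
    rw [mul_assoc, ← zpow_add₀ (by norm_num)]
    congr 2; ring
  · obtain ⟨y, hy, h5, h6⟩ := hder
    have h7 : (2 : ℝ) ^ (eMax q - 1) ∈ finiteFloats p q := hiVal_mem A
    have h8 : |(h : ℝ) * (r * 2 ^ (i + p + 3))| ≤ 2 ^ (eMax q - 1) := by
      rw [abs_mul, hw]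
      have h9 := (abs_le_maxFloat A h.2).trans maxFloat_lt.le
      calc |(h : ℝ)| * 2 ^ (i + p + 3) ≤ 2 ^ (eMax q + 1) * 2 ^ (i + p + 3) := by gcongr
        _ = 2 ^ (eMax q + 1 + (i + p + 3)) := (zpow_add₀ (by norm_num) _ _).symm
        _ ≤ _ := zpow_le_zpow_right₀ (by norm_num) (by omega)
    obtain ⟨f, hf, h9, h10⟩ := round_btw A (neg_mem h7) h7 (abs_le.1 h8).1 (abs_le.1 h8).2
    rw [fin_mul, hf, hy]
    refine isFin_mul_of_abs_le ?_
    have h11 : 2 * (2 : ℝ) ^ (eMax q - 1) = 2 ^ eMax q := two_mul_hiVal q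
    have h12 := two_zpow_eMax_le A
    have h13 : |(f : ℝ)| ≤ 2 ^ (eMax q - 1) := abs_le.2 ⟨h9, h10⟩
    have h14 : |(y : ℝ)| ≤ 2 := abs_le.2 ⟨h5, h6⟩
    have h15 : |(f : ℝ)| * |(y : ℝ)| ≤ 2 ^ (eMax q - 1) * 2 :=
      mul_le_mul h13 h14 (abs_nonneg _) (by positivity)
    have h16 : (0 : ℝ) < 2 ^ eMax q := by positivity
    linarith

/-- A value unit for activation functions with lower limit `-1`: an indicator and two more
neurons. -/
theorem IsIndicator.valueUnit_two (A : Adm p q) {Z : Flt p q} (C : Core σ σ' c Z)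
    {T : Tower p q l d 1} {u : {x : Fin d → Flt p q // dom x}} (hT : IsIndicator σ σ' T u)
    {w' b a w yₘ yᵤ : Flt p q} {v : ℝ} (hon : .fin w' ⊗ₑ .fin c ⊕ₑ .fin b = .fin yₘ)
    (hoff : Low (.fin w' ⊗ₑ .fin Z ⊕ₑ .fin b)) (hw' : |(w' : ℝ)| ≤ 1) (ha : |(a : ℝ)| ≤ 1)
    (hw : |(w : ℝ)| ≤ 1) (hm : σ (.fin yₘ) = .fin yₘ) (hm' : σ' (.fin yₘ) = round p q 1)
    (hon' : .fin a ⊗ₑ .fin yₘ ⊕ₑ .fin a = .fin yᵤ) (hu : σ (.fin yᵤ) = .fin yᵤ)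
    (hu' : σ' (.fin yᵤ) = round p q 1) (hv : .fin w ⊗ₑ .fin yᵤ = round p q v)
    (hoff' : .fin a ⊗ₑ .fin c ⊕ₑ .fin a = (0 : ExtFlt p q)) (h0 : σ 0 = 0)
    (h0' : σ' 0 = round p q 1) :
    IsValueUnit σ σ' hs (Block.single ((T.scal w' b).scal a a) w) u v := by
  intro x s t
  obtain ⟨g0, hg0⟩ := isFin_mul_of_abs_le_one A hw (hs x)
  obtain ⟨g1, hg1⟩ := isFin_mul_of_abs_le_one A ha g0
  obtain ⟨g2, hg2⟩ := isFin_mul_of_abs_le_one A hw' g1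
  by_cases hx : x = u
  · rw [if_pos hx]
    obtain ⟨y', h4, h5, h6, -⟩ := hT.dead A C x (isFin_fin g2) (fun h => absurd hx h)
    rw [← hg2] at h4
    have h7 := h4.scal A (isFin_fin _) ⟨_, hg2⟩ (by rw [h6 hx]; exact isFin_fin _) h5 b
    rw [h6 hx, hon] at h7
    have h8 : (ExtFlt.fin g0) ⊗ₑ .fin a ⊗ₑ σ' (.fin yₘ) = .fin g1 := by
      rw [hg1, hm', mul_round_one A (isFin_fin _)]
    rw [← h8] at h7
    have h9 := h7.scal A (isFin_fin _) ⟨_, hg1⟩ ⟨_, hm⟩ (C.der _) a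
    rw [hm, hon'] at h9
    have h10 : (ExtFlt.fin (hs x)) ⊗ₑ .fin w ⊗ₑ σ' (.fin yᵤ) = .fin g0 := by
      rw [hg0, hu', mul_round_one A (isFin_fin _)]
    rw [← h10] at h9
    have h11 := h9.run ⟨_, hg0⟩ ⟨_, hu⟩ (C.der _) s t
    rwa [hu, hv] at h11
  · rw [if_neg hx]
    have hl := C.low _ hoff
    obtain ⟨y', h4, h5, -, h6⟩ := hT.dead A C x isFin_zero (fun _ => rfl)
    have h10 : (0 : ExtFlt p q) ⊗ₑ .fin w' = 0 := zero_mul_fin A (isFin_fin _)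
    have h7 := Tower.Dead.scal A (g := 0) (w := w') (by rw [h10]; exact h4) isFin_zero
      (by rw [h10]; exact isFin_zero) (by rw [h6 hx]; exact isFin_fin _) h5 b
    rw [h6 hx] at h7
    have h8 : (ExtFlt.fin g0) ⊗ₑ .fin a ⊗ₑ σ' (.fin w' ⊗ₑ .fin Z ⊕ₑ .fin b) = 0 := by
      rw [hl.2, hg1, mul_zero_fin A (isFin_fin _)]
    rw [← h8] at h7
    have h9 := h7.scal A (isFin_fin _) ⟨_, hg1⟩ (by rw [hl.1]; exact isFin_fin _)
      (by rw [hl.2]; exact isFin_zero) a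
    rw [hl.1, hoff'] at h9
    have h11 : (ExtFlt.fin (hs x)) ⊗ₑ .fin w ⊗ₑ σ' 0 = .fin g0 := by
      rw [hg0, h0', mul_round_one A (isFin_fin _)]
    rw [← h11] at h9
    have h12 := h9.run ⟨_, hg0⟩ (by rw [h0]; exact isFin_zero) (C.der 0) s t
    rwa [h0, mul_zero_fin A (isFin_fin _), add_zero' A] at h12

/-- For c = -1 a low neuron does not output 0. A further neuron with equal weight and bias a turns
-1 into 0, and σ(0) = 0. Its derivative at 0 is 1, but the gradient dies at the low neuron behind
it. -/
theorem FloatRamp.valueUnit_neg_one (F : FloatRamp σ σ' c) (A : Adm p q) (hc : (c : ℝ) = -1)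
    (hpos : ∀ y : Flt p q, 0 ≤ (y : ℝ) → σ (.fin y) = .fin y ∧ σ' (.fin y) = round p q 1)
    {T : Tower p q l d 1} {u : {x : Fin d → Flt p q // dom x}} (hT : IsIndicator σ σ' T u) {i : ℤ}
    {r : ℝ} (hr : r = 1 ∨ r = -1) (hi : eMin q - p ≤ i) (hi' : i ≤ eMax q - p) :
    ∃ B : Block p q (l + 1 + 1) d, IsValueUnit σ σ' hs B u (r * 2 ^ i) := by
  have hE := A.expRange_ge
  have hp := A.two_mul_le
  have hp' := A.hp
  have hmin := eMin_eq q
  have hmax := eMax_eq q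
  have hz := zero_mem_finiteFloats p q
  have hoff : ∀ b : Flt p q, (b : ℝ) ≤ 2 ^ (eMax q - 2) →
      Low ((ExtFlt.fin ⟨-1, neg_mem (one_mem A)⟩) ⊗ₑ .fin ⟨hiVal q, hiVal_mem A⟩ ⊕ₑ .fin b) := by
    intro b hb
    have h2 := satur_le_hiVal A
    have h3 : 2 * (2 : ℝ) ^ (eMax q - 2) = hiVal q := by
      unfold hiVal
      rw [← zpow_one_add₀ (by norm_num)]
      congr 1; ring
    have h4 := satur_ge A
    refine Le.add A (r := -hiVal q) (s := 2 ^ (eMax q - 2)) ?_ (Or.inr ⟨_, rfl, hb⟩)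
      (neg_mem (satur_mem A)) (by linarith)
    rw [fin_mul]
    exact round_le A (neg_mem (hiVal_mem A)) (by simp only; linarith)
  have hcm : (ExtFlt.fin ⟨-1, neg_mem (one_mem A)⟩) ⊗ₑ .fin c = .fin ⟨1, one_mem A⟩ :=
    exact_mul A _ (by rw [hc]; norm_num)
  have hac : ∀ a : Flt p q, (ExtFlt.fin a) ⊗ₑ .fin c ⊕ₑ .fin a = 0 := fun a => by
    rw [exact_mul A (neg_mem a.2) (by rw [hc]; ring), fin_add]
    simp only [neg_add_cancel]
    exact round_zero A
  have h1 : |((⟨-1, neg_mem (one_mem A)⟩ : Flt p q) : ℝ)| ≤ 1 := by simp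
  have h0 := hpos 0 le_rfl
  rcases le_or_gt i 0 with hi0 | hi0
  · have ham : (2 : ℝ) ^ i ∈ finiteFloats p q := two_zpow_mem A hi (by omega)
    have hum : (2 : ℝ) ^ (i + 1) ∈ finiteFloats p q := two_zpow_mem A (by omega) (by omega)
    have hwm : (2 : ℝ) ^ (-1 : ℤ) ∈ finiteFloats p q := two_zpow_mem A (by omega) (by omega)
    have hwr : |r * (2 : ℝ) ^ (-1 : ℤ)| ≤ 1 := by
      rw [abs_mul, abs_eq_one hr]; norm_num
    have hy := hpos ⟨1, one_mem A⟩ zero_le_one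
    have hyu := hpos ⟨_, hum⟩ (by positivity)
    refine ⟨_, hT.valueUnit_two A (F.core A) (b := 0) (a := ⟨_, ham⟩)
      (w := ⟨_, sign_mul_mem hr hwm⟩) (yᵤ := ⟨_, hum⟩) (by rw [hcm]; exact add_zero' A _)
      (hoff 0 (by rw [coe_zero]; positivity)) h1 ?_ hwr hy.1 hy.2 ?_ hyu.1 hyu.2 ?_ (hac _) h0.1
      h0.2⟩
    · simp only
      rw [abs_of_pos (by positivity)]
      exact zpow_le_one_of_nonpos₀ (by norm_num) hi0
    · rw [exact_mul A ham (mul_one _)]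
      refine exact_add A _ ?_
      simp only
      rw [zpow_add_one₀ (by norm_num)]; ring
    · rw [fin_mul]
      congr 1
      simp only
      rw [mul_assoc, ← zpow_add₀ (by norm_num)]
      congr 2; ring
  -- Here both unwanted addends are absorbed: k ≥ p + 2 makes 1 smaller than half a spacing at 2^k,
  -- and 2^(i-k) smaller than half a spacing at 2^i.
  · obtain ⟨k, hk⟩ : ∃ k, k = max i (p + 2) := ⟨_, rfl⟩
    have hkm : (2 : ℝ) ^ k ∈ finiteFloats p q := two_zpow_mem A (by omega) (by omega)
    have him : (2 : ℝ) ^ i ∈ finiteFloats p q := two_zpow_mem A hi (by omega)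
    have ham : (2 : ℝ) ^ (i - k) ∈ finiteFloats p q := two_zpow_mem A (by omega) (by omega)
    have hadd : ∀ (e : ℤ) (x : ℝ) (hem : (2 : ℝ) ^ e ∈ finiteFloats p q), e ≤ eMax q → 0 ≤ x →
        x < 2 ^ (e - p - 1) → round p q (2 ^ e + x) = .fin ⟨_, hem⟩ := by
      intro e x hem he hx hx'
      refine round_near_of_binade A (n := 2 ^ p) (e := e) ?_ he (by linarith) ?_
      · push_cast
        rw [← zpow_natCast, ← zpow_add₀ (by norm_num)]
        congr 1; ring
      · rw [add_sub_cancel_left, abs_of_nonneg hx]; exact hx'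
    have hwr : |((⟨r, by simpa using sign_mul_mem hr (one_mem A)⟩ : Flt p q) : ℝ)| ≤ 1 :=
      (abs_eq_one hr).le
    have hy := hpos ⟨_, hkm⟩ (by positivity)
    have hyu := hpos ⟨_, him⟩ (by positivity)
    refine ⟨_, hT.valueUnit_two A (F.core A) (b := ⟨_, hkm⟩) (a := ⟨_, ham⟩) (yₘ := ⟨_, hkm⟩)
      (yᵤ := ⟨_, him⟩) ?_ (hoff _ ?_) h1 ?_ hwr hy.1 hy.2 ?_ hyu.1 hyu.2 ?_ (hac _) h0.1 h0.2⟩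
    · rw [hcm, fin_add]
      simp only
      rw [add_comm]
      refine hadd k 1 hkm (by omega) zero_le_one ?_
      exact one_lt_zpow₀ (by norm_num) (by omega)
    · exact zpow_le_zpow_right₀ (by norm_num) (by omega)
    · simp only
      rw [abs_of_pos (by positivity)]
      exact zpow_le_one_of_nonpos₀ (by norm_num) (by omega)
    · rw [exact_mul A him (by simp only; rw [← zpow_add₀ (by norm_num), sub_add_cancel]), fin_add]
      refine hadd i _ him (by omega) (by positivity) ?_
      exact zpow_lt_zpow_right₀ (by norm_num) (by omega)
    · rw [fin_mul]

/-- The last neuron is saturated in both cases, with value 1 at `u` and 0 elsewhere, so it passes no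
gradient. As values are at most 1, the weight is ±2^i itself, and the bound 2^(p-1) on h keeps h ⊗ w
finite for i ≤ eMax - p. -/
theorem FloatSquash.valueUnit_zero (F : FloatSquash σ σ' c s δ) (A : Adm p q) (hc : c = 0)
    (hH : ∀ x, |(hs x : ℝ)| ≤ 2 ^ (p - 1 : ℤ))
    {T : Tower p q l d 1} {u : {x : Fin d → Flt p q // dom x}} (hT : IsIndicator σ σ' T u) {i : ℤ}
    {r : ℝ} (hr : r = 1 ∨ r = -1) (hi : eMin q - p ≤ i) (hi' : i ≤ eMax q - p) :
    ∃ B : Block p q (l + 1) d, IsValueUnit σ σ' hs B u (r * 2 ^ i) := by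
  have him : (2 : ℝ) ^ i ∈ finiteFloats p q := two_zpow_mem A hi (by omega)
  have h2K : 2 ^ (1 : ℤ) * satur q ∈ finiteFloats p q :=
    satur_mul_mem A (by norm_num) (by norm_num)
  have hone := F.one A (y := .fin ⟨_, satur_mem A⟩) (Or.inr ⟨_, rfl, le_rfl⟩)
  have h1 : ∀ x, IsFin ((ExtFlt.fin (hs x)) ⊗ₑ .fin ⟨_, sign_mul_mem hr him⟩) := fun x => by
    refine isFin_mul_of_abs_le (le_trans ?_ (two_zpow_eMax_le A))
    simp only
    rw [abs_mul, abs_eq_one hr, one_mul, abs_of_pos (show (0 : ℝ) < 2 ^ i by positivity)]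
    have h2 : (0 : ℝ) < 2 ^ eMax q := by positivity
    calc |(hs x : ℝ)| * 2 ^ i ≤ 2 ^ (p - 1 : ℤ) * 2 ^ i := by gcongr; exact hH x
      _ = 2 ^ ((p - 1 : ℤ) + i) := (zpow_add₀ (by norm_num) _ _).symm
      _ ≤ 2 ^ eMax q := zpow_le_zpow_right₀ (by norm_num) (by omega)
      _ ≤ _ := by linarith
  refine ⟨_, hT.valueUnit (w := ⟨_, sign_mul_mem hr him⟩) (w' := ⟨_, neg_mem h2K⟩)
    (b := ⟨_, satur_mem A⟩) A (F.core A) hc ?_ hone.1 ?_ ?_ h1 (fun x => ?_) (fun x => ?_)⟩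
  · rw [hc, show (ExtFlt.fin 0 : ExtFlt p q) = 0 from rfl, mul_zero_fin A (isFin_fin _),
      zero_add' A]
  · rw [fin_mul, mul_one]
  · rw [exact_mul A (neg_mem h2K) (mul_one _)]
    refine Le.add A (Or.inr ⟨_, rfl, le_rfl⟩) (Or.inr ⟨_, rfl, le_rfl⟩) (neg_mem (satur_mem A)) ?_
    simp only [zpow_one]
    linarith
  · rw [hone.2, mul_zero_fin A (h1 x)]; exact isFin_zero
  · rw [hone.2, mul_zero_fin A (h1 x), zero_mul_fin A (isFin_fin _)]; exact isFin_zero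

theorem natCast_mem (A : Adm p q) {n : ℕ} (hn : n ≤ 2 ^ (p + 1)) :
    (n : ℝ) ∈ finiteFloats p q := by
  have hE := A.expRange_ge
  have hp := A.two_mul_le
  have := nat_mul_mem' (q := q) (e := p) hn (by rw [eMin_eq]; omega) (by rw [eMax_eq]; omega)
  simpa using this

/-- For tanh the output away from `u` must come from σ(0) = 0, so the neuron has to cancel exactly
there. The indicator takes the values -1 and 1; 2^p copies with weight -1 and the bias 2^p yield
2^(p+1) at `u` and 0 elsewhere. Copies replace a large weight because γ ⊗ (-1) is always finite. The
gradient that passes at 0 dies in the indicators, which are saturated on both sides. -/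
theorem FloatSquash.valueUnit_neg_one (F : FloatSquash σ σ' c s δ) (A : Adm p q)
    (hc : (c : ℝ) = -1) (hs0 : s = 0) (hH : ∀ x, |(hs x : ℝ)| ≤ 2 ^ (p - 2 : ℤ))
    (hone : σ (round p q (2 ^ (p + 1))) = round p q 1)
    {T : Tower p q l d 1} {u : {x : Fin d → Flt p q // dom x}} (hT : IsIndicator σ σ' T u) {i : ℤ}
    {r : ℝ} (hr : r = 1 ∨ r = -1) (hi : eMin q - p ≤ i) (hi' : i ≤ eMax q - p) :
    ∃ B : Block p q (l + 1) d, IsValueUnit σ σ' hs B u (r * 2 ^ i) := by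
  have him : (2 : ℝ) ^ i ∈ finiteFloats p q := two_zpow_mem A hi (by omega)
  have hpp : (2 : ℝ) ^ p ∈ finiteFloats p q := by
    have := natCast_mem A (n := 2 ^ p) (Nat.pow_le_pow_right (by norm_num) (by omega))
    simpa using this
  have hpp1 : (2 : ℝ) ^ (p + 1) ∈ finiteFloats p q := by
    have := natCast_mem A (n := 2 ^ (p + 1)) le_rfl
    simpa using this
  have h1 : ∀ x, IsFin ((ExtFlt.fin (hs x)) ⊗ₑ .fin ⟨_, sign_mul_mem hr him⟩) := fun x => by
    refine isFin_mul_of_abs_le (le_trans ?_ (two_zpow_eMax_le A))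
    simp only
    rw [abs_mul, abs_eq_one hr, one_mul, abs_of_pos (show (0 : ℝ) < 2 ^ i by positivity)]
    have h2 : (0 : ℝ) < 2 ^ eMax q := by positivity
    calc |(hs x : ℝ)| * 2 ^ i ≤ 2 ^ (p - 2 : ℤ) * 2 ^ i := by gcongr; exact hH x
      _ = 2 ^ ((p - 2 : ℤ) + i) := (zpow_add₀ (by norm_num) _ _).symm
      _ ≤ 2 ^ eMax q := zpow_le_zpow_right₀ (by norm_num) (by omega)
      _ ≤ _ := by linarith
  have hm1 : |((⟨-1, neg_mem (one_mem A)⟩ : Flt p q) : ℝ)| ≤ 1 := by simp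
  -- The partial sums are integers of size at most 2^p, hence exact.
  have hnum : ∀ ε : ℝ, (ε = 1 ∨ ε = -1) → ∀ j : ℕ, j < 2 ^ p →
      round p q (ε * j) ⊕ₑ round p q ε = round p q (ε * (j + 1 : ℕ)) := fun ε hε j hj => by
    have h2 : 2 ^ (p + 1) = 2 * 2 ^ p := by rw [pow_succ]; ring
    rw [round_add_round A (sign_mul_mem hε (natCast_mem A (by omega)))
      (by simpa using sign_mul_mem hε (one_mem A))]
    congr 1
    push_cast; ring
  have key : ∀ (x : {x : Fin d → Flt p q // dom x}) (ε : ℝ), (ε = 1 ∨ ε = -1) → ∀ yI : ExtFlt p q,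
      (∀ g : Flt p q, T.Dead σ σ' (inp x) (.fin g ⊗ₑ σ' yI) yI) → IsFin (σ' yI) → IsFin (σ yI) →
      (ExtFlt.fin ⟨-1, neg_mem (one_mem A)⟩) ⊗ₑ σ yI = round p q ε → ∀ γ : Flt p q,
      ((Block.parAll (Block.trivial l d) (List.replicate (2 ^ p)
        (Block.single T ⟨-1, neg_mem (one_mem A)⟩))).close ⟨_, hpp⟩).Dead σ σ' (inp x) (.fin γ)
        (round p q (ε * (2 ^ p : ℕ)) ⊕ₑ .fin ⟨_, hpp⟩) := by
    intro x ε hε yI hD h2 h3 h4 γ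
    obtain ⟨γ', hγ'⟩ := isFin_mul_of_abs_le_one A hm1 γ
    have hrun : ∀ t s, (Block.single T ⟨-1, neg_mem (one_mem A)⟩).Run σ σ' (inp x) γ s t
        (s ⊕ₑ round p q ε) t := fun t s => by
      rw [← h4]
      exact Tower.Dead.run (by rw [hγ']; exact hD γ') ⟨_, hγ'⟩ h3 h2 s t
    refine Block.Run.closeDead A (fun t => ?_) _
    refine Block.RunList.parAll A (Block.trivial_run A F.val (fun y => (F.der y).isFin) x.1 γ) ?_
    have h5 := Block.RunList.replicate (2 ^ p) (fun j => round p q (ε * j)) (fun _ => t)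
      (B := Block.single T ⟨-1, neg_mem (one_mem A)⟩) (σ := σ) (σ' := σ') (x := inp x) (h := γ)
      (fun j hj => by
        have := hrun t (round p q (ε * j))
        rwa [hnum ε hε j hj] at this)
    rwa [Nat.cast_zero, mul_zero, round_zero A] at h5
  refine ⟨Block.single ((Block.parAll (Block.trivial l d) (List.replicate (2 ^ p)
    (Block.single T ⟨-1, neg_mem (one_mem A)⟩))).close ⟨_, hpp⟩) ⟨_, sign_mul_mem hr him⟩,
    fun x ss t => ?_⟩
  have hder : ∀ y : Flt p q, ∃ γ : Flt p q, (ExtFlt.fin (hs x)) ⊗ₑ .fin ⟨_, sign_mul_mem hr him⟩ ⊗ₑ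
      σ' (.fin y) = .fin γ := fun y => by
    obtain ⟨f, hf⟩ := h1 x
    obtain ⟨g, hg, h2, h3⟩ := F.der y
    rw [hf, hg]
    exact isFin_mul_of_abs_le_one A (abs_le.2 ⟨by linarith, h3⟩) f
  by_cases hx : x = u
  · rw [if_pos hx]
    obtain ⟨yI, h2, h3⟩ := (hT x).2.1 hx
    have hl := F.low yI h2
    obtain ⟨γ, hγ⟩ := hder ⟨_, hpp1⟩
    have h4 := key x 1 (Or.inl rfl) yI (fun g => by
      rw [hl.2, mul_zero_fin A (isFin_fin _)]
      exact Tower.Dead.of_regular A (hT x).1 h3) (by rw [hl.2]; exact isFin_zero)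
      (by rw [hl.1]; exact isFin_fin _) (by rw [hl.1, fin_mul, hc]; norm_num) γ
    have h5 : round p q (1 * (2 ^ p : ℕ)) ⊕ₑ .fin ⟨_, hpp⟩ = .fin ⟨_, hpp1⟩ := by
      rw [one_mul, ← round_of_mem A hpp, round_add_round A (by simpa using hpp) hpp,
        ← round_of_mem A hpp1]
      congr 1
      push_cast; rw [pow_succ]; ring
    rw [h5, ← hγ] at h4
    have h6 : σ (.fin ⟨_, hpp1⟩) = .fin ⟨1, one_mem A⟩ := by
      rw [← round_of_mem A hpp1, hone, round_of_mem A (one_mem A)]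
    have h7 := h4.run (h1 x) ⟨_, h6⟩ (F.der _).isFin ss t
    rw [h6, fin_mul] at h7
    simp only [mul_one] at h7
    exact h7
  · rw [if_neg hx]
    have h3 := (hT x).2.2 hx
    have hh : High (round p q (hiVal q)) := by
      rw [round_of_mem A (hiVal_mem A)]
      refine Or.inr ⟨_, rfl, ?_⟩
      have := satur_le_hiVal A
      have := satur_ge A
      simp only
      linarith
    have hl := F.one A hh
    obtain ⟨γ, hγ⟩ := hder 0
    have h4 := key x (-1) (Or.inr rfl) _ (fun g => by
      rw [hl.2, mul_zero_fin A (isFin_fin _)]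
      exact Tower.Dead.of_regular A (hT x).1 h3) (by rw [hl.2]; exact isFin_zero)
      (by rw [hl.1]; exact isFin_fin _) (by rw [hl.1, fin_mul, mul_one]) γ
    have h5 : round p q (-1 * (2 ^ p : ℕ)) ⊕ₑ .fin ⟨_, hpp⟩ = .fin 0 := by
      rw [← round_of_mem A hpp, round_add_round A (by simpa using neg_mem hpp) hpp]
      push_cast
      rw [neg_one_mul, neg_add_cancel]
      exact round_zero A
    rw [h5, ← hγ] at h4
    have h7 := h4.run (h1 x) ⟨_, F.zero⟩ (F.der _).isFin ss t
    rw [F.zero, hs0, show (ExtFlt.fin 0 : ExtFlt p q) = 0 from rfl, mul_zero_fin A (isFin_fin _),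
      add_zero' A] at h7
    exact h7

end ValueUnits

end FloatNet

namespace FloatNet

open Filter Topology

/-! ### Networks for the two classes of activation functions -/

section Networks

variable {p q d : ℕ} {σ σ' : ExtFlt p q → ExtFlt p q} {c s : Flt p q} {δ : ℤ}

/-- The depth budget with L = n + 9: indicators are available from depth 5 (three detector layers,
coindicator, flip), and value units add one or two neurons. The gradient path uses n + 6 ≥ 6 layers
before the gate. -/
theorem FloatRamp.exists_network (F : FloatRamp σ σ' c) (A : Adm p q)
    {hs : {x : Fin d → Flt p q // ∀ k, |(x k : ℝ)| ≤ 2 ^ (eMax q - 2)} → Flt p q}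
    (hH : ∀ x, |(hs x : ℝ)| ≤ maxFloat p q) {L : ℕ} (hL : 9 ≤ L)
    (hval : ∀ (l : ℕ) (u : {x : Fin d → Flt p q // ∀ k, |(x k : ℝ)| ≤ 2 ^ (eMax q - 2)}),
      (∀ m, l ≤ m → ∃ T : Tower p q m d 1, IsIndicator σ σ' T u) → ∀ (i : ℤ) (r : ℝ), eMin q - p ≤ i → i ≤ eMax q - p → (r = 1 ∨ r = -1) →
      ∃ B : Block p q (l + 1 + 1) d, IsValueUnit σ σ' hs B u (r * 2 ^ i))
    (f : {x : Fin d → Flt p q // ∀ k, |(x k : ℝ)| ≤ 2 ^ (eMax q - 2)} → Flt p q)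
    (g : {x : Fin d → Flt p q // ∀ k, |(x k : ℝ)| ≤ 2 ^ (eMax q - 2)} → Fin d → Flt p q)
    (hg : ∀ u, hs u = 0 → g u = 0) :
    ∃ N : Network p q L d 1,
      ∀ x : {x : Fin d → Flt p q // ∀ k, |(x k : ℝ)| ≤ 2 ^ (eMax q - 2)},
        N.eval σ (inp x) = (fun _ => .fin (f x)) ∧
        N.grad σ σ' (inp x) (fun _ => .fin (hs x)) = fun k => .fin (g x k) := by
  obtain ⟨n, rfl⟩ := Nat.exists_eq_add_of_le' hL
  refine FloatNet.exists_network (l := n + 7) A F.val F.der (fun u i r hi hi' hr => ?_)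
    (fun u hu k i r hi hi' hr => ?_) f g hg
  · exact hval (n + 5) u (fun m hm =>
      exists_indicator A (F.core A) (F.detectors A) u m (by omega)) i r hi hi' hr
  · obtain ⟨ρ, v₀, i₀, hρ⟩ := F.exists_pathBase A u k hi hi' hr
    exact exists_gradUnit A (F.core A) (abs_le.2 ⟨F.c_nonpos.2, F.c_nonpos.1.trans zero_le_one⟩)
      (F.detectors A) (F.pathAct A) hH (m := n + 6) (by omega) (by omega) hu hρ

theorem FloatSquash.exists_network (F : FloatSquash σ σ' c s δ) (A : Adm p q)
    {hs : {x : Fin d → Flt p q // ∀ k, |(x k : ℝ)| ≤ 2 ^ (eMax q - 1)} → Flt p q} {H : ℝ}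
    (hH : ∀ x, |(hs x : ℝ)| ≤ H) (hHδ : H * 2 ^ δ ≤ maxFloat p q) {L : ℕ} (hL : 9 ≤ L)
    (hval : ∀ (l : ℕ) (T : Tower p q l d 1)
      (u : {x : Fin d → Flt p q // ∀ k, |(x k : ℝ)| ≤ 2 ^ (eMax q - 1)}), IsIndicator σ σ' T u →
      ∀ (i : ℤ) (r : ℝ), eMin q - p ≤ i → i ≤ eMax q - p → (r = 1 ∨ r = -1) →
      ∃ B : Block p q (l + 1) d, IsValueUnit σ σ' hs B u (r * 2 ^ i))
    (f : {x : Fin d → Flt p q // ∀ k, |(x k : ℝ)| ≤ 2 ^ (eMax q - 1)} → Flt p q)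
    (g : {x : Fin d → Flt p q // ∀ k, |(x k : ℝ)| ≤ 2 ^ (eMax q - 1)} → Fin d → Flt p q)
    (hg : ∀ u, hs u = 0 → g u = 0) :
    ∃ N : Network p q L d 1,
      ∀ x : {x : Fin d → Flt p q // ∀ k, |(x k : ℝ)| ≤ 2 ^ (eMax q - 1)},
        N.eval σ (inp x) = (fun _ => .fin (f x)) ∧
        N.grad σ σ' (inp x) (fun _ => .fin (hs x)) = fun k => .fin (g x k) := by
  obtain ⟨n, rfl⟩ := Nat.exists_eq_add_of_le' hL
  refine FloatNet.exists_network (l := n + 7) A F.val (fun y => (F.der y).isFin)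
    (fun u i r hi hi' hr => ?_) (fun u hu k i r hi hi' hr => ?_) f g hg
  · obtain ⟨T, hT⟩ := exists_indicator A (F.core A) (F.detectors A) u (n + 6) (by omega)
    exact hval _ T u hT i r hi hi' hr
  · obtain ⟨ρ, v₀, i₀, hρ⟩ := F.exists_pathBase A u k hi hi' hr
    exact exists_gradUnit A (F.core A)
      (abs_le.2 ⟨F.c_bounds.1, F.c_bounds.2.1.trans zero_le_one⟩)
      (F.detectors A) (F.pathAct A hHδ) hH (m := n + 6) (by omega) (by omega) hu hρ

end Networks

/-! ### The six activation functions -/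

section Activations

variable {p q : ℕ}

theorem rounded_relu (A : Adm p q) {σ' : ExtFlt p q → ExtFlt p q}
    (hσ' : IsRoundedDeriv Activation.relu.real σ') {y : Flt p q} (hy : 0 < (y : ℝ)) :
    rounded p q Activation.relu.real (.fin y) = .fin y ∧ σ' (.fin y) = round p q 1 := by
  constructor
  · simp only [rounded, Activation.real]
    rw [max_eq_right hy.le, round_coe A]
  · rw [hσ'.2 _ fun z hz => by cases hz; exact ramp_relu.diff y hy.ne']
    simp only [rounded]
    rw [deriv_relu hy]

/-- ELU is differentiable at 0 with derivative 1, the pre-activation at which its value units rest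
away from `u`; so σ'(0) is determined there. -/
theorem hasDerivAt_elu_zero : HasDerivAt Activation.elu.real 1 0 := by
  have h1 : HasDerivAt Real.exp 1 0 := by simpa using Real.hasDerivAt_exp 0
  have h2 : HasDerivWithinAt Activation.elu.real 1 (Set.Iic 0) 0 := by
    refine (h1.sub_const 1).hasDerivWithinAt.congr (fun y hy => ?_) (by simp [Activation.real])
    rcases (Set.mem_Iic.1 hy).eq_or_lt with rfl | hy
    · simp [Activation.real]
    · exact if_neg (not_le.2 hy)
  have h3 : HasDerivWithinAt Activation.elu.real 1 (Set.Ici 0) 0 :=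
    (hasDerivAt_id 0).hasDerivWithinAt.congr (fun y hy => if_pos hy) (if_pos le_rfl)
  have h4 := h2.union h3
  rwa [Set.Iic_union_Ici, hasDerivWithinAt_univ] at h4

theorem rounded_elu (A : Adm p q) {σ' : ExtFlt p q → ExtFlt p q}
    (hσ' : IsRoundedDeriv Activation.elu.real σ') {y : Flt p q} (hy : 0 ≤ (y : ℝ)) :
    rounded p q Activation.elu.real (.fin y) = .fin y ∧ σ' (.fin y) = round p q 1 := by
  have h1 : HasDerivAt Activation.elu.real 1 (y : ℝ) := by
    rcases hy.eq_or_lt with h | h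
    · rw [← h]; exact hasDerivAt_elu_zero
    · exact (hasDerivAt_id _).congr_of_eventuallyEq (elu_eventuallyEq h)
  constructor
  · simp only [rounded, Activation.real]
    rw [if_pos hy, round_coe A]
  · rw [hσ'.2 _ fun z hz => by cases hz; exact h1.differentiableAt]
    simp only [rounded]
    rw [h1.deriv]

theorem two_zpow_mem_of_small (A : Adm p q) {k : ℤ} (hk : 0 ≤ k) (hk' : k ≤ 3) :
    (2 : ℝ) ^ (-p - k : ℤ) ∈ finiteFloats p q := by
  have hE := A.expRange_ge
  have hp := A.two_mul_le
  have hp' := A.hp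
  exact two_zpow_mem A (by rw [eMin_eq]; omega) (by rw [eMax_eq]; omega)

/-- A small number that an activation function `y * Ψ y` halves. -/
theorem SmoothStep.round_mul (A : Adm p q) {Ψ : ℝ → ℝ} (h : SmoothStep Ψ) :
    round p q (2 ^ (-p - 2 : ℤ) * Ψ (2 ^ (-p - 2 : ℤ))) =
      .fin ⟨2 ^ (-p - 3 : ℤ), two_zpow_mem_of_small A (by norm_num) (by norm_num)⟩ := by
  have hE := A.expRange_ge
  have hy : (0 : ℝ) < 2 ^ (-p - 2 : ℤ) := by positivity
  have h1 : (2 : ℝ) ^ (-p - 3 : ℤ) = 2 ^ (-p - 2 : ℤ) / 2 := by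
    rw [show (-p - 3 : ℤ) = -p - 2 - 1 by ring, zpow_sub_one₀ (by norm_num)]; rfl
  have h2 := h.half_le hy.le
  have h3 := h.mul_lt hy
  -- With y = 2^(-p-2) the value lies in [y/2, y/2 + y²), and y² is exactly half a spacing at y/2.
  -- This fixes the exponent -p-2.
  have h4 : ((2 : ℝ) ^ (-p - 2 : ℤ)) ^ 2 = 2 ^ (-p - 3 - p - 1 : ℤ) := by
    rw [← zpow_natCast, ← zpow_mul]; congr 1; push_cast; ring
  refine round_near_of_binade A (n := 2 ^ p) (e := -p - 3) ?_ (by rw [eMax_eq]; omega) ?_ ?_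
  · push_cast
    rw [← zpow_natCast, ← zpow_add₀ (by norm_num)]
    congr 1; ring
  · rw [h1]; nlinarith
  · rw [← h4, abs_of_nonneg] <;> simp only [h1] <;> nlinarith

theorem SmoothStep.floatRamp (A : Adm p q) {Ψ : ℝ → ℝ} (h : SmoothStep Ψ)
    {σ' : ExtFlt p q → ExtFlt p q} (hσ' : IsRoundedDeriv (fun y => y * Ψ y) σ') :
    FloatRamp (rounded p q fun y => y * Ψ y) σ' 0 :=
  Ramp.floatRamp A hσ' (c := 0) (by rw [coe_zero]; exact h.ramp) (Or.inl coe_zero)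

theorem SmoothStep.valueUnit (A : Adm p q) {Ψ : ℝ → ℝ} (h : SmoothStep Ψ)
    {σ' : ExtFlt p q → ExtFlt p q} (hσ' : IsRoundedDeriv (fun y => y * Ψ y) σ') {d l : ℕ}
    {dom : (Fin d → Flt p q) → Prop} {hs : {x : Fin d → Flt p q // dom x} → Flt p q}
    {T : Tower p q l d 1} {u : {x : Fin d → Flt p q // dom x}}
    (hT : IsIndicator (rounded p q fun y => y * Ψ y) σ' T u) {i : ℤ} {r : ℝ}
    (hi : eMin q - p ≤ i) (hi' : i ≤ eMax q - p) (hr : r = 1 ∨ r = -1) :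
    ∃ B : Block p q (l + 1) d, IsValueUnit (rounded p q fun y => y * Ψ y) σ' hs B u (r * 2 ^ i) := by
  refine (h.floatRamp A hσ').valueUnit_of_small A rfl hT hr hi hi'
    (b := ⟨2 ^ (-p - 2 : ℤ), two_zpow_mem_of_small A (by norm_num) (by norm_num)⟩) rfl rfl
    (h.round_mul A) ?_
  have h2 := abs_le.1 (h.abs_deriv_mul_le (y := 2 ^ (-p - 2 : ℤ)) (by positivity))
  rw [hσ'.2 _ fun z _ => (h.hasDerivAt_mul z).differentiableAt]
  exact round_btw A (neg_mem (two_mem A)) (two_mem A) h2.1 h2.2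

theorem two_zpow_le_half (A : Adm p q) : (2 : ℝ) ^ (1 - p : ℤ) ≤ 1 / 2 := by
  have hp' := A.hp
  calc (2 : ℝ) ^ (1 - p : ℤ) ≤ 2 ^ (-1 : ℤ) := zpow_le_zpow_right₀ (by norm_num) (by omega)
    _ = 1 / 2 := by norm_num

theorem one_half_mem (A : Adm p q) : (1 / 2 : ℝ) ∈ finiteFloats p q := by
  have hE := A.expRange_ge
  have := two_zpow_mem A (i := -1) (by rw [eMin_eq]; omega) (by rw [eMax_eq]; omega)
  simpa using this

theorem floatSquash_sigmoid (A : Adm p q) {σ' : ExtFlt p q → ExtFlt p q}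
    (hσ' : IsRoundedDeriv Activation.sigmoid.real σ') :
    FloatSquash (rounded p q Activation.sigmoid.real) σ' 0 ⟨1 / 2, one_half_mem A⟩ 2 := by
  have h := two_zpow_le_half A
  refine Squash.floatSquash A hσ' (by rw [coe_zero]; exact squash_sigmoid)
    (Or.inl ⟨coe_zero, rfl, rfl⟩) (lt_sigmoid (by positivity) (by linarith)) fun h => ?_
  norm_num at h

theorem floatSquash_tanh (A : Adm p q) {σ' : ExtFlt p q → ExtFlt p q}
    (hσ' : IsRoundedDeriv Activation.tanh.real σ') :
    FloatSquash (rounded p q Activation.tanh.real) σ' ⟨-1, neg_mem (one_mem A)⟩ 0 0 := by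
  have h := two_zpow_le_half A
  have h0 : (0 : ℝ) < 2 ^ (1 - p : ℤ) := by positivity
  have h1 : (2 : ℝ) ^ (1 - p : ℤ) = 4 * 2 ^ (-1 - p : ℤ) := by
    rw [show (4 : ℝ) = 2 ^ (2 : ℤ) by norm_num, ← zpow_add₀ (by norm_num)]; congr 1; ring
  have h2 := lt_tanh h0 (by linarith)
  refine Squash.floatSquash A hσ' (by rw [coe_zero]; exact squash_tanh)
    (Or.inr ⟨rfl, coe_zero, rfl⟩) ?_ fun _ => ?_
  · rw [coe_zero]; linarith
  · linarith

/-- The argument 2^(p+1) need not reach the saturation threshold: the error e^(-2^p) is below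
2^(-p-2), half the spacing just below 1. -/
theorem rounded_tanh_large (A : Adm p q) :
    rounded p q Activation.tanh.real (round p q (2 ^ (p + 1))) = round p q 1 := by
  have hE := A.expRange_ge
  have hp := A.hp
  have hm : (2 : ℝ) ^ (p + 1) ∈ finiteFloats p q := by
    have := natCast_mem A (n := 2 ^ (p + 1)) le_rfl
    simpa using this
  have hle : (4 : ℝ) ≤ 2 ^ (p + 1) := by
    calc (4 : ℝ) = 2 ^ 2 := by norm_num
      _ ≤ _ := pow_le_pow_right₀ (by norm_num) (by omega)
  have h1 := squash_tanh.top _ hle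
  have h2 : Real.exp (-2 ^ (p + 1) / 2) < 2 ^ (-1 - p - 1 : ℤ) := by
    rw [show (-1 - p - 1 : ℤ) = -((p + 2 : ℕ) : ℤ) by push_cast; ring, zpow_neg, zpow_natCast,
      neg_div, Real.exp_neg]
    refine inv_strictAnti₀ (by positivity) ?_
    have h3 : (p : ℝ) + 2 ≤ 2 ^ (p + 1) / 2 := by
      rw [pow_succ, mul_div_assoc, div_self (by norm_num), mul_one]
      obtain ⟨k, rfl⟩ := Nat.exists_eq_add_of_le' hp
      have := one_add_mul_le_pow (a := (1 : ℝ)) (by norm_num) k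
      rw [pow_add]
      push_cast
      norm_num at this ⊢
      linarith [show (0 : ℝ) ≤ k from Nat.cast_nonneg k]
    calc (2 : ℝ) ^ (p + 2) < Real.exp 1 ^ (p + 2) :=
          pow_lt_pow_left₀ (by linarith [Real.exp_one_gt_d9]) (by norm_num) (by omega)
      _ = Real.exp ((p + 2 : ℕ) : ℝ) := Real.exp_one_pow _
      _ ≤ _ := Real.exp_le_exp.2 (by push_cast; exact h3)
  rw [round_of_mem A hm, round_of_mem A (one_mem A)]
  -- The binade is the one below 1, with 1 as its upper end, since tanh approaches 1 from below.
  refine round_near_of_binade A (n := 2 ^ (p + 1)) (e := -1) ?_ (by rw [eMax_eq]; omega) ?_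
    (h1.trans_lt h2)
  · push_cast
    rw [← zpow_natCast, ← zpow_add₀ (by norm_num),
      show ((p + 1 : ℕ) : ℤ) + (-1 - p) = 0 by push_cast; ring, zpow_zero]
  · have h4 := (abs_le.1 (h1.trans_lt h2).le).1
    have h5 : (2 : ℝ) ^ (-1 - p - 1 : ℤ) ≤ 2 ^ (-1 : ℤ) :=
      zpow_le_zpow_right₀ (by norm_num) (by omega)
    norm_num at h4 h5 ⊢
    linarith

end Activations

end FloatNet

/-! ### The theorem -/

open FloatNet in
theorem theorem3p1 (p q : ℕ) (hp : 2 ≤ p) (hpq : p ≤ 2 ^ (q - 2)) (hq : 6 ≤ q)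
    (act : Activation) (σ' : ExtFlt p q → ExtFlt p q) (hσ' : IsRoundedDeriv act.real σ')
    (d : ℕ) (hd : 1 ≤ d)
    (fStar : {x : Fin d → Flt p q // ∀ k, |(x k : ℝ)| ≤ act.inputBound q} → Flt p q)
    (hStar : {x : Fin d → Flt p q // ∀ k, |(x k : ℝ)| ≤ act.inputBound q} → Flt p q)
    (hhStar : ∀ x, |(hStar x : ℝ)| ≤ act.gradBound p q)
    (gStar : (Fin d → Flt p q) → (Fin d → Flt p q))
    (hgStar : ∀ x, hStar x = 0 → gStar x.1 = 0)
    (L : ℕ) (hL : 9 ≤ L) :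
    ∃ N : Network p q L d 1,
      ∀ x : {x : Fin d → Flt p q // ∀ k, |(x k : ℝ)| ≤ act.inputBound q},
        N.eval (rounded p q act.real) (fun k => .fin (x.1 k)) = (fun _ => .fin (fStar x)) ∧
        N.grad (rounded p q act.real) σ' (fun k => .fin (x.1 k)) (fun _ => .fin (hStar x)) =
          fun k => .fin (gStar x.1 k) := by
  have A : Adm p q := ⟨hp, hpq, hq⟩
  have hE := A.expRange_ge
  have hmin := eMin_eq q
  have hmax := eMax_eq q
  have hpe := A.two_mul_le
  have hΩ := two_zpow_eMax_le A
  have hbound : ∀ k : ℤ, k ≤ eMax q → (2 : ℝ) ^ k ≤ maxFloat p q := fun k hk => by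
    have h1 : (2 : ℝ) ^ k ≤ 2 ^ eMax q := zpow_le_zpow_right₀ (by norm_num) hk
    have h2 : (0 : ℝ) < 2 ^ eMax q := by positivity
    linarith
  cases act with
  | relu =>
    have F := Ramp.floatRamp A hσ' (c := 0) (by rw [coe_zero]; exact ramp_relu) (Or.inl coe_zero)
    refine F.exists_network A hhStar hL (fun l u hI i r hi hi' hr => ?_) fStar
      (fun x => gStar x.1) hgStar
    -- Value units with c = 0 need a single neuron behind the indicator, which is therefore taken
    -- one layer deeper than for ELU.
    obtain ⟨T, hT⟩ := hI (l + 1) (Nat.le_succ l)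
    have hm : (2 : ℝ) ^ i ∈ finiteFloats p q := two_zpow_mem A hi (by omega)
    obtain ⟨h1, h2⟩ := rounded_relu A hσ' (y := ⟨_, hm⟩) (by positivity)
    -- ReLU is the identity on all positive floats, so the activation is 2^i itself and the weight
    -- is ±1; the free choice of σ'(0) plays no role.
    exact F.valueUnit_of_deriv A rfl hT hr le_rfl (by omega) (by omega) hm h1 h2
  | elu =>
    have F := Ramp.floatRamp A hσ' (c := ⟨-1, neg_mem (one_mem A)⟩) ramp_elu (Or.inr rfl)
    refine F.exists_network A hhStar hL (fun l u hI i r hi hi' hr => ?_) fStar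
      (fun x => gStar x.1) hgStar
    obtain ⟨T, hT⟩ := hI l le_rfl
    exact F.valueUnit_neg_one A rfl (fun y hy => rounded_elu A hσ' hy) hT hr hi hi'
  | gelu =>
    rw [gelu_eq] at hσ' ⊢
    refine (smoothStep_gaussian.floatRamp A hσ').exists_network A hhStar hL
      (fun l u hI i r hi hi' hr => ?_) fStar (fun x => gStar x.1) hgStar
    obtain ⟨T, hT⟩ := hI (l + 1) (Nat.le_succ l)
    exact smoothStep_gaussian.valueUnit A hσ' hT hi hi' hr
  | swish =>
    rw [swish_eq] at hσ' ⊢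
    refine (smoothStep_sigmoid.floatRamp A hσ').exists_network A hhStar hL
      (fun l u hI i r hi hi' hr => ?_) fStar (fun x => gStar x.1) hgStar
    obtain ⟨T, hT⟩ := hI (l + 1) (Nat.le_succ l)
    exact smoothStep_sigmoid.valueUnit A hσ' hT hi hi' hr
  | sigmoid =>
    refine (floatSquash_sigmoid A hσ').exists_network A hhStar ?_ hL
      (fun l T u hT i r hi hi' hr =>
        (floatSquash_sigmoid A hσ').valueUnit_zero A rfl hhStar hT hr hi hi') fStar
      (fun x => gStar x.1) hgStar
    simp only [Activation.gradBound]
    rw [← zpow_add₀ (by norm_num)]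
    exact hbound _ (by omega)
  | tanh =>
    refine (floatSquash_tanh A hσ').exists_network A hhStar ?_ hL
      (fun l T u hT i r hi hi' hr =>
        (floatSquash_tanh A hσ').valueUnit_neg_one A rfl rfl hhStar (rounded_tanh_large A) hT hr hi
          hi') fStar
      (fun x => gStar x.1) hgStar
    simp only [Activation.gradBound]
    rw [zpow_zero, mul_one]
    exact hbound _ (by omega)
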